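/- Let $G$ be a compact (real, finite-dimensional, smooth, Hausdorff) Lie group with Lie algebra $\mathfrak g$ of dimension $n$, let $e_1,\dots,e_n$ be a basis of $\mathfrak g$, and let $\xi_1,\dots,\xi_n$ be the corresponding linear coordinates on $\mathfrak g^*$, $\xi_i(\eta)=\eta(e_i)$, with Lebesgue measure $d^n\xi$. Let $\mathcal U(\mathfrak g)$ be the universal enveloping algebra, with product $\bullet$, and let $$\sigma_\nu:\mathrm{Pol}(\mathfrak g^*)[\nu]\to\mathcal U(\mathfrak g)[\nu],\qquad \sigma_\nu(\hat x_1\cdots\hat x_k)=\frac{\nu^k}{k!}\sum_{\tau\in S_k}x_{\tau(1)}\bullet\cdots\bullet x_{\tau(k)}\qquad(x_1,\dots,x_k\in\mathfrak g),$$ be the $\nu$-linear total symmetrization map, where $\hat x(\eta)=\eta(x)$. The BCH star product $f\star_{\mathrm{BCH}}g=\sum_{r\ge0}\nu^rC_r(f,g)$ on $C^\infty(\mathfrak g^*)[[\nu]]$ is the unique $\nu$-bilinear product with bidifferential operators $C_r$ on $\mathfrak g^*$ such that $\sigma_\nu(f\star_{\mathrm{BCH}}g)=\sigma_\nu(f)\bullet\sigma_\nu(g)$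 for all polynomials $f,g$; the operator $C_r$ has order at most $r$ in each argument. Then $\star_{\mathrm{BCH}}$ is strongly closed: for all formal power series $f,g\in C_0^\infty(\mathfrak g^*)[[\nu]]$ whose coefficients are (real- or complex-valued) smooth functions with compact support (in particular for all $f,g\in C^\infty_0(\mathfrak g^*)$), $$\int_{\mathfrak g^*}\bigl(f\star_{\mathrm{BCH}}g-g\star_{\mathrm{BCH}}f\bigr)\,d^n\xi=0$$ in every order of $\nu$ (each coefficient of the integrand being integrable). -/

import Mathlib

open MeasureTheory
open scoped Manifold ContDiff

/-- A smooth real Lie group is regular enough for Mathlib's Lie bracket on `GroupLieAlgebra`. -/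
instance minSmoothnessThreeLEInfty : ENat.LEInfty (minSmoothness ℝ 3) :=
  ⟨by
    rw [minSmoothness_of_isRCLikeNormedField]
    exact ENat.LEInfty.out⟩

namespace BCH

noncomputable section

section Algebra

variable {L : Type*} [LieRing L] [LieAlgebra ℝ L] {ι : Type*}

/-- The symmetrized product `(1 / k!) ∑_{τ ∈ S_k} x_{τ(1)} • ⋯ • x_{τ(k)}` in the universal
enveloping algebra. -/
def symmProd {k : ℕ} (x : Fin k → L) : UniversalEnvelopingAlgebra ℝ L :=
  ((k.factorial : ℝ)⁻¹) • ∑ τ : Equiv.Perm (Fin k),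
    (List.ofFn fun j => UniversalEnvelopingAlgebra.ι ℝ (x (τ j))).prod

/-- The symmetrization of the monomial with exponents `m`, the variable `i` standing for the
linear function on the dual given by the basis vector `e i`. -/
def symmMonomial (e : Module.Basis ι ℝ L) (m : ι →₀ ℕ) : UniversalEnvelopingAlgebra ℝ L :=
  symmProd fun j : Fin (Finsupp.toMultiset m).toList.length =>
    e ((Finsupp.toMultiset m).toList.get j)

/-- `σ_ν` on polynomials not involving `ν`: a monomial of degree `k` is sent to `ν ^ k` times its
symmetrization. -/
def sigmaPoly (e : Module.Basis ι ℝ L) :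
    MvPolynomial ι ℝ →ₗ[ℝ] Polynomial (UniversalEnvelopingAlgebra ℝ L) :=
  (MvPolynomial.basisMonomials ι ℝ).constr ℝ fun m =>
    Polynomial.monomial m.degree (symmMonomial e m)

/-- The total symmetrization map `σ_ν : Pol(L*)[ν] → U(L)[ν]`, extended `ν`-linearly. Polynomials
on the dual of `L` are written in the linear coordinates `ξ i = ξ (e i)`, and the polynomial
variable of `Polynomial` is the formal parameter `ν`. -/
def sigmaNu (e : Module.Basis ι ℝ L) (p : Polynomial (MvPolynomial ι ℝ)) :
    Polynomial (UniversalEnvelopingAlgebra ℝ L) :=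
  p.sum fun a q => Polynomial.X ^ a * sigmaPoly e q

/-- The BCH star product of two polynomials: the element of `Pol(L*)[ν]` with
`σ_ν (p ⋆ q) = σ_ν p • σ_ν q`. By the Poincaré–Birkhoff–Witt theorem `σ_ν` is injective and its
range is a subalgebra, so `Function.invFun` is the inverse on the element it is applied to. -/
def polyStar (e : Module.Basis ι ℝ L) (p q : MvPolynomial ι ℝ) : Polynomial (MvPolynomial ι ℝ) :=
  Function.invFun (sigmaNu e)
    (sigmaNu e (Polynomial.C p) * sigmaNu e (Polynomial.C q))

/-- The coefficient (times `k! l!`) in front of `∂_{i 1} ⋯ ∂_{i k} f · ∂_{j 1} ⋯ ∂_{j l} g`, at the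
point with coordinates `ξ`, of the `r`-th bidifferential operator of the star product: the value at
`ξ` of the `ν ^ r`-part of the star product of the corresponding monomials centred at `ξ`. -/
def symbol (e : Module.Basis ι ℝ L) (r : ℕ) {k l : ℕ} (i : Fin k → ι) (j : Fin l → ι)
    (ξ : ι → ℝ) : ℝ :=
  MvPolynomial.eval ξ
    ((polyStar e (∏ a, (MvPolynomial.X (i a) - MvPolynomial.C (ξ (i a))))
      (∏ b, (MvPolynomial.X (j b) - MvPolynomial.C (ξ (j b))))).coeff r)

/-- Linear coordinates on the dual: `(ξ i)` corresponds to the functional `x ↦ ∑ i, ξ i * x i`,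
where `x = ∑ i, x i • e i`, i.e. to `∑ i, ξ i • e^i` for the dual basis `e^i`. -/
def dualCoords (e : Module.Basis ι ℝ L) : (ι → ℝ) ≃ₗ[ℝ] Module.Dual ℝ L :=
  e.constr ℝ

end Algebra

section Analysis

variable {L : Type*} [LieRing L] [LieAlgebra ℝ L] {ι : Type*} [Fintype ι]
  {𝕜 : Type*} [RCLike 𝕜]

/-- Smooth compactly supported functions on the dual of a finite-dimensional Lie algebra. -/
def IsTestFunction (e : Module.Basis ι ℝ L) (f : Module.Dual ℝ L → 𝕜) : Prop :=
  ContDiff ℝ ∞ (f ∘ dualCoords e) ∧ HasCompactSupport (f ∘ dualCoords e)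

/-- The iterated partial derivative `∂_{i 1} ⋯ ∂_{i k} f` with respect to the coordinates `ξ`. -/
def partialD (e : Module.Basis ι ℝ L) {k : ℕ} (i : Fin k → ι) (f : Module.Dual ℝ L → 𝕜)
    (ξ : ι → ℝ) : 𝕜 :=
  iteratedFDeriv ℝ k (f ∘ dualCoords e) ξ fun a => Pi.basisFun ℝ ι (i a)

/-- The `r`-th bidifferential operator `C_r` of the BCH star product, of order at most `r` in each
argument. It is the only bidifferential operator which on polynomials is the `ν ^ r`-part of
`polyStar`: this is the Taylor expansion of both arguments at the point of evaluation. -/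
def cochain (e : Module.Basis ι ℝ L) (r : ℕ) (f g : Module.Dual ℝ L → 𝕜) :
    Module.Dual ℝ L → 𝕜 := fun η =>
  let ξ : ι → ℝ := (dualCoords e).symm η
  ∑ k ∈ Finset.range (r + 1), ∑ l ∈ Finset.range (r + 1),
    ∑ i : Fin k → ι, ∑ j : Fin l → ι,
      (((k.factorial : ℝ)⁻¹ * (l.factorial : ℝ)⁻¹ * symbol e r i j ξ : ℝ) : 𝕜) *
        (partialD e i f ξ * partialD e j g ξ)

/-- The BCH star product `f ⋆ g = ∑_r ν ^ r C_r(f, g)` on formal power series in `ν` whose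
coefficients are functions on the dual of `L`, extended `ν`-bilinearly. -/
def bchStar (e : Module.Basis ι ℝ L) (F G : PowerSeries (Module.Dual ℝ L → 𝕜)) :
    PowerSeries (Module.Dual ℝ L → 𝕜) :=
  PowerSeries.mk fun r =>
    ∑ s ∈ Finset.HasAntidiagonal.antidiagonal r, ∑ t ∈ Finset.HasAntidiagonal.antidiagonal s.2,
      cochain e s.1 (PowerSeries.coeff t.1 F) (PowerSeries.coeff t.2 G)

end Analysis

end

end BCH

namespace BCH

noncomputable section

open Finset.HasAntidiagonal (antidiagonal)

/-! ### Polarization: the powers of linear elements span -/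

section VectorPolynomials

/-! Powers `ẑ ^ d` of linear functions span all polynomials, and `σ_ν(ẑ ^ d) = (ν z) ^ d`, so star
multiplication by `ẑ ^ d` is the `d`-th power of star multiplication by `ẑ`. Left star
multiplication by `ẑ` is an explicit series of differential operators `L_z = ∑ ν ^ m (B_m / m!) ∑
[e_{i m}, …, [e_{i 1}, z]] ∂_{i 1} ⋯ ∂_{i m}` (`intertwines_leftSeries`), and right multiplication
is `R_z = L_z + ν V_z`, where `V_z = ∑ [e_i, z] ∂_i` is a coadjoint vector field
(`intertwines_rightSeries`). Associativity of the enveloping algebra makes `L_z` and `R_z` commute,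
hence `φ ⋆ ẑ ^ d - ẑ ^ d ⋆ φ = (R_z ^ d - L_z ^ d) φ = ν V_z (∑ R_z ^ i L_z ^ (d - 1 - i) φ)`. The
divergence of `V_z` is constant and equals the trace of `ad z` up to sign. If the Lie algebra is
unimodular, the right side integrates to zero for compactly supported `φ`
(`integ_smoothCochain_pow`).

To replace `ẑ ^ d` by a smooth function `g`, integrate by parts: the integral of `φ ⋆ g - g ⋆ φ` is,
in each order of `ν`, the integral of `g` against a fixed test function. That function is orthogonal
to all polynomials, so it vanishes by Stone–Weierstrass (`integ_smoothCochain_comm`). The same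
density argument shows that an identity between differential operators with polynomial coefficients
holds on smooth functions once it holds on polynomials (`weylAlgebra_snd_eq`).

The star product makes sense on polynomials because `σ_ν` is injective with range closed under
products. Injectivity comes from a representation: a Bernoulli number identity gives `[L_x, L_y] = ν
L_{[x, y]}`, so `x ↦ ν⁻¹ L_x` extends to the enveloping algebra, and letting `z ^ k` act on the
constant `1` returns `ν ^ (-k) ẑ ^ k` (`sigmaNu_injective`).

Unimodularity is where compactness enters. The function `|det Ad|` is multiplicative and bounded on
a compact group, so it is identically `1`. Hence left and right translations have equal squared
Jacobians in the chart at the identity, and differentiating there gives `tr (ad x) = 0`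
(`sum_repr_bracket_eq_zero`). -/

theorem eq_zero_of_forall_sum_pow_smul {V : Type*} [AddCommGroup V] [Module ℝ V] {n : ℕ}
    {u : ℕ → V} (h : ∀ ε : ℝ, ∑ i ∈ Finset.range n, ε ^ i • u i = 0) {i : ℕ} (hi : i < n) :
    u i = 0 := by
  -- Linear functionals separate points, so the claim reduces to a real polynomial all of whose
  -- values vanish.
  rw [← Module.forall_dual_apply_eq_zero_iff ℝ]
  intro φ
  have hp : (∑ i ∈ Finset.range n, Polynomial.monomial i (φ (u i))) = 0 := by
    refine Polynomial.funext fun ε => ?_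
    have := congrArg φ (h ε)
    simpa [Polynomial.eval_finsetSum, mul_comm] using this
  have := congrArg (fun p => Polynomial.coeff p i) hp
  simpa [Polynomial.finsetSum_coeff, Polynomial.coeff_monomial, hi] using this

end VectorPolynomials

section SpanPowers

variable {L : Type*} [AddCommGroup L] [Module ℝ L] {A : Type*} [CommRing A] [Algebra ℝ A]

/-- Polarization: `φ (ε • w + z) ^ (k + 1)` lies in the span for every `ε`, so modulo the span a
polynomial in `ε` vanishes identically. Its linear coefficient is `(k + 1) * φ w * φ z ^ k`. -/
theorem mul_mem_span_powers (φ : L →ₗ[ℝ] A) (w : L) {a : A}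
    (ha : a ∈ Submodule.span ℝ {a | ∃ z k, φ z ^ k = a}) :
    φ w * a ∈ Submodule.span ℝ {a | ∃ z k, φ z ^ k = a} := by
  set V := Submodule.span ℝ {a | ∃ z k, φ z ^ k = a} with hV
  induction ha using Submodule.span_induction with
  | zero => simp
  | add x y _ _ hx hy => rw [mul_add]; exact V.add_mem hx hy
  | smul c x _ hx => rw [mul_smul_comm]; exact V.smul_mem c hx
  | mem x hx =>
    obtain ⟨z, k, rfl⟩ := hx
    have key := eq_zero_of_forall_sum_pow_smul (n := k + 2)
      (u := fun i => V.mkQ (((k + 1).choose i : ℝ) • (φ w ^ i * φ z ^ (k + 1 - i)))) (i := 1)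
      (fun ε => by
        have h1 : φ (ε • w + z) ^ (k + 1) ∈ V := Submodule.subset_span ⟨_, _, rfl⟩
        rw [← V.ker_mkQ, LinearMap.mem_ker] at h1
        rw [← h1, map_add, add_pow, map_sum]
        refine Finset.sum_congr rfl fun i _ => ?_
        rw [← map_smul]
        congr 1
        rw [map_smul, smul_pow]
        simp only [Algebra.smul_def, map_natCast]
        ring) (by omega)
    rw [← LinearMap.mem_ker, V.ker_mkQ] at key
    have h2 := V.smul_mem (((k + 1).choose 1 : ℝ)⁻¹) key
    rwa [smul_smul, inv_mul_cancel₀ (by simp; positivity), one_smul, pow_one,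
      Nat.add_sub_cancel] at h2

theorem span_powers_eq_top (φ : L →ₗ[ℝ] A) (h : Algebra.adjoin ℝ (Set.range φ) = ⊤) :
    Submodule.span ℝ {a | ∃ z k, φ z ^ k = a} = ⊤ := by
  refine eq_top_iff.2 fun a _ => ?_
  suffices ∀ a ∈ Algebra.adjoin ℝ (Set.range φ),
      ∀ v ∈ Submodule.span ℝ {a | ∃ z k, φ z ^ k = a},
      a * v ∈ Submodule.span ℝ {a | ∃ z k, φ z ^ k = a} by
    simpa using this a (h ▸ Algebra.mem_top) 1 (Submodule.subset_span ⟨0, 0, by simp⟩)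
  intro a ha
  induction ha using Algebra.adjoin_induction with
  | mem x hx => obtain ⟨w, rfl⟩ := hx; exact fun v hv => mul_mem_span_powers φ w hv
  | algebraMap r => intro v hv; rw [← Algebra.smul_def]; exact Submodule.smul_mem _ _ hv
  | add x y _ _ hx hy => intro v hv; rw [add_mul]; exact Submodule.add_mem _ (hx v hv) (hy v hv)
  | mul x y _ _ hx hy => intro v hv; rw [mul_assoc]; exact hx _ (hy v hv)

end SpanPowers

/-! ### Two identities for Bernoulli numbers -/

section Bernoulli

/-- The Taylor coefficients of `t / (exp t - 1)`. -/
def bern (m : ℕ) : ℝ := algebraMap ℚ ℝ (bernoulli m / m.factorial)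

theorem bern_zero : bern 0 = 1 := by simp [bern]

open PowerSeries MvPolynomial in
theorem coeff_bernoulliPowerSeries_eq (m : ℕ) :
    coeff m (bernoulliPowerSeries (MvPolynomial (Fin 2) ℝ)) = MvPolynomial.C (bern m) := by
  simp only [bernoulliPowerSeries, coeff_mk, bern]
  rw [← MvPolynomial.algebraMap_eq, ← IsScalarTower.algebraMap_apply]

open PowerSeries in
theorem rescale_bernoulli_mul {R : Type*} [CommRing R] [Algebra ℚ R] (s : R) :
    rescale s (bernoulliPowerSeries R) * (rescale s (exp R) - 1) = C s * X := by
  have := congrArg (rescale s) (bernoulliPowerSeries_mul_exp_sub_one R)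
  simpa [rescale_X] using this

open PowerSeries in
theorem rescale_exp_sub_one_ne_zero {R : Type*} [CommRing R] [Algebra ℚ R] {s : R} (hs : s ≠ 0) :
    rescale s (exp R) - 1 ≠ 0 := by
  intro h
  have := congrArg (coeff 1) h
  simp [coeff_one, coeff_exp] at this
  exact hs this

open PowerSeries in
-- The three series are values of `u / (exp u - 1)` at `sX`, `tX` and `(s + t)X`. Clearing the
-- denominators `exp(sX) - 1` and `exp(tX) - 1`, nonzero elements of a domain, leaves a consequence
-- of `exp(sX) exp(tX) = exp((s + t)X)`.
theorem bernoulli_functional_equation {R : Type*} [CommRing R] [IsDomain R] [Algebra ℚ R] {s t : R}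
    (hs : s ≠ 0) (ht : t ≠ 0) :
    C s * (rescale t (bernoulliPowerSeries R) *
        (rescale (s + t) (bernoulliPowerSeries R) - rescale s (bernoulliPowerSeries R))) +
      C t * (rescale s (bernoulliPowerSeries R) *
        (rescale (s + t) (bernoulliPowerSeries R) - rescale t (bernoulliPowerSeries R))) =
      - (C (s * t) * (X * rescale (s + t) (bernoulliPowerSeries R))) := by
  have h1 := rescale_bernoulli_mul s
  have h2 := rescale_bernoulli_mul t
  have h3 := rescale_bernoulli_mul (s + t)
  rw [← exp_mul_exp_eq_exp_add, map_add] at h3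
  have e1 := rescale_exp_sub_one_ne_zero hs
  have e2 := rescale_exp_sub_one_ne_zero ht
  rw [map_mul]
  set Bs := rescale s (bernoulliPowerSeries R)
  set Bt := rescale t (bernoulliPowerSeries R)
  set B := rescale (s + t) (bernoulliPowerSeries R)
  set Es := rescale s (exp R)
  set Et := rescale t (exp R)
  refine mul_left_cancel₀ (mul_ne_zero e1 e2) ?_
  linear_combination (C s * (Es - 1) * (B - Bs) - C s * C t * X) * h2
    + (C t * (Et - 1) * (B - Bt) - C s * C t * X) * h1 + C s * C t * X * h3

section MvPoly
open MvPolynomial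

local notation "𝕊" => (X 0 : MvPolynomial (Fin 2) ℝ)
local notation "𝕋" => (X 1 : MvPolynomial (Fin 2) ℝ)

theorem X_sub_X_ne_zero : 𝕊 - 𝕋 ≠ 0 := fun h => by
  have := congrArg (MvPolynomial.eval ![(1 : ℝ), 0]) h
  norm_num at this

/-- The identity on Bernoulli numbers that makes left star multiplication by linear functions a
representation. -/
theorem bern_commutator_identity (N : ℕ) :
    ∑ p ∈ antidiagonal N, C (bern (p.1 + 1) * bern p.2) *
      ∑ q ∈ antidiagonal p.1,
        (𝕊 + 𝕋) ^ q.1 * (𝕊 ^ q.2 * 𝕋 ^ p.2 + 𝕊 ^ p.2 * 𝕋 ^ q.2) =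
      - (C (bern N) * (𝕊 + 𝕋) ^ N) := by
  -- The coefficient at `N + 1` is homogeneous of degree `N + 2` in `𝕊` and `𝕋`; cancelling `𝕊 * 𝕋`
  -- leaves degree `N`. The inner sums are divided differences of `(N + 1)`-type powers, evaluated
  -- by `geom`.
  have h := congrArg (PowerSeries.coeff (N + 1)) (bernoulli_functional_equation
    (X_ne_zero (R := ℝ) (0 : Fin 2)) (X_ne_zero (R := ℝ) (1 : Fin 2)))
  simp only [map_add, map_neg, PowerSeries.coeff_C_mul, PowerSeries.coeff_succ_X_mul] at h
  simp only [PowerSeries.coeff_mul, map_sub, PowerSeries.coeff_rescale,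
    coeff_bernoulliPowerSeries_eq] at h
  simp only [Finset.Nat.sum_antidiagonal_succ', pow_zero, one_mul, sub_self, mul_zero,
    zero_add] at h
  rw [← Finset.Nat.sum_antidiagonal_swap, ← Finset.Nat.sum_antidiagonal_swap (n := N) (f := fun x =>
    𝕊 ^ x.1 * C (bern x.1) * ((𝕊 + 𝕋) ^ (x.2 + 1) * C (bern (x.2 + 1)) -
      𝕋 ^ (x.2 + 1) * C (bern (x.2 + 1))))] at h
  simp only [Prod.fst_swap, Prod.snd_swap] at h
  refine mul_left_cancel₀ (mul_ne_zero (X_ne_zero (R := ℝ) (0 : Fin 2))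
    (X_ne_zero (R := ℝ) (1 : Fin 2))) ?_
  have geom : ∀ (m : ℕ) (u : MvPolynomial (Fin 2) ℝ),
      (𝕊 + 𝕋 - u) * ∑ q ∈ antidiagonal m, (𝕊 + 𝕋) ^ q.1 * u ^ q.2 =
        (𝕊 + 𝕋) ^ (m + 1) - u ^ (m + 1) := fun m u => by
    rw [← (Commute.all _ _).mul_geom_sum₂,
      Finset.Nat.sum_antidiagonal_eq_sum_range_succ fun i j => (𝕊 + 𝕋) ^ i * u ^ j]
    simp
  refine Eq.trans ?_ (h.trans (by ring))
  rw [Finset.mul_sum, Finset.mul_sum, Finset.mul_sum, ← Finset.sum_add_distrib]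
  refine Finset.sum_congr rfl fun p _ => ?_
  have hs : ∑ q ∈ antidiagonal p.1,
        (𝕊 + 𝕋) ^ q.1 * (𝕊 ^ q.2 * 𝕋 ^ p.2 + 𝕊 ^ p.2 * 𝕋 ^ q.2) =
      𝕋 ^ p.2 * ∑ q ∈ antidiagonal p.1, (𝕊 + 𝕋) ^ q.1 * 𝕊 ^ q.2 +
      𝕊 ^ p.2 * ∑ q ∈ antidiagonal p.1, (𝕊 + 𝕋) ^ q.1 * 𝕋 ^ q.2 := by
    rw [Finset.mul_sum, Finset.mul_sum, ← Finset.sum_add_distrib]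
    exact Finset.sum_congr rfl fun q _ => by ring
  rw [hs, C_mul]
  linear_combination C (bern (p.1 + 1)) * C (bern p.2) *
    (𝕊 * 𝕋 ^ p.2 * geom p.1 𝕊 + 𝕋 * 𝕊 ^ p.2 * geom p.1 𝕋)

/-- The identity on Bernoulli numbers behind the formula for `x • σ(y ^ k)`. -/
theorem bern_multiplication_identity (k : ℕ) :
    ∑ p ∈ antidiagonal k, C (bern p.1 * ((p.2 + 1).factorial : ℝ)⁻¹) *
      ((𝕊 - 𝕋) ^ p.1 * ∑ q ∈ antidiagonal p.2, 𝕊 ^ q.1 * 𝕋 ^ q.2) =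
      C ((k.factorial : ℝ)⁻¹) * 𝕋 ^ k := by
  -- Later `𝕊` and `𝕋` act as left and right multiplication by `y`, so that `𝕊 - 𝕋` acts as `ad y`.
  -- The identity says that the Bernoulli series in `𝕊 - 𝕋` inverts the divided difference of the
  -- exponential, up to the factor `exp 𝕋`.
  have h : PowerSeries.rescale (𝕊 - 𝕋) (bernoulliPowerSeries _) *
      (PowerSeries.rescale 𝕊 (PowerSeries.exp _) - PowerSeries.rescale 𝕋 (PowerSeries.exp _)) =
      PowerSeries.C (𝕊 - 𝕋) * (PowerSeries.X * PowerSeries.rescale 𝕋 (PowerSeries.exp _)) := by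
    have h1 := rescale_bernoulli_mul (𝕊 - 𝕋)
    have h2 := PowerSeries.exp_mul_exp_eq_exp_add (𝕊 - 𝕋) 𝕋
    rw [sub_add_cancel] at h2
    rw [← h2]
    linear_combination PowerSeries.rescale 𝕋 (PowerSeries.exp _) * h1
  have hq : ∀ m : ℕ, algebraMap ℚ (MvPolynomial (Fin 2) ℝ) (1 / (m.factorial : ℚ)) =
      C ((m.factorial : ℝ)⁻¹) := fun m => by
    rw [IsScalarTower.algebraMap_apply ℚ ℝ, MvPolynomial.algebraMap_eq]
    simp
  replace h := congrArg (PowerSeries.coeff (k + 1)) h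
  simp only [PowerSeries.coeff_C_mul, PowerSeries.coeff_succ_X_mul] at h
  simp only [PowerSeries.coeff_mul, map_sub, PowerSeries.coeff_rescale,
      coeff_bernoulliPowerSeries_eq, PowerSeries.coeff_exp, hq] at h
  rw [Finset.Nat.sum_antidiagonal_succ'] at h
  simp only [pow_zero, sub_self, mul_zero, zero_add] at h
  refine mul_left_cancel₀ X_sub_X_ne_zero ?_
  refine Eq.trans ?_ (h.trans (by ring))
  rw [Finset.mul_sum]
  refine Finset.sum_congr rfl fun p _ => ?_
  have geom : (𝕊 - 𝕋) * ∑ q ∈ antidiagonal p.2, 𝕊 ^ q.1 * 𝕋 ^ q.2 =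
        𝕊 ^ (p.2 + 1) - 𝕋 ^ (p.2 + 1) := by
    rw [← (Commute.all _ _).mul_geom_sum₂,
      Finset.Nat.sum_antidiagonal_eq_sum_range_succ fun i j => 𝕊 ^ i * 𝕋 ^ j]
    simp
  rw [C_mul]
  linear_combination C (bern p.1) * C ((p.2 + 1).factorial : ℝ)⁻¹ * (𝕊 - 𝕋) ^ p.1 * geom

end MvPoly

end Bernoulli

end

end BCH

namespace BCH

noncomputable section

open Finset.HasAntidiagonal (antidiagonal)

/-! ### The operators of star multiplication by a linear function -/

section OrderOperators

theorem descFactorial_mul_descFactorial_sub (k a b : ℕ) :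
    k.descFactorial (a + b) = k.descFactorial a * (k - a).descFactorial b := by
  rw [← Nat.descFactorial_mul_descFactorial (Nat.le_add_right a b), Nat.add_sub_cancel_left,
    mul_comm]

variable {L : Type*} [LieRing L] [LieAlgebra ℝ L] {ι : Type*} [Fintype ι]
  (e : Module.Basis ι ℝ L)

/-- For elements `X i` and `D i` of an algebra, thought of as multiplication by coordinates and
partial derivatives, the element `∑_{i} [e_{i 1}, …, [e_{i m}, x]] D_{i 1} ⋯ D_{i m}`. -/
def orderOp {A : Type*} [Ring A] [Algebra ℝ A] (X D : ι → A) : ℕ → L →ₗ[ℝ] A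
  | 0 => e.constr ℝ X
  | m + 1 => ∑ i, LinearMap.mulRight ℝ (D i) ∘ₗ orderOp X D m ∘ₗ (LieAlgebra.ad ℝ L (e i) :)

theorem orderOp_zero {A : Type*} [Ring A] [Algebra ℝ A] (X D : ι → A) (x : L) :
    orderOp e X D 0 x = e.constr ℝ X x := rfl

theorem orderOp_succ {A : Type*} [Ring A] [Algebra ℝ A] (X D : ι → A) (m : ℕ) (x : L) :
    orderOp e X D (m + 1) x = ∑ i, orderOp e X D m ⁅e i, x⁆ * D i := by
  simp [orderOp]

theorem constr_apply_eq_sum {A : Type*} [Ring A] [Algebra ℝ A] (X : ι → A) (x : L) :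
    e.constr ℝ X x = ∑ i, e.repr x i • X i := by
  simp [Module.Basis.constr_apply_fintype]

theorem map_orderOp {A B : Type*} [Ring A] [Algebra ℝ A] [Ring B] [Algebra ℝ B] (F : A →ₐ[ℝ] B)
    (X D : ι → A) (m : ℕ) (x : L) :
    F (orderOp e X D m x) = orderOp e (fun i => F (X i)) (fun i => F (D i)) m x := by
  induction m generalizing x with
  | zero => simp [orderOp_zero]
  | succ m ih => simp [orderOp_succ, ih]

theorem orderOp_mem {A : Type*} [Ring A] [Algebra ℝ A] (W : Subalgebra ℝ A) {X D : ι → A}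
    (hX : ∀ i, X i ∈ W) (hD : ∀ i, D i ∈ W) (m : ℕ) (x : L) : orderOp e X D m x ∈ W := by
  induction m generalizing x with
  | zero =>
    rw [orderOp_zero, constr_apply_eq_sum]
    exact Subalgebra.sum_mem _ fun i _ => Subalgebra.smul_mem _ (hX i) _
  | succ m ih =>
    rw [orderOp_succ]
    exact Subalgebra.sum_mem _ fun i _ => Subalgebra.mul_mem _ (ih _) (hD i)

/-- The formal operator of left star multiplication by the linear function `x`. -/
def leftSeries {A : Type*} [Ring A] [Algebra ℝ A] (X D : ι → A) (x : L) : PowerSeries A :=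
  PowerSeries.mk fun m => bern m • orderOp e X D m x

/-- The formal operator of right star multiplication by the linear function `x`. -/
def rightSeries {A : Type*} [Ring A] [Algebra ℝ A] (X D : ι → A) (x : L) : PowerSeries A :=
  leftSeries e X D x + PowerSeries.X * PowerSeries.C (orderOp e X D 1 x)

/-- The linear function on the dual of `L` given by an element of `L`. -/
def linForm : L →ₗ[ℝ] MvPolynomial ι ℝ := e.constr ℝ MvPolynomial.X

/-- Multiplication by a coordinate. -/
def mulX (i : ι) : Module.End ℝ (MvPolynomial ι ℝ) := LinearMap.mulLeft ℝ (MvPolynomial.X i)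

/-- A partial derivative of polynomials. -/
def pderivEnd (i : ι) : Module.End ℝ (MvPolynomial ι ℝ) :=
  (MvPolynomial.pderiv i : Derivation ℝ (MvPolynomial ι ℝ) (MvPolynomial ι ℝ))

theorem pderivEnd_apply (i : ι) (p : MvPolynomial ι ℝ) :
    pderivEnd i p = MvPolynomial.pderiv i p := rfl

theorem linForm_eq_sum (x : L) :
    linForm e x = ∑ i, e.repr x i • (MvPolynomial.X i : MvPolynomial ι ℝ) :=
  constr_apply_eq_sum e _ x

theorem linForm_basis (i : ι) : linForm e (e i) = MvPolynomial.X i := by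
  simp only [linForm, Module.Basis.constr_basis]

theorem pderiv_linForm (i : ι) (x : L) :
    MvPolynomial.pderiv i (linForm e x) = MvPolynomial.C (e.repr x i) := by
  classical
  simp [linForm_eq_sum, MvPolynomial.pderiv_X, Pi.single_apply, MvPolynomial.smul_eq_C_mul]

theorem adjoin_linForm : Algebra.adjoin ℝ (Set.range (linForm e)) = ⊤ := by
  rw [eq_top_iff, ← MvPolynomial.adjoin_range_X]
  refine Algebra.adjoin_mono ?_
  rintro _ ⟨i, rfl⟩
  exact ⟨e i, linForm_basis e i⟩

theorem span_linForm_pow : Submodule.span ℝ {a | ∃ z k, linForm e z ^ k = a} = ⊤ :=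
  span_powers_eq_top _ (adjoin_linForm e)

/-- The operators of `orderOp` on polynomials. -/
abbrev polyOp (m : ℕ) (x : L) : Module.End ℝ (MvPolynomial ι ℝ) := orderOp e mulX pderivEnd m x

theorem polyOp_zero (x : L) (p : MvPolynomial ι ℝ) : polyOp e 0 x p = linForm e x * p := by
  simp [polyOp, orderOp_zero, linForm_eq_sum, Finset.sum_mul, mulX]

theorem polyOp_succ (m : ℕ) (x : L) (p : MvPolynomial ι ℝ) :
    polyOp e (m + 1) x p = ∑ i, polyOp e m ⁅e i, x⁆ (MvPolynomial.pderiv i p) := by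
  simp [polyOp, orderOp_succ, pderivEnd_apply]

/-- A derivative of a power of `ẑ` in direction `i` produces the coordinate `e.repr z i`.
Contracting it with `e i` restores `z`, so on powers of linear forms the index sums collapse to
iterated `ad z`. -/
theorem sum_polyOp_smul (m : ℕ) (x z : L) (p : MvPolynomial ι ℝ) :
    ∑ i, polyOp e m ⁅e i, x⁆ (e.repr z i • p) = polyOp e m ⁅z, x⁆ p := by
  have h : ⁅z, x⁆ = ∑ i, e.repr z i • ⁅e i, x⁆ := by
    conv_lhs => rw [← e.sum_repr z, sum_lie]
    simp
  simp only [h, map_sum, LinearMap.sum_apply, map_smul, LinearMap.smul_apply]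

theorem pderiv_linForm_pow (i : ι) (z : L) (k : ℕ) :
    MvPolynomial.pderiv i (linForm e z ^ k) = e.repr z i • ((k : ℝ) • linForm e z ^ (k - 1)) := by
  rw [Derivation.leibniz_pow, pderiv_linForm]
  rw [nsmul_eq_mul, MvPolynomial.smul_eq_C_mul, MvPolynomial.smul_eq_C_mul, map_natCast,
      smul_eq_mul]
  ring

/-- The iterated adjoint action `(ad z) ^ m`. -/
def adPow (m : ℕ) (z : L) : Module.End ℝ L := LieAlgebra.ad ℝ L z ^ m

theorem adPow_zero (z x : L) : adPow 0 z x = x := rfl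

theorem adPow_succ (m : ℕ) (z x : L) : adPow (m + 1) z x = adPow m z ⁅z, x⁆ := by
  rw [adPow, pow_succ]; rfl

theorem adPow_succ' (m : ℕ) (z x : L) : adPow (m + 1) z x = ⁅z, adPow m z x⁆ := by
  rw [adPow, pow_succ']; rfl

theorem polyOp_succ_pow (m : ℕ) (x z : L) (k : ℕ) :
    polyOp e (m + 1) x (linForm e z ^ k) =
      (k : ℝ) • polyOp e m ⁅z, x⁆ (linForm e z ^ (k - 1)) := by
  rw [polyOp_succ]
  simp only [pderiv_linForm_pow, sum_polyOp_smul]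
  rw [map_smul]

theorem polyOp_linForm_pow (m : ℕ) (x z : L) (k : ℕ) :
    polyOp e m x (linForm e z ^ k) =
      (k.descFactorial m : ℝ) • (linForm e (adPow m z x) * linForm e z ^ (k - m)) := by
  induction m generalizing x k with
  | zero => simp [polyOp_zero, adPow_zero]
  | succ m ih =>
    rw [polyOp_succ_pow, ih]
    cases k with
    | zero => simp
    | succ k =>
      rw [smul_smul, Nat.succ_descFactorial_succ, Nat.add_sub_cancel, Nat.add_sub_add_right,
        adPow_succ, Nat.cast_mul]

theorem polyOp_succ_mul_pow (m : ℕ) (x w z : L) (j : ℕ) :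
    polyOp e (m + 1) x (linForm e w * linForm e z ^ j) =
      polyOp e m ⁅w, x⁆ (linForm e z ^ j) +
      (j : ℝ) • polyOp e m ⁅z, x⁆ (linForm e w * linForm e z ^ (j - 1)) := by
  have : ∀ i, MvPolynomial.pderiv i (linForm e w * linForm e z ^ j) =
      e.repr w i • linForm e z ^ j +
        e.repr z i • ((j : ℝ) • (linForm e w * linForm e z ^ (j - 1))) := fun i => by
    rw [Derivation.leibniz, pderiv_linForm_pow, pderiv_linForm]
    simp only [smul_eq_mul, Algebra.smul_def, MvPolynomial.algebraMap_eq]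
    ring
  rw [polyOp_succ]
  simp only [this, map_add, Finset.sum_add_distrib, sum_polyOp_smul]
  rw [map_smul]

/-- By Leibniz, either all `m + 1` derivatives fall on the power of `z`, or exactly one falls on
`w`. In the second case the sum over `q` records where `ad w` stands in the chain of `ad z`. -/
theorem polyOp_succ_mul_pow_eq (m : ℕ) (x w z : L) (j : ℕ) :
    polyOp e (m + 1) x (linForm e w * linForm e z ^ j) =
      (j.descFactorial (m + 1) : ℝ) •
        (linForm e (adPow (m + 1) z x) * linForm e w * linForm e z ^ (j - (m + 1))) +
      (j.descFactorial m : ℝ) •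
        (linForm e (∑ q ∈ antidiagonal m, adPow q.1 z ⁅w, adPow q.2 z x⁆) *
          linForm e z ^ (j - m)) := by
  induction m generalizing x j with
  | zero =>
    rw [polyOp_succ_mul_pow, polyOp_zero, polyOp_zero]
    simp [add_comm, mul_assoc, adPow_zero, adPow_succ]
  | succ m ih =>
    rw [polyOp_succ_mul_pow, ih, polyOp_linForm_pow, Finset.Nat.sum_antidiagonal_succ']
    cases j with
    | zero => simp
    | succ j =>
      simp only [adPow_succ, adPow_zero, map_add, Nat.succ_descFactorial_succ,
        Nat.add_sub_cancel, Nat.add_sub_add_right, smul_add, smul_smul, add_mul]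
      push_cast
      module

variable {e} in
-- This reduces every operator identity on polynomials to powers of a single linear form, where the
-- operators are given by `ad z`.
theorem endo_ext {M : Type*} [AddCommGroup M] [Module ℝ M] {F F' : MvPolynomial ι ℝ →ₗ[ℝ] M}
    (h : ∀ z k, F (linForm e z ^ k) = F' (linForm e z ^ k)) : F = F' :=
  LinearMap.ext_on (span_linForm_pow e) (by rintro _ ⟨z, k, rfl⟩; exact h z k)

section LieIdentity

variable (x y z : L)

/-- The linear map `X 0 ^ i * X 1 ^ j ↦ [(ad z) ^ i x, (ad z) ^ j y]`. -/
def bracketMap : MvPolynomial (Fin 2) ℝ →ₗ[ℝ] L :=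
  (MvPolynomial.basisMonomials (Fin 2) ℝ).constr ℝ fun m => ⁅adPow (m 0) z x, adPow (m 1) z y⁆

theorem bracketMap_monomial (m : Fin 2 →₀ ℕ) (c : ℝ) :
    bracketMap x y z (MvPolynomial.monomial m c) = c • ⁅adPow (m 0) z x, adPow (m 1) z y⁆ := by
  have : MvPolynomial.monomial m c = c • MvPolynomial.basisMonomials (Fin 2) ℝ m := by
    simp [MvPolynomial.smul_monomial]
  rw [this, map_smul, bracketMap, Module.Basis.constr_basis]

/-- `ad z` is a derivation of the bracket, so it corresponds to multiplication by `X 0 + X 1`. This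
lets a polynomial identity be read as an identity in the Lie algebra. -/
theorem bracketMap_add_mul (p : MvPolynomial (Fin 2) ℝ) :
    bracketMap x y z ((MvPolynomial.X 0 + MvPolynomial.X 1) * p) = ⁅z, bracketMap x y z p⁆ := by
  induction p using MvPolynomial.induction_on' with
  | add p q hp hq => rw [mul_add, map_add, map_add, hp, hq, lie_add]
  | monomial m c =>
    rw [add_mul, map_add, MvPolynomial.X, MvPolynomial.X, MvPolynomial.monomial_mul,
      MvPolynomial.monomial_mul, bracketMap_monomial, bracketMap_monomial, bracketMap_monomial]
    simp [add_comm 1, adPow_succ', lie_lie, ← smul_add]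

theorem bracketMap_add_pow_mul (a : ℕ) (p : MvPolynomial (Fin 2) ℝ) :
    bracketMap x y z ((MvPolynomial.X 0 + MvPolynomial.X 1) ^ a * p) =
      adPow a z (bracketMap x y z p) := by
  induction a with
  | zero => simp [adPow_zero]
  | succ a ih =>
    rw [pow_succ', mul_assoc, bracketMap_add_mul, ih, adPow_succ']

theorem bracketMap_pow_mul_pow (a b : ℕ) :
    bracketMap x y z (MvPolynomial.X 0 ^ a * MvPolynomial.X 1 ^ b) =
      ⁅adPow a z x, adPow b z y⁆ := by
  rw [MvPolynomial.X_pow_eq_monomial, MvPolynomial.X_pow_eq_monomial, MvPolynomial.monomial_mul,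
    bracketMap_monomial]
  simp

/-- This is the image of `bern_commutator_identity` under `bracketMap`; the minus sign is absorbed
by skew-symmetry. -/
theorem sum_ad_pow_lie (N : ℕ) :
    ∑ p ∈ antidiagonal N, (bern (p.1 + 1) * bern p.2) • ∑ q ∈ antidiagonal p.1,
      (adPow q.1 z ⁅adPow p.2 z y, adPow q.2 z x⁆ - adPow q.1 z ⁅adPow p.2 z x, adPow q.2 z y⁆) =
      bern N • adPow N z ⁅x, y⁆ := by
  have h := congrArg (fun p => - bracketMap x y z p) (bern_commutator_identity N)
  simp only [map_sum, MvPolynomial.C_mul', map_smul, mul_add, map_add, bracketMap_add_pow_mul,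
    map_neg, neg_neg, bracketMap_pow_mul_pow] at h
  rw [← mul_one ((MvPolynomial.X 0 + MvPolynomial.X 1) ^ N), bracketMap_add_pow_mul] at h
  have h1 : bracketMap x y z 1 = ⁅x, y⁆ := by
    simpa [adPow_zero] using bracketMap_pow_mul_pow x y z 0 0
  rw [h1] at h
  rw [← h, ← Finset.sum_neg_distrib]
  refine Finset.sum_congr rfl fun p _ => ?_
  rw [← smul_neg, ← Finset.sum_neg_distrib]
  congr 1
  refine Finset.sum_congr rfl fun q _ => ?_
  rw [neg_add, ← map_neg, lie_skew, sub_eq_add_neg]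

end LieIdentity

/-- The first sum collects the terms in which no derivative of the outer operator hits the linear
factor made by the inner one; it is symmetric in `x` and `y` and drops out of the commutator. The
term `p.1 = 0` is split off because it contains no derivative. -/
theorem sum_polyOp_polyOp_pow (N : ℕ) (x y z : L) (k : ℕ) :
    ∑ p ∈ antidiagonal (N + 1), (bern p.1 * bern p.2) •
        polyOp e p.1 x (polyOp e p.2 y (linForm e z ^ k)) =
      (∑ p ∈ antidiagonal (N + 1), (bern p.1 * bern p.2) • (k.descFactorial (N + 1) : ℝ) •
        (linForm e (adPow p.1 z x) * linForm e (adPow p.2 z y) * linForm e z ^ (k - (N + 1)))) +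
      (k.descFactorial N : ℝ) • (linForm e (∑ p ∈ antidiagonal N, (bern (p.1 + 1) * bern p.2) •
        ∑ q ∈ antidiagonal p.1, adPow q.1 z ⁅adPow p.2 z y, adPow q.2 z x⁆) *
          linForm e z ^ (k - N)) := by
  rw [Finset.Nat.sum_antidiagonal_succ, Finset.Nat.sum_antidiagonal_succ, add_assoc]
  congr 1
  · simp only [polyOp_linForm_pow, map_smul, polyOp_zero, adPow_zero, mul_assoc]
  · rw [map_sum, Finset.sum_mul, Finset.smul_sum, ← Finset.sum_add_distrib]
    refine Finset.sum_congr rfl fun p hp => ?_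
    rw [Finset.HasAntidiagonal.mem_antidiagonal] at hp
    have h1 : k.descFactorial p.2 * (k - p.2).descFactorial p.1 = k.descFactorial N := by
      rw [← descFactorial_mul_descFactorial_sub, add_comm, hp]
    have h2 : k.descFactorial p.2 * (k - p.2).descFactorial (p.1 + 1) =
        k.descFactorial (N + 1) := by
      rw [← descFactorial_mul_descFactorial_sub, ← add_assoc, add_comm p.2, hp]
    have h3 : k - p.2 - (p.1 + 1) = k - (N + 1) := by omega
    have h4 : k - p.2 - p.1 = k - N := by omega
    rw [polyOp_linForm_pow, map_smul, polyOp_succ_mul_pow_eq, smul_add, smul_smul, smul_smul,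
      ← Nat.cast_mul, ← Nat.cast_mul, h1, h2, h3, h4, map_smul, smul_add, smul_mul_assoc,
      smul_comm (k.descFactorial N : ℝ)]

theorem sum_polyOp_commutator (N : ℕ) (x y : L) :
    ∑ p ∈ antidiagonal (N + 1), (bern p.1 * bern p.2) • (polyOp e p.1 x * polyOp e p.2 y) -
      ∑ p ∈ antidiagonal (N + 1), (bern p.1 * bern p.2) • (polyOp e p.1 y * polyOp e p.2 x) =
      bern N • polyOp e N ⁅x, y⁆ := by
  refine endo_ext (e := e) fun z k => ?_
  simp only [LinearMap.sub_apply, LinearMap.sum_apply, LinearMap.smul_apply, Module.End.mul_apply]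
  rw [sum_polyOp_polyOp_pow, sum_polyOp_polyOp_pow, polyOp_linForm_pow,
    ← Finset.Nat.sum_antidiagonal_swap]
  simp only [Prod.fst_swap, Prod.snd_swap, mul_comm (bern _) (bern _)]
  rw [add_sub_add_comm]
  have h1 : ∀ p : ℕ × ℕ, linForm e (adPow p.2 z x) * linForm e (adPow p.1 z y) =
      linForm e (adPow p.1 z y) * linForm e (adPow p.2 z x) := fun p => mul_comm _ _
  simp only [h1, sub_self, zero_add]
  rw [← smul_sub, ← sub_mul, ← map_sub, smul_comm (bern N), ← smul_mul_assoc (bern N), ← map_smul,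
    ← sum_ad_pow_lie, ← Finset.sum_sub_distrib]
  simp only [← smul_sub, ← Finset.sum_sub_distrib, mul_comm (bern _) (bern _)]

/-- At order zero this is commutativity of polynomial multiplication; each higher order is one
instance of the Bernoulli identity. After division by `ν` it gives a representation of the Lie
algebra. -/
theorem leftSeries_commutator (x y : L) :
    leftSeries e mulX pderivEnd x * leftSeries e mulX pderivEnd y -
      leftSeries e mulX pderivEnd y * leftSeries e mulX pderivEnd x =
      PowerSeries.X * leftSeries e mulX pderivEnd ⁅x, y⁆ := by
  ext1 r
  rw [map_sub, PowerSeries.coeff_mul, PowerSeries.coeff_mul]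
  simp only [leftSeries, PowerSeries.coeff_mk, smul_mul_smul_comm]
  cases r with
  | zero =>
    rw [PowerSeries.coeff_zero_X_mul]
    refine LinearMap.ext fun p => ?_
    have h : ∀ x y : L, (polyOp e 0 x * polyOp e 0 y) p = linForm e x * (linForm e y * p) :=
      fun x y => by rw [Module.End.mul_apply, polyOp_zero, polyOp_zero]
    simp [h, mul_left_comm]
  | succ N =>
    rw [PowerSeries.coeff_succ_X_mul, PowerSeries.coeff_mk, sum_polyOp_commutator]

end OrderOperators

end

end BCH

namespace BCH

noncomputable section

open Finset.HasAntidiagonal (antidiagonal)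

/-! ### Injectivity of the symmetrization map -/

section Symmetrization

variable {L : Type*} [LieRing L] [LieAlgebra ℝ L] {ι : Type*}

local notation "𝒰" => UniversalEnvelopingAlgebra ℝ L

section Inclusion

attribute [local instance] LieRing.ofAssociativeRing

/-- The inclusion of `L` into its universal enveloping algebra as a linear map. -/
def ueaIncl : L →ₗ[ℝ] 𝒰 := (UniversalEnvelopingAlgebra.ι ℝ : L →ₗ⁅ℝ⁆ 𝒰).toLinearMap

theorem ueaIncl_lie (x y : L) :
    ueaIncl ⁅x, y⁆ = ueaIncl x * ueaIncl y - ueaIncl y * ueaIncl x := by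
  rw [← LieRing.of_associative_ring_bracket]
  exact LieHom.map_lie _ x y

end Inclusion

theorem symmProd_eq {k : ℕ} (x : Fin k → L) :
    symmProd x = ((k.factorial : ℝ)⁻¹) • ∑ τ : Equiv.Perm (Fin k),
      (List.ofFn fun j => ueaIncl (x (τ j))).prod := rfl

/-- `symmProd` as a multilinear map. -/
def symmProdMultilinear (k : ℕ) : MultilinearMap ℝ (fun _ : Fin k => L) 𝒰 :=
  ((k.factorial : ℝ)⁻¹) • ∑ τ : Equiv.Perm (Fin k),
    ((MultilinearMap.mkPiAlgebraFin ℝ k 𝒰).compLinearMap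
      fun _ => ueaIncl).domDomCongr τ

theorem symmProdMultilinear_apply {k : ℕ} (x : Fin k → L) :
    symmProdMultilinear k x = symmProd x := by
  simp [symmProdMultilinear, symmProd_eq]

theorem symmProd_comp_perm {k : ℕ} (x : Fin k → L) (π : Equiv.Perm (Fin k)) :
    symmProd (x ∘ π) = symmProd x := by
  rw [symmProd_eq, symmProd_eq]
  congr 1
  exact Equiv.sum_comp (Equiv.mulLeft π)
    (fun τ => (List.ofFn fun j => ueaIncl (x (τ j))).prod)

theorem symmProd_const {k : ℕ} (x : L) :
    symmProd (fun _ : Fin k => x) = ueaIncl x ^ k := by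
  have : (k.factorial : ℝ) ≠ 0 := by positivity
  rw [symmProd_eq]
  simp only [List.ofFn_const, List.prod_replicate, Finset.sum_const, Finset.card_univ,
    Fintype.card_perm, Fintype.card_fin]
  rw [← Nat.cast_smul_eq_nsmul ℝ, smul_smul, inv_mul_cancel₀ this, one_smul]

theorem exists_perm_of_map_univ_eq {k : ℕ} {i j : Fin k → ι}
    (h : Finset.univ.val.map i = Finset.univ.val.map j) :
    ∃ π : Equiv.Perm (Fin k), i = j ∘ π := by
  classical
  have hc : ∀ c, Fintype.card {a // i a = c} = Fintype.card {a // j a = c} := fun c => by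
    have := congrArg (Multiset.count c) h
    rw [Multiset.count_map, Multiset.count_map] at this
    rw [Fintype.card_subtype, Fintype.card_subtype, Finset.card_def, Finset.card_def]
    simpa [Finset.filter_val, eq_comm] using this
  refine ⟨Equiv.ofFiberEquiv fun c => Fintype.equivOfCardEq (hc c), ?_⟩
  ext a
  exact (Equiv.ofFiberEquiv_map _ a).symm

/-- `symmMonomial` lists the variables of a monomial in an arbitrarily chosen order; this makes the
choice irrelevant. -/
theorem symmProd_eq_of_map_univ_eq (v : ι → L) {k l : ℕ} {i : Fin k → ι} {j : Fin l → ι}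
    (h : Finset.univ.val.map i = Finset.univ.val.map j) :
    symmProd (fun a => v (i a)) = symmProd (fun a => v (j a)) := by
  obtain rfl : k = l := by simpa using congrArg Multiset.card h
  obtain ⟨π, rfl⟩ := exists_perm_of_map_univ_eq h
  exact symmProd_comp_perm (fun a => v (j a)) π

variable [Fintype ι] (e : Module.Basis ι ℝ L)

theorem prod_X_eq_monomial {k : ℕ} (i : Fin k → ι) :
    (∏ a, MvPolynomial.X (i a) : MvPolynomial ι ℝ) =
      MvPolynomial.monomial (∑ a, Finsupp.single (i a) 1) 1 := by
  rw [MvPolynomial.monomial_sum_one]; rfl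

theorem sigmaPoly_prod_X {k : ℕ} (i : Fin k → ι) :
    sigmaPoly e (∏ a, MvPolynomial.X (i a)) =
      Polynomial.monomial k (symmProd fun a => e (i a)) := by
  have h1 : (∏ a, MvPolynomial.X (i a) : MvPolynomial ι ℝ) =
      MvPolynomial.basisMonomials ι ℝ (∑ a, Finsupp.single (i a) 1) := by
    rw [prod_X_eq_monomial]; rfl
  rw [h1, sigmaPoly, Module.Basis.constr_basis]
  have h2 : (∑ a, Finsupp.single (i a) 1 : ι →₀ ℕ).degree = k := by simp [map_sum]
  rw [h2]
  congr 1
  refine symmProd_eq_of_map_univ_eq e ?_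
  rw [Fin.univ_val_map, List.ofFn_get, Multiset.coe_toList, map_sum]
  simp only [Finsupp.toMultiset_single, one_smul]
  rw [← Multiset.bind_singleton]; rfl

/-- Both sides are multilinear in `x`, so basis vectors suffice, and there the product is a
monomial. -/
theorem sigmaPoly_prod_linForm {k : ℕ} (x : Fin k → L) :
    sigmaPoly e (∏ a, linForm e (x a)) = Polynomial.monomial k (symmProd x) := by
  have : ((sigmaPoly e).compMultilinearMap
      ((MultilinearMap.mkPiAlgebra ℝ (Fin k) (MvPolynomial ι ℝ)).compLinearMap
        fun _ => linForm e)) =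
      ((Polynomial.monomial k : 𝒰 →ₗ[𝒰] Polynomial 𝒰).restrictScalars ℝ).compMultilinearMap
        (symmProdMultilinear k) := by
    refine Module.Basis.ext_multilinear (fun _ => e) fun i => ?_
    simp only [LinearMap.compMultilinearMap_apply, MultilinearMap.compLinearMap_apply,
      MultilinearMap.mkPiAlgebra_apply, linForm_basis, sigmaPoly_prod_X,
      symmProdMultilinear_apply]
    rfl
  have h := DFunLike.congr_fun this x
  simpa [symmProdMultilinear_apply] using h

theorem sigmaPoly_linForm_pow (z : L) (k : ℕ) :
    sigmaPoly e (linForm e z ^ k) =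
      Polynomial.monomial k (ueaIncl z ^ k) := by
  have := sigmaPoly_prod_linForm e fun _ : Fin k => z
  simpa [symmProd_const] using this

/-- `sigmaNu` as a linear map. -/
def sigmaNuLin : Polynomial (MvPolynomial ι ℝ) →ₗ[ℝ] Polynomial 𝒰 :=
  Polynomial.lsum fun a => LinearMap.mulLeft ℝ (Polynomial.X ^ a) ∘ₗ sigmaPoly e

theorem sigmaNuLin_apply (p : Polynomial (MvPolynomial ι ℝ)) : sigmaNuLin e p = sigmaNu e p := rfl

theorem sigmaNuLin_monomial (a : ℕ) (q : MvPolynomial ι ℝ) :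
    sigmaNuLin e (Polynomial.monomial a q) = Polynomial.X ^ a * sigmaPoly e q := by
  rw [sigmaNuLin_apply, sigmaNu, Polynomial.sum_monomial_index]
  simp

theorem sigmaNuLin_monomial_pow (a : ℕ) (z : L) (k : ℕ) :
    sigmaNuLin e (Polynomial.monomial a (linForm e z ^ k)) =
      Polynomial.monomial (a + k) (ueaIncl z ^ k) := by
  rw [sigmaNuLin_monomial, sigmaPoly_linForm_pow, Polynomial.X_pow_eq_monomial,
    Polynomial.monomial_mul_monomial, one_mul]

/-- All corrections of positive order to `ẑ ⋆ ẑ ^ k` contain `ad z` applied to `z`, hence vanish. -/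
theorem coeff_leftSeries_pow_one (z : L) (k n : ℕ) :
    PowerSeries.coeff n (leftSeries e mulX pderivEnd z ^ k) (1 : MvPolynomial ι ℝ) =
      if n = 0 then linForm e z ^ k else 0 := by
  induction k generalizing n with
  | zero =>
    rw [pow_zero, PowerSeries.coeff_one]
    split_ifs <;> simp
  | succ k ih =>
    rw [pow_succ', PowerSeries.coeff_mul, LinearMap.sum_apply]
    simp only [Module.End.mul_apply, ih]
    rw [Finset.sum_eq_single (n, 0)]
    · simp only [leftSeries, PowerSeries.coeff_mk, LinearMap.smul_apply, if_true]
      cases n with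
      | zero => rw [polyOp_zero, bern_zero, one_smul, if_pos rfl, pow_succ']
      | succ n =>
        rw [polyOp_linForm_pow, adPow_succ, lie_self]
        simp
    · rintro ⟨a, b⟩ hp hne
      rw [if_neg, map_zero]
      rintro rfl
      rw [Finset.HasAntidiagonal.mem_antidiagonal] at hp
      simp at hp
      simp [hp] at hne
    · intro h
      simp [Finset.HasAntidiagonal.mem_antidiagonal] at h

section Representation

attribute [local instance] LieRing.ofAssociativeRing

/-- The series `ν⁻¹ A`. -/
def shiftSeries {R : Type*} [Ring R] [Algebra ℝ R] : PowerSeries R →ₗ[ℝ] HahnSeries ℤ R where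
  toFun A := HahnSeries.single (-1) 1 * HahnSeries.ofPowerSeries ℤ R A
  map_add' x y := by rw [map_add, mul_add]
  map_smul' c x := by
    have : HahnSeries.ofPowerSeries ℤ R (c • x) = c • HahnSeries.ofPowerSeries ℤ R x :=
      map_smul (HahnSeries.ofPowerSeriesAlg ℤ ℝ : PowerSeries R →ₐ[ℝ] _) c x
    rw [this, mul_smul_comm, RingHom.id_apply]

theorem single_commute {R : Type*} [Ring R] (a : ℤ) (x : HahnSeries ℤ R) :
    Commute (HahnSeries.single a 1) x := by
  ext b
  rw [HahnSeries.coeff_single_mul, HahnSeries.coeff_mul_single, one_mul, mul_one]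

theorem shiftSeries_mul {R : Type*} [Ring R] [Algebra ℝ R] (A B : PowerSeries R) :
    shiftSeries A * shiftSeries B =
      HahnSeries.single (-2) 1 * HahnSeries.ofPowerSeries ℤ R (A * B) := by
  rw [shiftSeries]
  simp only [LinearMap.coe_mk, AddHom.coe_mk]
  rw [mul_assoc, ← mul_assoc (HahnSeries.ofPowerSeries ℤ R A), ← (single_commute _ _).eq, map_mul,
    ← mul_assoc, ← mul_assoc, HahnSeries.single_mul_single, one_mul, mul_assoc]
  norm_num

theorem shiftSeries_pow {R : Type*} [Ring R] [Algebra ℝ R] (A : PowerSeries R) (k : ℕ) :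
    shiftSeries A ^ k = HahnSeries.single (-k : ℤ) 1 * HahnSeries.ofPowerSeries ℤ R (A ^ k) := by
  rw [shiftSeries]
  simp only [LinearMap.coe_mk, AddHom.coe_mk]
  rw [(single_commute _ _).mul_pow, HahnSeries.single_pow, map_pow (HahnSeries.ofPowerSeries ℤ R)]
  simp

theorem leftSeries_add_smul (c : ℝ) (x y : L) :
    leftSeries e mulX pderivEnd (c • x + y) =
      c • leftSeries e mulX pderivEnd x + leftSeries e mulX pderivEnd y := by
  ext1 m
  simp [leftSeries, smul_comm c]

theorem shiftSeries_commutator (x y : L) :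
    shiftSeries (leftSeries e mulX pderivEnd x) * shiftSeries (leftSeries e mulX pderivEnd y) -
      shiftSeries (leftSeries e mulX pderivEnd y) * shiftSeries (leftSeries e mulX pderivEnd x) =
      shiftSeries (leftSeries e mulX pderivEnd ⁅x, y⁆) := by
  rw [shiftSeries_mul, shiftSeries_mul, ← mul_sub, ← map_sub, leftSeries_commutator, map_mul,
    HahnSeries.ofPowerSeries_X, ← mul_assoc, HahnSeries.single_mul_single]
  norm_num [shiftSeries]

/-- The representation of `L` on Laurent series sending `x` to `ν⁻¹` times left star
multiplication by `x`. -/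
def laurentRep : L →ₗ⁅ℝ⁆ HahnSeries ℤ (Module.End ℝ (MvPolynomial ι ℝ)) where
  toFun x := shiftSeries (leftSeries e mulX pderivEnd x)
  map_add' x y := by
    rw [← map_add]
    simpa using congrArg shiftSeries (leftSeries_add_smul e 1 x y)
  map_smul' c x := by
    rw [← map_smul]
    have h0 : leftSeries e mulX pderivEnd (0 : L) = 0 := by ext1 m; simp [leftSeries]
    simpa [h0] using congrArg shiftSeries (leftSeries_add_smul e c x 0)
  map_lie' {x y} := by
    rw [LieRing.of_associative_ring_bracket]
    exact (shiftSeries_commutator e x y).symm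

/-- The action of the universal enveloping algebra on Laurent series. -/
def laurentAction : 𝒰 →ₐ[ℝ] HahnSeries ℤ (Module.End ℝ (MvPolynomial ι ℝ)) :=
  UniversalEnvelopingAlgebra.lift ℝ (laurentRep e)

theorem laurentAction_ueaIncl (x : L) :
    laurentAction e (ueaIncl x) = shiftSeries (leftSeries e mulX pderivEnd x) :=
  UniversalEnvelopingAlgebra.lift_ι_apply ℝ (laurentRep e) x

end Representation

/-- The homogeneous component of degree `j` of the inverse of the symmetrization map. -/
def symbolMap (j : ℕ) : 𝒰 →ₗ[ℝ] MvPolynomial ι ℝ where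
  toFun u := (laurentAction e u).coeff (-j) 1
  map_add' u v := by simp
  map_smul' c u := by simp

theorem symbolMap_pow (j : ℕ) (z : L) (k : ℕ) :
    symbolMap e j (ueaIncl z ^ k) = if k = j then linForm e z ^ k else 0 := by
  change (laurentAction e (ueaIncl z ^ k)).coeff (-j) 1 = _
  rw [map_pow, laurentAction_ueaIncl, shiftSeries_pow, HahnSeries.coeff_single_mul, one_mul]
  rcases le_or_gt j k with h | h
  -- For `k = j + n`, the coefficient of `ν ^ (-j)` in `ν ^ (-k) L_z ^ k` is the `n`-th coefficient
  -- of `L_z ^ k`, which kills `1` unless `n = 0`.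
  · obtain ⟨n, rfl⟩ := Nat.exists_eq_add_of_le h
    have : -(j : ℤ) - -((j + n : ℕ) : ℤ) = (n : ℤ) := by push_cast; ring
    rw [this, HahnSeries.ofPowerSeries_apply_coeff, coeff_leftSeries_pow_one]
    simp
  · rw [if_neg (by omega), HahnSeries.ofPowerSeries_apply, HahnSeries.embDomain_of_notMem_range,
      LinearMap.zero_apply]
    rintro ⟨m, hm⟩
    simp at hm
    omega

theorem homogeneousComponent_linForm_pow (j : ℕ) (z : L) (k : ℕ) :
    MvPolynomial.homogeneousComponent j (linForm e z ^ k) =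
      if k = j then linForm e z ^ k else 0 := by
  have h1 : (linForm e z).IsHomogeneous 1 := by
    rw [linForm_eq_sum]
    refine MvPolynomial.IsHomogeneous.sum _ _ _ fun i _ => ?_
    rw [MvPolynomial.smul_eq_C_mul]
    exact (MvPolynomial.isHomogeneous_X ℝ i).C_mul _
  have h := h1.pow k
  rw [one_mul] at h
  rw [MvPolynomial.homogeneousComponent_of_mem h]
  simp [eq_comm]

/-- In `σ_ν Q` the `ν`-degree mixes the original power of `ν` with the polynomial degree. Testing on
`ν ^ a ẑ ^ k` shows that `symbolMap e j` selects the part of degree `j`, which separates the two. -/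
theorem symbolMap_coeff_sigmaNu (a j : ℕ) (Q : Polynomial (MvPolynomial ι ℝ)) :
    symbolMap e j ((sigmaNuLin e Q).coeff (a + j)) =
      MvPolynomial.homogeneousComponent j (Q.coeff a) := by
  induction Q using Polynomial.induction_on' with
  | add p q hp hq => simp [hp, hq]
  | monomial n q =>
    have : (symbolMap e j ∘ₗ (Polynomial.lcoeff 𝒰 (a + j)).restrictScalars ℝ ∘ₗ sigmaNuLin e ∘ₗ
        (Polynomial.monomial n : MvPolynomial ι ℝ →ₗ[MvPolynomial ι ℝ] _).restrictScalars ℝ) =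
        (MvPolynomial.homogeneousComponent j ∘ₗ
          (Polynomial.lcoeff (MvPolynomial ι ℝ) a).restrictScalars ℝ ∘ₗ
          (Polynomial.monomial n : MvPolynomial ι ℝ →ₗ[MvPolynomial ι ℝ] _).restrictScalars ℝ) := by
      refine endo_ext (e := e) fun z k => ?_
      simp only [LinearMap.comp_apply, LinearMap.restrictScalars_apply, Polynomial.lcoeff_apply,
        sigmaNuLin_monomial_pow, Polynomial.coeff_monomial]
      by_cases h1 : n = a
      · subst h1
        by_cases h2 : k = j
        · subst h2
          simp [symbolMap_pow, homogeneousComponent_linForm_pow]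
        · simp [h2, homogeneousComponent_linForm_pow]
      · rw [if_neg h1, map_zero]
        split_ifs with h2
        · rw [symbolMap_pow, if_neg (by omega)]
        · rw [map_zero]
    exact LinearMap.congr_fun this q

/-- This is the half of the Poincaré–Birkhoff–Witt theorem that the star product needs: all
homogeneous components of all coefficients can be recovered. -/
theorem sigmaNu_injective : Function.Injective (sigmaNu e) := by
  intro P Q h
  ext a d
  have h' : MvPolynomial.homogeneousComponent d.degree (P.coeff a) =
      MvPolynomial.homogeneousComponent d.degree (Q.coeff a) := by
    rw [← symbolMap_coeff_sigmaNu e, ← symbolMap_coeff_sigmaNu e, sigmaNuLin_apply,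
      sigmaNuLin_apply, h]
  simpa [MvPolynomial.coeff_homogeneousComponent] using congrArg (MvPolynomial.coeff d) h'

end Symmetrization

end

end BCH

namespace BCH

noncomputable section

open Finset.HasAntidiagonal (antidiagonal)

/-! ### Star multiplication by powers of linear functions -/

section StarProduct

variable {L : Type*} [LieRing L] [LieAlgebra ℝ L] {ι : Type*}

local notation "𝒰" => UniversalEnvelopingAlgebra ℝ L

theorem sum_prod_ofFn_update_const {A : Type*} [Ring A] (z w : A) (j : ℕ) :
    ∑ a : Fin (j + 1), (List.ofFn (Function.update (fun _ => z) a w)).prod =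
      ∑ q ∈ antidiagonal j, z ^ q.1 * w * z ^ q.2 := by
  induction j with
  | zero => simp
  | succ j ih =>
    rw [Fin.sum_univ_succ, Finset.Nat.sum_antidiagonal_succ]
    congr 1
    · rw [List.ofFn_succ]
      simp [Function.update, pow_succ']
    · simp only [pow_succ', mul_assoc, ← Finset.mul_sum]
      simp only [mul_assoc] at ih
      rw [← ih, Finset.mul_sum]
      refine Finset.sum_congr rfl fun a _ => ?_
      rw [List.ofFn_succ, List.prod_cons, Function.update_of_ne (Fin.succ_ne_zero a).symm]
      congr 3
      ext b
      simp [Function.update_apply, Fin.succ_inj]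

/-- By permutation invariance the position of `w` does not matter, so the symmetrized product is the
average over all `j + 1` positions. -/
theorem symmProd_update_const (z w : L) (j : ℕ) (c : Fin (j + 1)) :
    symmProd (Function.update (fun _ => z) c w) = ((j + 1 : ℕ) : ℝ)⁻¹ •
      ∑ q ∈ antidiagonal j, ueaIncl z ^ q.1 * ueaIncl w * ueaIncl z ^ q.2 := by
  have h0 : ((j + 1 : ℕ) : ℝ) ≠ 0 := by positivity
  have hupd : ∀ (c : Fin (j + 1)) (π : Equiv.Perm (Fin (j + 1))),
      Function.update (fun _ => z) c w ∘ π = Function.update (fun _ => z) (π.symm c) w :=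
    fun c π => by
      rw [Function.update_comp_equiv]; rfl
  have h1 : ∀ d, symmProd (Function.update (fun _ => z) d w) =
      symmProd (Function.update (fun _ => z) c w) := fun d => by
    rw [← symmProd_comp_perm (Function.update (fun _ => z) c w) (Equiv.swap c d), hupd]
    simp
  have h2 : ∑ d : Fin (j + 1), symmProd (Function.update (fun _ => z) d w) =
      ∑ q ∈ antidiagonal j, ueaIncl z ^ q.1 * ueaIncl w * ueaIncl z ^ q.2 := by
    simp only [symmProd_eq]
    rw [← Finset.smul_sum, Finset.sum_comm]
    -- A permutation only relabels the position of `w`, so each of the `(j + 1)!` permutations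
    -- contributes the same full sum.
    have h3 : ∀ τ : Equiv.Perm (Fin (j + 1)), ∑ d : Fin (j + 1),
        (List.ofFn fun a => ueaIncl (Function.update (fun _ => z) d w (τ a))).prod =
        ∑ q ∈ antidiagonal j, ueaIncl z ^ q.1 * ueaIncl w * ueaIncl z ^ q.2 := fun τ => by
      rw [← sum_prod_ofFn_update_const, ← Equiv.sum_comp τ]
      refine Finset.sum_congr rfl fun d _ => ?_
      congr 2
      ext a
      simp only [Function.update_apply, EmbeddingLike.apply_eq_iff_eq]
      split_ifs <;> rfl
    simp only [h3, Finset.sum_const, Finset.card_univ, Fintype.card_perm, Fintype.card_fin]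
    rw [← Nat.cast_smul_eq_nsmul ℝ, smul_smul, inv_mul_cancel₀ (by positivity), one_smul]
  rw [← h2, Finset.sum_congr rfl fun d _ => h1 d, Finset.sum_const, Finset.card_univ,
    Fintype.card_fin, ← Nat.cast_smul_eq_nsmul ℝ, smul_smul, inv_mul_cancel₀ h0, one_smul]

section MultMap

variable (y : L)

/-- The linear map `X 0 ^ i * X 1 ^ j ↦ y ^ i • x • y ^ j`. -/
def sandwichMap (x : L) : MvPolynomial (Fin 2) ℝ →ₗ[ℝ] 𝒰 :=
  (MvPolynomial.basisMonomials (Fin 2) ℝ).constr ℝ fun m =>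
    ueaIncl y ^ m 0 * ueaIncl x * ueaIncl y ^ m 1

theorem sandwichMap_monomial (x : L) (m : Fin 2 →₀ ℕ) (c : ℝ) :
    sandwichMap y x (MvPolynomial.monomial m c) =
      c • (ueaIncl y ^ m 0 * ueaIncl x * ueaIncl y ^ m 1) := by
  have : MvPolynomial.monomial m c = c • MvPolynomial.basisMonomials (Fin 2) ℝ m := by
    simp [MvPolynomial.smul_monomial]
  rw [this, map_smul, sandwichMap, Module.Basis.constr_basis]

theorem sandwichMap_sub_mul (x : L) (p : MvPolynomial (Fin 2) ℝ) :
    sandwichMap y x ((MvPolynomial.X 0 - MvPolynomial.X 1) * p) = sandwichMap y ⁅y, x⁆ p := by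
  induction p using MvPolynomial.induction_on' with
  | add p q hp hq => rw [mul_add, map_add, map_add, hp, hq]
  | monomial m c =>
    rw [sub_mul, map_sub, MvPolynomial.X, MvPolynomial.X, MvPolynomial.monomial_mul,
      MvPolynomial.monomial_mul, sandwichMap_monomial, sandwichMap_monomial, sandwichMap_monomial,
      ueaIncl_lie]
    simp only [one_mul, Finsupp.add_apply, Finsupp.single_eq_same, ← smul_sub]
    congr 1
    simp only [Finsupp.single_apply, one_ne_zero, zero_ne_one, if_false, zero_add, add_comm 1,
      pow_succ, mul_assoc, mul_sub, sub_mul]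
    rw [← pow_succ, pow_succ']

theorem sandwichMap_sub_pow_mul (x : L) (m : ℕ) (p : MvPolynomial (Fin 2) ℝ) :
    sandwichMap y x ((MvPolynomial.X 0 - MvPolynomial.X 1) ^ m * p) =
      sandwichMap y (adPow m y x) p := by
  induction m generalizing x with
  | zero => simp [adPow_zero]
  | succ m ih => rw [pow_succ', mul_assoc, sandwichMap_sub_mul, ih, adPow_succ]

theorem sandwichMap_pow_mul_pow (x : L) (a b : ℕ) :
    sandwichMap y x (MvPolynomial.X 0 ^ a * MvPolynomial.X 1 ^ b) =
      ueaIncl y ^ a * ueaIncl x * ueaIncl y ^ b := by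
  rw [MvPolynomial.X_pow_eq_monomial, MvPolynomial.X_pow_eq_monomial, MvPolynomial.monomial_mul,
    sandwichMap_monomial]
  simp

/-- `bern_multiplication_identity`, read through `sandwichMap`, where `X 0 - X 1` becomes `ad y`. It
writes `x • y ^ k` through the symmetrized products of `(ad y) ^ m x` with powers of `y`. -/
theorem ueaIncl_mul_pow (x : L) (k : ℕ) :
    ueaIncl x * ueaIncl y ^ k = ∑ p ∈ antidiagonal k, (bern p.1 * k.descFactorial p.1) •
      (((p.2 + 1 : ℕ) : ℝ)⁻¹ • ∑ q ∈ antidiagonal p.2,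
        ueaIncl y ^ q.1 * ueaIncl (adPow p.1 y x) * ueaIncl y ^ q.2) := by
  have h := congrArg (fun p => (k.factorial : ℝ) • sandwichMap y x p)
    (bern_multiplication_identity k)
  simp only [MvPolynomial.C_mul', map_smul, map_sum, sandwichMap_sub_pow_mul,
    sandwichMap_pow_mul_pow] at h
  rw [← one_mul (MvPolynomial.X 1 ^ k), ← pow_zero (MvPolynomial.X 0), sandwichMap_pow_mul_pow,
    smul_smul, mul_inv_cancel₀ (by positivity), one_smul, pow_zero, one_mul] at h
  rw [← h, Finset.smul_sum]
  refine Finset.sum_congr rfl fun p hp => ?_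
  rw [Finset.HasAntidiagonal.mem_antidiagonal] at hp
  have hk : (k.factorial : ℝ) = p.2.factorial * k.descFactorial p.1 := by
    rw [← Nat.factorial_mul_descFactorial (show p.1 ≤ k by omega), show k - p.1 = p.2 by omega]
    push_cast; rfl
  rw [smul_smul, smul_smul]
  congr 1
  rw [hk, Nat.factorial_succ]
  have : (p.2.factorial : ℝ) ≠ 0 := by positivity
  push_cast
  field_simp

/-- Replacing `[y, x]` by `y • x - x • y` makes the sum telescope. -/
theorem sum_pow_mul_lie_mul_pow (x : L) (k : ℕ) :
    ∑ q ∈ antidiagonal k, ueaIncl y ^ q.1 * ueaIncl ⁅y, x⁆ * ueaIncl y ^ q.2 =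
      ueaIncl y ^ (k + 1) * ueaIncl x - ueaIncl x * ueaIncl y ^ (k + 1) := by
  have geom : (MvPolynomial.X 0 - MvPolynomial.X 1 : MvPolynomial (Fin 2) ℝ) *
      ∑ q ∈ antidiagonal k, MvPolynomial.X 0 ^ q.1 * MvPolynomial.X 1 ^ q.2 =
        MvPolynomial.X 0 ^ (k + 1) * MvPolynomial.X 1 ^ 0 -
          MvPolynomial.X 0 ^ 0 * MvPolynomial.X 1 ^ (k + 1) := by
    rw [pow_zero, pow_zero, mul_one, one_mul, ← (Commute.all _ _).mul_geom_sum₂,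
      Finset.Nat.sum_antidiagonal_eq_sum_range_succ
        fun i j => (MvPolynomial.X 0 : MvPolynomial (Fin 2) ℝ) ^ i * MvPolynomial.X 1 ^ j]
    simp
  have h := congrArg (sandwichMap y x) geom
  rw [sandwichMap_sub_mul, map_sum, map_sub, sandwichMap_pow_mul_pow, sandwichMap_pow_mul_pow,
    pow_zero, one_mul, mul_one] at h
  simpa only [sandwichMap_pow_mul_pow] using h

end MultMap

variable [Fintype ι] (e : Module.Basis ι ℝ L)

theorem sigmaPoly_mul_pow (w z : L) (j : ℕ) :
    sigmaPoly e (linForm e w * linForm e z ^ j) = Polynomial.monomial (j + 1)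
      (((j + 1 : ℕ) : ℝ)⁻¹ • ∑ q ∈ antidiagonal j,
        ueaIncl z ^ q.1 * ueaIncl w * ueaIncl z ^ q.2) := by
  rw [← symmProd_update_const z w j 0, ← sigmaPoly_prod_linForm e, Fin.prod_univ_succ]
  simp [Fin.succ_ne_zero]

/-- The formal operator `B` on polynomials corresponds to the operator `T` on the universal
enveloping algebra. -/
def Intertwines (B : PowerSeries (Module.End ℝ (MvPolynomial ι ℝ)))
    (T : Module.End ℝ (Polynomial 𝒰)) : Prop :=
  ∀ Q, ∃ Q', (∀ r, Polynomial.coeff Q' r =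
    ∑ p ∈ antidiagonal r, PowerSeries.coeff p.1 B (Q.coeff p.2)) ∧
      sigmaNuLin e Q' = T (sigmaNuLin e Q)

variable {e}

theorem Intertwines.add {B B' : PowerSeries (Module.End ℝ (MvPolynomial ι ℝ))}
    {T T' : Module.End ℝ (Polynomial 𝒰)} (h : Intertwines e B T) (h' : Intertwines e B' T') :
    Intertwines e (B + B') (T + T') := fun Q => by
  obtain ⟨P, hP, hP'⟩ := h Q
  obtain ⟨R, hR, hR'⟩ := h' Q
  exact ⟨P + R, fun r => by simp [hP, hR, Finset.sum_add_distrib], by simp [hP', hR']⟩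

theorem Intertwines.mul {B B' : PowerSeries (Module.End ℝ (MvPolynomial ι ℝ))}
    {T T' : Module.End ℝ (Polynomial 𝒰)} (h : Intertwines e B T) (h' : Intertwines e B' T') :
    Intertwines e (B * B') (T * T') := fun Q => by
  obtain ⟨R, hR, hR'⟩ := h' Q
  obtain ⟨P, hP, hP'⟩ := h R
  refine ⟨P, fun r => ?_, by simp [hP', hR']⟩
  simp only [hP, hR, map_sum, PowerSeries.coeff_mul, LinearMap.sum_apply, Module.End.mul_apply]
  rw [Finset.sum_sigma', Finset.sum_sigma']
  refine Finset.sum_nbij' (fun p => ⟨(p.1.1 + p.2.1, p.2.2), (p.1.1, p.2.1)⟩)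
    (fun p => ⟨(p.2.1, p.2.2 + p.1.2), (p.2.2, p.1.2)⟩) ?_ ?_ ?_ ?_ fun _ _ => rfl
  all_goals
    rintro ⟨⟨a, b⟩, ⟨c, d⟩⟩ h
    simp only [Finset.mem_sigma, Finset.HasAntidiagonal.mem_antidiagonal] at h ⊢
    obtain ⟨rfl, rfl⟩ := h
    simp [add_assoc]

theorem Intertwines.one : Intertwines e 1 1 := fun Q => by
  refine ⟨Q, fun r => ?_, rfl⟩
  rw [Finset.sum_eq_single (0, r)]
  · simp
  · rintro ⟨a, b⟩ hp hne
    rw [PowerSeries.coeff_one, if_neg, LinearMap.zero_apply]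
    rintro rfl
    rw [Finset.HasAntidiagonal.mem_antidiagonal] at hp
    simp at hp
    simp [hp] at hne
  · simp [Finset.HasAntidiagonal.mem_antidiagonal]

theorem Intertwines.pow {B : PowerSeries (Module.End ℝ (MvPolynomial ι ℝ))}
    {T : Module.End ℝ (Polynomial 𝒰)} (h : Intertwines e B T) (k : ℕ) :
    Intertwines e (B ^ k) (T ^ k) := by
  induction k with
  | zero => rw [pow_zero, pow_zero]; exact Intertwines.one
  | succ k ih => rw [pow_succ, pow_succ]; exact ih.mul h

theorem sum_antidiagonal_coeff_monomial (B : PowerSeries (Module.End ℝ (MvPolynomial ι ℝ)))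
    (a r : ℕ) (q : MvPolynomial ι ℝ) :
    ∑ p ∈ antidiagonal r, PowerSeries.coeff p.1 B ((Polynomial.monomial a q).coeff p.2) =
      if a ≤ r then PowerSeries.coeff (r - a) B q else 0 := by
  split_ifs with h
  · rw [Finset.sum_eq_single (r - a, a)]
    · simp
    · rintro ⟨b, c⟩ hp hne
      rw [Polynomial.coeff_monomial, if_neg, map_zero]
      rintro rfl
      rw [Finset.HasAntidiagonal.mem_antidiagonal] at hp
      simp at hp
      exact hne (by simp; omega)
    · simp [Finset.HasAntidiagonal.mem_antidiagonal, h]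
  · refine Finset.sum_eq_zero fun p hp => ?_
    rw [Finset.HasAntidiagonal.mem_antidiagonal] at hp
    rw [Polynomial.coeff_monomial, if_neg (by omega), map_zero]

theorem Intertwines.of_monomial_pow {B : PowerSeries (Module.End ℝ (MvPolynomial ι ℝ))}
    {T : Module.End ℝ (Polynomial 𝒰)}
    (h : ∀ a z k, ∃ Q' : Polynomial (MvPolynomial ι ℝ),
      (∀ r, Q'.coeff r = if a ≤ r then PowerSeries.coeff (r - a) B (linForm e z ^ k) else 0) ∧
      sigmaNuLin e Q' = T (Polynomial.monomial (a + k) (ueaIncl z ^ k))) :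
    Intertwines e B T := by
  intro Q
  induction Q using Polynomial.induction_on' with
  | add P R hP hR =>
    obtain ⟨P', hP, hP'⟩ := hP
    obtain ⟨R', hR, hR'⟩ := hR
    exact ⟨P' + R', fun r => by simp [hP, hR, Finset.sum_add_distrib], by simp [hP', hR']⟩
  | monomial a q =>
    have hq : q ∈ Submodule.span ℝ {p | ∃ z k, linForm e z ^ k = p} := by
      rw [span_linForm_pow]; trivial
    simp only [sum_antidiagonal_coeff_monomial]
    induction hq using Submodule.span_induction with
    | mem q hq =>
      obtain ⟨z, k, rfl⟩ := hq
      rw [sigmaNuLin_monomial_pow]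
      exact h a z k
    | zero => exact ⟨0, by simp, by simp⟩
    | add p q _ _ hp hq =>
      obtain ⟨P', hP, hP'⟩ := hp
      obtain ⟨R', hR, hR'⟩ := hq
      refine ⟨P' + R', fun r => ?_, by simp [hP', hR']⟩
      rw [Polynomial.coeff_add, hP, hR]
      split_ifs <;> simp
    | smul c p _ hp =>
      obtain ⟨P', hP, hP'⟩ := hp
      refine ⟨c • P', fun r => ?_, ?_⟩
      · rw [Polynomial.coeff_smul, hP]
        split_ifs <;> simp
      · rw [map_smul, hP', ← map_smul, ← map_smul, Polynomial.smul_monomial]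

variable (e)

/-- On powers of `z` this is `ueaIncl_mul_pow`: an operator of order `m` loses `m` powers of `z`,
gains one linear factor and comes with `ν ^ m`, so the total `ν`-degree after `σ_ν` rises by exactly
one. -/
theorem intertwines_leftSeries (x : L) :
    Intertwines e (leftSeries e mulX pderivEnd x)
      (LinearMap.mulLeft ℝ (Polynomial.monomial 1 (ueaIncl x))) := by
  refine Intertwines.of_monomial_pow fun a z k => ?_
  -- A finite sum suffices because operators of order greater than `k` annihilate the `k`-th power
  -- of a linear form.
  refine ⟨∑ p ∈ antidiagonal k,
    Polynomial.monomial (a + p.1) (bern p.1 • polyOp e p.1 x (linForm e z ^ k)), fun r => ?_, ?_⟩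
  · simp only [Polynomial.finsetSum_coeff, Polynomial.coeff_monomial]
    split_ifs with h
    · obtain ⟨m, rfl⟩ := Nat.exists_eq_add_of_le h
      rw [Nat.add_sub_cancel_left, leftSeries, PowerSeries.coeff_mk]
      simp only [add_right_inj, LinearMap.smul_apply]
      rcases le_or_gt m k with hm | hm
      · rw [Finset.sum_eq_single (m, k - m)]
        · simp
        · rintro ⟨b, c⟩ hp hne
          rw [if_neg]
          rintro rfl
          rw [Finset.HasAntidiagonal.mem_antidiagonal] at hp
          simp at hp
          exact hne (by simp; omega)
        · simp [Finset.HasAntidiagonal.mem_antidiagonal, hm]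
      · rw [polyOp_linForm_pow, Nat.descFactorial_eq_zero_iff_lt.2 hm, Finset.sum_eq_zero]
        · simp
        · intro p hp
          rw [Finset.HasAntidiagonal.mem_antidiagonal] at hp
          rw [if_neg (by omega)]
    · refine Finset.sum_eq_zero fun p hp => if_neg (by omega)
  · rw [map_sum, LinearMap.mulLeft_apply, Polynomial.monomial_mul_monomial, ueaIncl_mul_pow,
      map_sum]
    refine Finset.sum_congr rfl fun p hp => ?_
    rw [Finset.HasAntidiagonal.mem_antidiagonal] at hp
    rw [polyOp_linForm_pow, show k - p.1 = p.2 by omega, smul_smul, ← Polynomial.smul_monomial,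
      map_smul, sigmaNuLin_monomial, sigmaPoly_mul_pow, Polynomial.X_pow_eq_monomial,
      Polynomial.monomial_mul_monomial, one_mul, ← Polynomial.smul_monomial]
    rw [show a + p.1 + (p.2 + 1) = 1 + (a + k) by omega, Polynomial.smul_monomial,
      Polynomial.smul_monomial]

/-- The vector field acts on `ẑ ^ k` as a derivation sending `ẑ` to the linear form of `[z, x]`. Its
symmetrization telescopes to `z ^ k • x - x • z ^ k`. -/
theorem intertwines_commutator (x : L) :
    Intertwines e (PowerSeries.X * PowerSeries.C (polyOp e 1 x))
      (LinearMap.mulRight ℝ (Polynomial.monomial 1 (ueaIncl x)) -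
        LinearMap.mulLeft ℝ (Polynomial.monomial 1 (ueaIncl x))) := by
  refine Intertwines.of_monomial_pow fun a z k => ?_
  refine ⟨Polynomial.monomial (a + 1) (polyOp e 1 x (linForm e z ^ k)), fun r => ?_, ?_⟩
  · rw [Polynomial.coeff_monomial]
    split_ifs with h1 h2 h3
    · subst h1
      rw [Nat.add_sub_cancel_left, show (1 : ℕ) = 0 + 1 from rfl, PowerSeries.coeff_succ_X_mul]
      simp
    · omega
    · obtain ⟨m, rfl⟩ := Nat.exists_eq_add_of_le h3
      rw [Nat.add_sub_cancel_left]
      cases m with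
      | zero => simp
      | succ m =>
        rw [PowerSeries.coeff_succ_X_mul, PowerSeries.coeff_C, if_neg (by omega),
          LinearMap.zero_apply]
    · rfl
  · rw [LinearMap.sub_apply, LinearMap.mulLeft_apply, LinearMap.mulRight_apply,
      Polynomial.monomial_mul_monomial, Polynomial.monomial_mul_monomial, polyOp_linForm_pow,
      Nat.descFactorial_one]
    cases k with
    | zero => simp [add_comm]
    | succ k =>
      rw [Nat.add_sub_cancel, ← Polynomial.smul_monomial, map_smul, sigmaNuLin_monomial,
        sigmaPoly_mul_pow, adPow_succ, adPow_zero, sum_pow_mul_lie_mul_pow,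
        Polynomial.X_pow_eq_monomial,
        Polynomial.monomial_mul_monomial, one_mul, Polynomial.smul_monomial, smul_smul,
        mul_inv_cancel₀ (by positivity), one_smul, map_sub, add_comm (a + 1), add_comm 1 (a + _)]
      congr 2 <;> congr 1 <;> omega

theorem intertwines_rightSeries (x : L) :
    Intertwines e (rightSeries e mulX pderivEnd x)
      (LinearMap.mulRight ℝ (Polynomial.monomial 1 (ueaIncl x))) := by
  have := (intertwines_leftSeries e x).add (intertwines_commutator e x)
  rwa [add_sub_cancel] at this

theorem polyStar_eq_of_sigmaNu_eq {p q : MvPolynomial ι ℝ} {Q : Polynomial (MvPolynomial ι ℝ)}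
    (h : sigmaNuLin e Q = sigmaNuLin e (Polynomial.C p) * sigmaNuLin e (Polynomial.C q)) :
    polyStar e p q = Q := by
  rw [polyStar, ← sigmaNuLin_apply, ← sigmaNuLin_apply, ← h]
  exact Function.leftInverse_invFun (sigmaNu_injective e) Q

theorem sigmaNuLin_C_pow (z : L) (k : ℕ) :
    sigmaNuLin e (Polynomial.C (linForm e z ^ k)) = Polynomial.monomial 1 (ueaIncl z) ^ k := by
  rw [← Polynomial.monomial_zero_left, sigmaNuLin_monomial_pow, Polynomial.monomial_pow, zero_add,
    one_mul]

theorem sum_antidiagonal_coeff_C (B : PowerSeries (Module.End ℝ (MvPolynomial ι ℝ)))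
    (r : ℕ) (q : MvPolynomial ι ℝ) :
    ∑ p ∈ antidiagonal r, PowerSeries.coeff p.1 B ((Polynomial.C q).coeff p.2) =
      PowerSeries.coeff r B q := by
  simpa using sum_antidiagonal_coeff_monomial B 0 r q

/-- Since `σ_ν(ẑ ^ k) = (ν z) ^ k`, left multiplication by it is the `k`-th power of an intertwined
operator. This exhibits the product as a value of `σ_ν`, so `Function.invFun` returns a genuine
preimage. -/
theorem exists_polyStar_pow_left (z : L) (k : ℕ) (q : MvPolynomial ι ℝ) :
    (∀ r, (polyStar e (linForm e z ^ k) q).coeff r =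
      PowerSeries.coeff r (leftSeries e mulX pderivEnd z ^ k) q) ∧
    sigmaNuLin e (polyStar e (linForm e z ^ k) q) =
      sigmaNuLin e (Polynomial.C (linForm e z ^ k)) * sigmaNuLin e (Polynomial.C q) := by
  obtain ⟨Q, hQ, hQ'⟩ := (intertwines_leftSeries e z).pow k (Polynomial.C q)
  rw [LinearMap.pow_mulLeft, LinearMap.mulLeft_apply, ← sigmaNuLin_C_pow e] at hQ'
  rw [polyStar_eq_of_sigmaNu_eq e hQ']
  exact ⟨fun r => by rw [hQ, sum_antidiagonal_coeff_C], hQ'⟩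

theorem coeff_polyStar_pow_left (z : L) (k : ℕ) (q : MvPolynomial ι ℝ) (r : ℕ) :
    (polyStar e (linForm e z ^ k) q).coeff r =
      PowerSeries.coeff r (leftSeries e mulX pderivEnd z ^ k) q :=
  (exists_polyStar_pow_left e z k q).1 r

theorem coeff_polyStar_pow_right (z : L) (k : ℕ) (q : MvPolynomial ι ℝ) (r : ℕ) :
    (polyStar e q (linForm e z ^ k)).coeff r =
      PowerSeries.coeff r (rightSeries e mulX pderivEnd z ^ k) q := by
  obtain ⟨Q, hQ, hQ'⟩ := (intertwines_rightSeries e z).pow k (Polynomial.C q)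
  rw [LinearMap.pow_mulRight, LinearMap.mulRight_apply, ← sigmaNuLin_C_pow e] at hQ'
  rw [polyStar_eq_of_sigmaNu_eq e hQ', hQ, sum_antidiagonal_coeff_C]

/-- The range of `σ_ν` contains these products when `p` is a power of a linear form, and such powers
span. With injectivity this gives bilinearity of the star product. -/
theorem sigmaNuLin_polyStar (p q : MvPolynomial ι ℝ) :
    sigmaNuLin e (polyStar e p q) =
      sigmaNuLin e (Polynomial.C p) * sigmaNuLin e (Polynomial.C q) := by
  have hp : p ∈ Submodule.span ℝ {p | ∃ z k, linForm e z ^ k = p} := by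
    rw [span_linForm_pow]; trivial
  suffices ∃ Q, sigmaNuLin e Q = sigmaNuLin e (Polynomial.C p) * sigmaNuLin e (Polynomial.C q) by
    obtain ⟨Q, hQ⟩ := this
    rw [polyStar_eq_of_sigmaNu_eq e hQ, hQ]
  induction hp using Submodule.span_induction with
  | mem p hp =>
    obtain ⟨z, k, rfl⟩ := hp
    exact ⟨_, (exists_polyStar_pow_left e z k q).2⟩
  | zero => exact ⟨0, by simp⟩
  | add p p' _ _ h h' =>
    obtain ⟨Q, hQ⟩ := h
    obtain ⟨Q', hQ'⟩ := h'
    exact ⟨Q + Q', by rw [map_add, hQ, hQ', map_add, map_add, add_mul]⟩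
  | smul c p _ h =>
    obtain ⟨Q, hQ⟩ := h
    exact ⟨c • Q, by rw [map_smul, hQ, ← Polynomial.smul_C, map_smul, smul_mul_assoc]⟩

/-- The star product of polynomials as a bilinear map. -/
def polyStarBilin :
    MvPolynomial ι ℝ →ₗ[ℝ] MvPolynomial ι ℝ →ₗ[ℝ] Polynomial (MvPolynomial ι ℝ) :=
  LinearMap.mk₂ ℝ (polyStar e)
    (fun p p' q => polyStar_eq_of_sigmaNu_eq e <| by
      simp only [map_add, sigmaNuLin_polyStar, add_mul])
    (fun c p q => polyStar_eq_of_sigmaNu_eq e <| by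
      rw [map_smul, sigmaNuLin_polyStar, ← Polynomial.smul_C, map_smul, smul_mul_assoc])
    (fun p q q' => polyStar_eq_of_sigmaNu_eq e <| by
      simp only [map_add, sigmaNuLin_polyStar, mul_add])
    (fun c p q => polyStar_eq_of_sigmaNu_eq e <| by
      rw [map_smul, sigmaNuLin_polyStar, ← Polynomial.smul_C, map_smul, mul_smul_comm])

/-- The `r`-th bidifferential operator on polynomials. -/
def polyCochain (r : ℕ) : MvPolynomial ι ℝ →ₗ[ℝ] MvPolynomial ι ℝ →ₗ[ℝ] MvPolynomial ι ℝ :=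
  (polyStarBilin e).compr₂ ((Polynomial.lcoeff (MvPolynomial ι ℝ) r).restrictScalars ℝ)

theorem polyCochain_apply (r : ℕ) (p q : MvPolynomial ι ℝ) :
    polyCochain e r p q = (polyStar e p q).coeff r := rfl

/-- Left and right multiplications in an associative algebra commute, and injectivity of `σ_ν`
carries this over to the formal operators. -/
theorem leftSeries_mul_rightSeries (z : L) :
    leftSeries e mulX pderivEnd z * rightSeries e mulX pderivEnd z =
      rightSeries e mulX pderivEnd z * leftSeries e mulX pderivEnd z := by
  ext1 r
  refine LinearMap.ext fun q => ?_
  obtain ⟨P, hP, hP'⟩ :=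
    (intertwines_leftSeries e z).mul (intertwines_rightSeries e z) (Polynomial.C q)
  obtain ⟨Q, hQ, hQ'⟩ :=
    (intertwines_rightSeries e z).mul (intertwines_leftSeries e z) (Polynomial.C q)
  rw [← sum_antidiagonal_coeff_C, ← sum_antidiagonal_coeff_C, ← hP, ← hQ]
  have : P = Q := sigmaNu_injective e <| by
    rw [← sigmaNuLin_apply, ← sigmaNuLin_apply, hP', hQ']
    simp [mul_assoc]
  rw [this]

end StarProduct

end

end BCH

namespace BCH

noncomputable section

open Finset.HasAntidiagonal (antidiagonal)

/-! ### Orders of the bidifferential operators and Taylor expansion -/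

section Order

variable {L : Type*} [LieRing L] [LieAlgebra ℝ L] {ι : Type*} [Fintype ι]

/-- Evaluation of polynomials at a point as a linear map. -/
def evalLin (ξ : ι → ℝ) : MvPolynomial ι ℝ →ₗ[ℝ] ℝ := (MvPolynomial.aeval ξ).toLinearMap

theorem evalLin_apply (ξ : ι → ℝ) (p : MvPolynomial ι ℝ) :
    evalLin ξ p = MvPolynomial.eval ξ p := rfl

/-- The ideal of polynomials vanishing at a point. -/
def pointIdeal (ξ : ι → ℝ) : Ideal (MvPolynomial ι ℝ) :=
  Ideal.span (Set.range fun i => MvPolynomial.X i - MvPolynomial.C (ξ i))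

theorem eval_eq_zero_of_mem_pointIdeal {ξ : ι → ℝ} {p : MvPolynomial ι ℝ} (h : p ∈ pointIdeal ξ) :
    MvPolynomial.eval ξ p = 0 := by
  have : pointIdeal ξ ≤ RingHom.ker (MvPolynomial.eval ξ) := by
    refine Ideal.span_le.2 ?_
    rintro _ ⟨i, rfl⟩
    simp [RingHom.mem_ker]
  exact this h

/-- An operator on polynomials which is a differential operator of order at most `r`. -/
def HasOrder (r : ℕ) (F : Module.End ℝ (MvPolynomial ι ℝ)) : Prop :=
  ∀ (ξ : ι → ℝ) (j : ℕ), ∀ p ∈ pointIdeal ξ ^ (j + r), F p ∈ pointIdeal ξ ^ j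

theorem HasOrder.mono {r s : ℕ} {F : Module.End ℝ (MvPolynomial ι ℝ)} (h : HasOrder r F)
    (hrs : r ≤ s) : HasOrder s F :=
  fun ξ j p hp => h ξ j p (Ideal.pow_le_pow_right (by omega) hp)

theorem HasOrder.add {r : ℕ} {F F' : Module.End ℝ (MvPolynomial ι ℝ)} (h : HasOrder r F)
    (h' : HasOrder r F') : HasOrder r (F + F') :=
  fun ξ j p hp => Ideal.add_mem _ (h ξ j p hp) (h' ξ j p hp)

theorem HasOrder.zero {r : ℕ} : HasOrder r (0 : Module.End ℝ (MvPolynomial ι ℝ)) :=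
  fun _ _ _ _ => Ideal.zero_mem _

theorem HasOrder.smul {r : ℕ} {F : Module.End ℝ (MvPolynomial ι ℝ)} (h : HasOrder r F) (c : ℝ) :
    HasOrder r (c • F) := fun ξ j p hp => by
  rw [LinearMap.smul_apply, MvPolynomial.smul_eq_C_mul]
  exact Ideal.mul_mem_left _ _ (h ξ j p hp)

theorem HasOrder.sum {α : Type*} {r : ℕ} {F : α → Module.End ℝ (MvPolynomial ι ℝ)} {s : Finset α}
    (h : ∀ a ∈ s, HasOrder r (F a)) : HasOrder r (∑ a ∈ s, F a) := fun ξ j p hp => by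
  rw [LinearMap.sum_apply]
  exact Ideal.sum_mem _ fun a ha => h a ha ξ j p hp

theorem HasOrder.mul {r s : ℕ} {F F' : Module.End ℝ (MvPolynomial ι ℝ)} (h : HasOrder r F)
    (h' : HasOrder s F') : HasOrder (r + s) (F * F') :=
  fun ξ j p hp => h ξ j _ (h' ξ (j + r) p (by rwa [add_assoc]))

theorem hasOrder_mulX (i : ι) : HasOrder 0 (mulX i) :=
  fun _ _ _ hp => Ideal.mul_mem_left _ _ hp

theorem hasOrder_pderivEnd (i : ι) : HasOrder 1 (pderivEnd i) := by
  intro ξ j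
  induction j with
  | zero => intro p _; simp
  | succ j ih =>
    intro p hp
    rw [pow_succ' _ (j + 1)] at hp
    refine Submodule.mul_induction_on hp (fun a ha b hb => ?_) fun a b ha hb => ?_
    · rw [pderivEnd_apply, Derivation.leibniz, smul_eq_mul, smul_eq_mul]
      refine Ideal.add_mem _ ?_ (Ideal.mul_mem_right _ _ hb)
      rw [pow_succ']
      exact Ideal.mul_mem_mul ha (ih b hb)
    · rw [map_add]
      exact Ideal.add_mem _ ha hb

variable (e : Module.Basis ι ℝ L)

theorem hasOrder_polyOp (m : ℕ) (x : L) : HasOrder m (polyOp e m x) := by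
  induction m generalizing x with
  | zero =>
    rw [polyOp, orderOp_zero, constr_apply_eq_sum]
    exact HasOrder.sum fun i _ => (hasOrder_mulX i).smul _
  | succ m ih =>
    rw [polyOp, orderOp_succ]
    exact HasOrder.sum fun i _ => (ih _).mul (hasOrder_pderivEnd i)

theorem hasOrder_coeff_leftSeries (x : L) (r : ℕ) :
    HasOrder r (PowerSeries.coeff r (leftSeries e mulX pderivEnd x)) := by
  rw [leftSeries, PowerSeries.coeff_mk]
  exact (hasOrder_polyOp e r x).smul _

theorem hasOrder_coeff_rightSeries (x : L) (r : ℕ) :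
    HasOrder r (PowerSeries.coeff r (rightSeries e mulX pderivEnd x)) := by
  rw [rightSeries, map_add]
  refine (hasOrder_coeff_leftSeries e x r).add ?_
  cases r with
  | zero => rw [PowerSeries.coeff_zero_X_mul]; exact HasOrder.zero
  | succ r =>
    rw [PowerSeries.coeff_succ_X_mul, PowerSeries.coeff_C]
    split_ifs with h
    · exact (hasOrder_polyOp e 1 x).mono (by omega)
    · exact HasOrder.zero

/-- The bound “order at most the exponent of `ν`” is stable under products, since orders and
exponents both add. -/
theorem hasOrder_coeff_pow {B : PowerSeries (Module.End ℝ (MvPolynomial ι ℝ))}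
    (h : ∀ r, HasOrder r (PowerSeries.coeff r B)) (k r : ℕ) :
    HasOrder r (PowerSeries.coeff r (B ^ k)) := by
  induction k generalizing r with
  | zero =>
    rw [pow_zero, PowerSeries.coeff_one]
    split_ifs
    · exact fun ξ j p hp => Ideal.pow_le_pow_right (by omega) hp
    · exact HasOrder.zero
  | succ k ih =>
    rw [pow_succ, PowerSeries.coeff_mul]
    refine HasOrder.sum fun p hp => ?_
    rw [Finset.HasAntidiagonal.mem_antidiagonal] at hp
    rw [← hp]
    exact (ih _).mul (h _)

/-- For `p` a power of a linear form, `C_r(p, ·)` is a coefficient of a power of the left series, of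
order at most `r`. So it depends only on the `r`-jet of its argument at `ξ`; the left argument is
treated with the right series. -/
theorem eval_polyCochain_right_eq_zero {r : ℕ} {ξ : ι → ℝ} (p : MvPolynomial ι ℝ)
    {q : MvPolynomial ι ℝ} (hq : q ∈ pointIdeal ξ ^ (r + 1)) :
    MvPolynomial.eval ξ (polyCochain e r p q) = 0 := by
  have : (evalLin ξ ∘ₗ (polyCochain e r).flip q) =
      (0 : MvPolynomial ι ℝ →ₗ[ℝ] ℝ) := by
    refine endo_ext (e := e) fun z k => ?_
    rw [LinearMap.comp_apply, LinearMap.flip_apply, polyCochain_apply, coeff_polyStar_pow_left]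
    have h := hasOrder_coeff_pow (hasOrder_coeff_leftSeries e z) k r ξ 1 q (by rwa [add_comm])
    rw [pow_one] at h
    exact eval_eq_zero_of_mem_pointIdeal h
  exact LinearMap.congr_fun this p

theorem eval_polyCochain_left_eq_zero {r : ℕ} {ξ : ι → ℝ} {p : MvPolynomial ι ℝ}
    (q : MvPolynomial ι ℝ) (hp : p ∈ pointIdeal ξ ^ (r + 1)) :
    MvPolynomial.eval ξ (polyCochain e r p q) = 0 := by
  have : (evalLin ξ ∘ₗ polyCochain e r p) =
      (0 : MvPolynomial ι ℝ →ₗ[ℝ] ℝ) := by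
    refine endo_ext (e := e) fun z k => ?_
    rw [LinearMap.comp_apply, polyCochain_apply, coeff_polyStar_pow_right]
    have h := hasOrder_coeff_pow (hasOrder_coeff_rightSeries e z) k r ξ 1 p (by rwa [add_comm])
    rw [pow_one] at h
    exact eval_eq_zero_of_mem_pointIdeal h
  exact LinearMap.congr_fun this q

section Taylor

/-- The product `D (i 0) ⋯ D (i (k - 1))`. -/
def prodOp {A : Type*} [Monoid A] (D : ι → A) {k : ℕ} (i : Fin k → ι) : A :=
  (List.ofFn fun a => D (i a)).prod

theorem prodOp_zero {A : Type*} [Monoid A] (D : ι → A) (i : Fin 0 → ι) : prodOp D i = 1 := by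
  simp [prodOp]

theorem prodOp_succ {A : Type*} [Monoid A] (D : ι → A) {k : ℕ} (i : Fin (k + 1) → ι) :
    prodOp D i = D (i 0) * prodOp D (Fin.tail i) := by
  rw [prodOp, List.ofFn_succ, List.prod_cons]
  rfl

/-- The monomial of degree `k` centred at `ξ`. -/
def centredMonomial (ξ : ι → ℝ) {k : ℕ} (i : Fin k → ι) : MvPolynomial ι ℝ :=
  ∏ a, (MvPolynomial.X (i a) - MvPolynomial.C (ξ (i a)))

/-- The affine function with linear part `z` that vanishes at `ξ`. -/
def centredForm (ξ : ι → ℝ) : L →ₗ[ℝ] MvPolynomial ι ℝ :=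
  e.constr ℝ fun i => MvPolynomial.X i - MvPolynomial.C (ξ i)

theorem centredForm_eq_sum (ξ : ι → ℝ) (z : L) :
    centredForm e ξ z = ∑ i, e.repr z i •
      (MvPolynomial.X i - MvPolynomial.C (ξ i) : MvPolynomial ι ℝ) :=
  constr_apply_eq_sum e _ z

theorem span_centredForm_pow (ξ : ι → ℝ) :
    Submodule.span ℝ {a | ∃ z k, centredForm e ξ z ^ k = a} = ⊤ := by
  refine span_powers_eq_top _ ?_
  rw [eq_top_iff, ← MvPolynomial.adjoin_range_X, Algebra.adjoin_le_iff]
  rintro _ ⟨i, rfl⟩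
  have h1 : (MvPolynomial.X i - MvPolynomial.C (ξ i) : MvPolynomial ι ℝ) ∈
      Algebra.adjoin ℝ (Set.range (centredForm e ξ)) :=
    Algebra.subset_adjoin ⟨e i, by rw [centredForm, Module.Basis.constr_basis]⟩
  have h2 := Subalgebra.add_mem _ h1
    (Subalgebra.algebraMap_mem (Algebra.adjoin ℝ (Set.range (centredForm e ξ))) (ξ i))
  rwa [MvPolynomial.algebraMap_eq, sub_add_cancel] at h2

theorem pderiv_centredForm (ξ : ι → ℝ) (i : ι) (z : L) :
    MvPolynomial.pderiv i (centredForm e ξ z) = MvPolynomial.C (e.repr z i) := by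
  classical
  simp [centredForm_eq_sum, MvPolynomial.pderiv_X, Pi.single_apply, MvPolynomial.smul_eq_C_mul]

theorem prodOp_pderivEnd_centredForm_pow (ξ : ι → ℝ) (z : L) (d : ℕ) {k : ℕ} (i : Fin k → ι) :
    prodOp pderivEnd i (centredForm e ξ z ^ d) =
      ((d.descFactorial k : ℝ) * ∏ a, e.repr z (i a)) • centredForm e ξ z ^ (d - k) := by
  induction k with
  | zero => simp [prodOp_zero]
  | succ k ih =>
    rw [prodOp_succ, Module.End.mul_apply, ih, map_smul, pderivEnd_apply, Derivation.leibniz_pow,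
      pderiv_centredForm, Fin.prod_univ_succ, Nat.descFactorial_succ, Nat.sub_sub]
    simp only [MvPolynomial.smul_eq_C_mul, smul_eq_mul, nsmul_eq_mul, map_mul, map_natCast,
      Nat.cast_mul, Fin.tail]
    ring

theorem centredForm_mem (ξ : ι → ℝ) (z : L) : centredForm e ξ z ∈ pointIdeal ξ := by
  rw [centredForm_eq_sum]
  refine Ideal.sum_mem _ fun i _ => ?_
  rw [MvPolynomial.smul_eq_C_mul]
  exact Ideal.mul_mem_left _ _ (Ideal.subset_span ⟨i, rfl⟩)

theorem centredForm_pow_eq_sum (ξ : ι → ℝ) (z : L) (d : ℕ) :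
    centredForm e ξ z ^ d =
      ∑ i : Fin d → ι, (∏ a, e.repr z (i a)) • centredMonomial ξ i := by
  classical
  rw [centredForm_eq_sum, ← Fin.prod_const, Finset.prod_univ_sum, Fintype.piFinset_univ]
  refine Finset.sum_congr rfl fun i _ => ?_
  rw [centredMonomial, Finset.prod_smul]

/-- Taylor's formula for a functional depending on the `r`-jet at `ξ` only. -/
theorem functional_eq_sum_taylor (e : Module.Basis ι ℝ L) {r : ℕ} {ξ : ι → ℝ}
    (F : MvPolynomial ι ℝ →ₗ[ℝ] ℝ)
    (hF : ∀ p ∈ pointIdeal ξ ^ (r + 1), F p = 0) (p : MvPolynomial ι ℝ) :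
    F p = ∑ k ∈ Finset.range (r + 1), ∑ i : Fin k → ι, (k.factorial : ℝ)⁻¹ *
      MvPolynomial.eval ξ (prodOp pderivEnd i p) * F (centredMonomial ξ i) := by
  have : F = ∑ k ∈ Finset.range (r + 1), ∑ i : Fin k → ι,
      ((k.factorial : ℝ)⁻¹ * F (centredMonomial ξ i)) •
        (evalLin ξ ∘ₗ (prodOp pderivEnd i)) := by
    refine LinearMap.ext_on (span_centredForm_pow e ξ) ?_
    rintro _ ⟨z, d, rfl⟩
    simp only [LinearMap.sum_apply, LinearMap.smul_apply, LinearMap.comp_apply,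
      prodOp_pderivEnd_centredForm_pow, map_smul, evalLin_apply, map_pow]
    have h0 : MvPolynomial.eval ξ (centredForm e ξ z) = 0 :=
      eval_eq_zero_of_mem_pointIdeal (centredForm_mem e ξ z)
    -- On `centredForm e ξ z ^ d` only derivatives of order exactly `d` survive at `ξ`: lower ones
    -- leave a factor vanishing there, higher ones are zero. The sum runs over words, and `1 / d!`
    -- cancels the factor `d!` of the top derivative.
    have h1 : ∀ k, k ≠ d → ∀ c : ℝ, c * ((d.descFactorial k : ℝ) *
        MvPolynomial.eval ξ (centredForm e ξ z) ^ (d - k)) = 0 := fun k hk c => by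
      rcases lt_or_gt_of_ne hk with h | h
      · rw [h0, zero_pow (by omega), mul_zero, mul_zero]
      · rw [Nat.descFactorial_eq_zero_iff_lt.2 h, Nat.cast_zero, zero_mul, mul_zero]
    rcases le_or_gt d r with hd | hd
    · rw [Finset.sum_eq_single d]
      · rw [centredForm_pow_eq_sum, map_sum]
        refine Finset.sum_congr rfl fun i _ => ?_
        have : (d.factorial : ℝ) ≠ 0 := by positivity
        rw [Nat.descFactorial_self, Nat.sub_self, pow_zero, map_smul, smul_eq_mul, smul_eq_mul,
          smul_eq_mul]
        field_simp
      · intro k _ hk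
        refine Finset.sum_eq_zero fun i _ => ?_
        simp only [smul_eq_mul]
        refine Eq.trans ?_ (h1 k hk ((k.factorial : ℝ)⁻¹ * F (centredMonomial ξ i) *
          ∏ a, e.repr z (i a)))
        ring
      · intro h
        exact absurd (Finset.mem_range.2 (by omega)) h
    · rw [hF _ (Ideal.pow_le_pow_right (by omega) (Ideal.pow_mem_pow (centredForm_mem e ξ z) d))]
      refine (Finset.sum_eq_zero fun k hk => Finset.sum_eq_zero fun i _ => ?_).symm
      rw [Finset.mem_range] at hk
      simp only [smul_eq_mul]
      refine Eq.trans ?_ (h1 k (by omega) ((k.factorial : ℝ)⁻¹ * F (centredMonomial ξ i) *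
        ∏ a, e.repr z (i a)))
      ring
  conv_lhs => rw [this]
  simp only [LinearMap.sum_apply, LinearMap.smul_apply, LinearMap.comp_apply, smul_eq_mul]
  refine Finset.sum_congr rfl fun k _ => Finset.sum_congr rfl fun i _ => ?_
  rw [mul_right_comm]
  rfl

theorem symbol_eq (r : ℕ) {k l : ℕ} (i : Fin k → ι) (j : Fin l → ι) (ξ : ι → ℝ) :
    symbol e r i j ξ =
      MvPolynomial.eval ξ (polyCochain e r (centredMonomial ξ i) (centredMonomial ξ j)) := rfl

/-- Taylor's formula in each argument in turn. It shows that the expression defining `cochain`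
agrees on polynomials with the coefficient of `polyStar`. -/
theorem eval_polyCochain (r : ℕ) (p q : MvPolynomial ι ℝ) (ξ : ι → ℝ) :
    MvPolynomial.eval ξ (polyCochain e r p q) =
      ∑ k ∈ Finset.range (r + 1), ∑ l ∈ Finset.range (r + 1),
        ∑ i : Fin k → ι, ∑ j : Fin l → ι,
          ((k.factorial : ℝ)⁻¹ * (l.factorial : ℝ)⁻¹ * symbol e r i j ξ) *
            (MvPolynomial.eval ξ (prodOp pderivEnd i p) *
              MvPolynomial.eval ξ (prodOp pderivEnd j q)) := by
  have h1 := functional_eq_sum_taylor e (r := r) (ξ := ξ) (evalLin ξ ∘ₗ (polyCochain e r).flip q)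
    (fun p hp => by
      rw [LinearMap.comp_apply, LinearMap.flip_apply, evalLin_apply]
      exact eval_polyCochain_left_eq_zero e q hp) p
  have h2 : ∀ {k : ℕ} (i : Fin k → ι), _ := fun i =>
    functional_eq_sum_taylor e (r := r) (ξ := ξ) (evalLin ξ ∘ₗ polyCochain e r
      (centredMonomial ξ i))
    (fun q hq => by
      rw [LinearMap.comp_apply, evalLin_apply]
      exact eval_polyCochain_right_eq_zero e _ hq) q
  simp only [LinearMap.comp_apply, LinearMap.flip_apply, evalLin_apply] at h1 h2
  rw [h1]
  refine Finset.sum_congr rfl fun k _ => ?_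
  rw [Finset.sum_comm]
  refine Finset.sum_congr rfl fun i _ => ?_
  rw [h2, Finset.mul_sum]
  refine Finset.sum_congr rfl fun l _ => ?_
  rw [Finset.mul_sum]
  refine Finset.sum_congr rfl fun j _ => ?_
  rw [symbol_eq]
  ring

/-- The point `ξ` occurs both as the centre of the monomials and as the point of evaluation.
Expanding the centred products over subsets and turning each `ξ (i a)` into a variable makes the
dependence polynomial. -/
theorem exists_symbol_eq_eval (r : ℕ) {k l : ℕ} (i : Fin k → ι) (j : Fin l → ι) :
    ∃ P : MvPolynomial ι ℝ, ∀ ξ, symbol e r i j ξ = MvPolynomial.eval ξ P := by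
  classical
  have h : ∀ (ξ : ι → ℝ) {k : ℕ} (i : Fin k → ι), centredMonomial ξ i =
      ∑ s : Finset (Fin k), (∏ a ∈ sᶜ, - ξ (i a)) • ∏ a ∈ s, MvPolynomial.X (i a) :=
    fun ξ k i => by
      rw [centredMonomial]
      simp only [sub_eq_add_neg]
      rw [Finset.prod_add]
      simp [MvPolynomial.smul_eq_C_mul, mul_comm, Finset.compl_eq_univ_sdiff]
  refine ⟨∑ s : Finset (Fin k), ∑ t : Finset (Fin l),
    (∏ a ∈ sᶜ, - MvPolynomial.X (i a)) * ((∏ b ∈ tᶜ, - MvPolynomial.X (j b)) *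
      polyCochain e r (∏ a ∈ s, MvPolynomial.X (i a)) (∏ b ∈ t, MvPolynomial.X (j b))),
    fun ξ => ?_⟩
  rw [symbol_eq, h, h]
  simp only [map_sum, map_smul, LinearMap.sum_apply, LinearMap.smul_apply]
  rw [Finset.sum_comm]
  simp [MvPolynomial.smul_eq_C_mul, map_prod, mul_left_comm, Finset.mul_sum]

end Taylor

end Order

end

end BCH

namespace BCH

noncomputable section

open Finset.HasAntidiagonal (antidiagonal)

/-! ### Smooth functions, integration by parts and density of polynomials -/

section SmoothFunctions

variable {ι : Type*} [Fintype ι] {𝕜 : Type*} [RCLike 𝕜]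

variable (ι 𝕜) in
/-- The smooth functions on `ι → ℝ` as a subalgebra of all functions. -/
def smoothSubalgebra : Subalgebra ℝ ((ι → ℝ) → 𝕜) where
  carrier := {f | ContDiff ℝ ∞ f}
  mul_mem' {f g} (hf : ContDiff ℝ ∞ f) (hg : ContDiff ℝ ∞ g) := hf.mul hg
  add_mem' {f g} (hf : ContDiff ℝ ∞ f) (hg : ContDiff ℝ ∞ g) := hf.add hg
  algebraMap_mem' c := (contDiff_const : ContDiff ℝ ∞ fun _ => algebraMap ℝ 𝕜 c)

variable (ι 𝕜) in
/-- The algebra of smooth functions on `ι → ℝ`. -/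
def SmoothFn : Type _ := smoothSubalgebra ι 𝕜

instance : CommRing (SmoothFn ι 𝕜) := inferInstanceAs (CommRing (smoothSubalgebra ι 𝕜))

instance : Algebra ℝ (SmoothFn ι 𝕜) := inferInstanceAs (Algebra ℝ (smoothSubalgebra ι 𝕜))

/-- A smooth function as an element of `SmoothFn`. -/
def SmoothFn.of (f : (ι → ℝ) → 𝕜) (hf : ContDiff ℝ ∞ f) : SmoothFn ι 𝕜 := ⟨f, hf⟩

/-- The coordinates as smooth functions. -/
def SmoothFn.coord (i : ι) : SmoothFn ι 𝕜 :=
  .of (fun ξ => ((ξ i : ℝ) : 𝕜)) ((RCLike.ofRealCLM (K := 𝕜)).contDiff.comp (contDiff_apply ℝ ℝ i))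

@[ext] theorem SmoothFn.ext {f g : SmoothFn ι 𝕜} (h : ∀ ξ, f.1 ξ = g.1 ξ) : f = g :=
  Subtype.ext (funext h)

/-- Compactly supported smooth functions. -/
def IsCompactlySupported (f : SmoothFn ι 𝕜) : Prop := HasCompactSupport f.1

theorem SmoothFn.contDiff (f : SmoothFn ι 𝕜) : ContDiff ℝ ∞ f.1 := f.2

theorem SmoothFn.continuous (f : SmoothFn ι 𝕜) : Continuous f.1 :=
  f.contDiff.continuous

theorem SmoothFn.differentiable (f : SmoothFn ι 𝕜) : Differentiable ℝ f.1 :=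
  f.contDiff.differentiable (by simp)

theorem IsCompactlySupported.integrable {f : SmoothFn ι 𝕜} (h : IsCompactlySupported f) :
    Integrable f.1 :=
  f.continuous.integrable_of_hasCompactSupport h

theorem IsCompactlySupported.mul_left {f : SmoothFn ι 𝕜} (h : IsCompactlySupported f)
    (g : SmoothFn ι 𝕜) : IsCompactlySupported (g * f) := HasCompactSupport.mul_left h

theorem IsCompactlySupported.mul_right {f : SmoothFn ι 𝕜} (h : IsCompactlySupported f)
    (g : SmoothFn ι 𝕜) : IsCompactlySupported (f * g) := HasCompactSupport.mul_right h

theorem IsCompactlySupported.add {f g : SmoothFn ι 𝕜} (h : IsCompactlySupported f)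
    (h' : IsCompactlySupported g) : IsCompactlySupported (f + g) := HasCompactSupport.add h h'

theorem IsCompactlySupported.zero : IsCompactlySupported (0 : SmoothFn ι 𝕜) :=
  HasCompactSupport.zero

theorem IsCompactlySupported.smul {f : SmoothFn ι 𝕜} (h : IsCompactlySupported f) (c : ℝ) :
    IsCompactlySupported (c • f) := by
  rw [Algebra.smul_def]; exact h.mul_left _

theorem IsCompactlySupported.sum {α : Type*} {s : Finset α} {f : α → SmoothFn ι 𝕜}
    (h : ∀ a ∈ s, IsCompactlySupported (f a)) : IsCompactlySupported (∑ a ∈ s, f a) :=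
  Finset.sum_induction _ _ (fun _ _ => IsCompactlySupported.add) IsCompactlySupported.zero h

/-- The integral of a smooth function. -/
def integ (f : SmoothFn ι 𝕜) : 𝕜 := ∫ ξ, f.1 ξ

theorem integ_add {f g : SmoothFn ι 𝕜} (hf : IsCompactlySupported f)
    (hg : IsCompactlySupported g) : integ (f + g) = integ f + integ g :=
  integral_add hf.integrable hg.integrable

theorem integ_smul (c : ℝ) (f : SmoothFn ι 𝕜) : integ (c • f) = c • integ f :=
  integral_smul c _

theorem integ_zero : integ (0 : SmoothFn ι 𝕜) = 0 := integral_zero _ _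

theorem integ_sum {α : Type*} {s : Finset α} {f : α → SmoothFn ι 𝕜}
    (h : ∀ a ∈ s, IsCompactlySupported (f a)) : integ (∑ a ∈ s, f a) = ∑ a ∈ s, integ (f a) := by
  classical
  induction s using Finset.induction_on with
  | empty => simp [integ_zero]
  | insert a s ha ih =>
    rw [Finset.sum_insert ha, Finset.sum_insert ha, integ_add (h a (Finset.mem_insert_self a s))
      (IsCompactlySupported.sum fun b hb => h b (Finset.mem_insert_of_mem hb)),
      ih fun b hb => h b (Finset.mem_insert_of_mem hb)]

/-- A partial derivative of smooth functions. -/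
def partialDeriv (i : ι) : Module.End ℝ (SmoothFn ι 𝕜) where
  toFun f := ⟨fun ξ => fderiv ℝ f.1 ξ (Pi.basisFun ℝ ι i),
    (f.contDiff.fderiv_right (m := ∞) (by simp)).clm_apply contDiff_const⟩
  map_add' f g := by
    ext ξ
    change fderiv ℝ (f.1 + g.1) ξ _ = _
    rw [fderiv_add (f.differentiable ξ) (g.differentiable ξ)]
    rfl
  map_smul' c f := by
    ext ξ
    change fderiv ℝ (c • f.1) ξ _ = _
    rw [fderiv_const_smul (f.differentiable ξ)]
    rfl

theorem partialDeriv_apply (i : ι) (f : SmoothFn ι 𝕜) (ξ : ι → ℝ) :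
    (partialDeriv i f).1 ξ =
      fderiv ℝ f.1 ξ (Pi.basisFun ℝ ι i) := rfl

theorem partialDeriv_mul (i : ι) (f g : SmoothFn ι 𝕜) :
    partialDeriv i (f * g) = f * partialDeriv i g + partialDeriv i f * g := by
  ext ξ
  change fderiv ℝ (f.1 * g.1) ξ _ = _
  rw [fderiv_mul (f.differentiable ξ) (g.differentiable ξ)]
  change f.1 ξ * fderiv ℝ g.1 ξ _ + g.1 ξ * fderiv ℝ f.1 ξ _ =
    f.1 ξ * fderiv ℝ g.1 ξ _ + fderiv ℝ f.1 ξ _ * g.1 ξ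
  rw [mul_comm (g.1 ξ)]

theorem IsCompactlySupported.partialDeriv {f : SmoothFn ι 𝕜} (h : IsCompactlySupported f) (i : ι) :
    IsCompactlySupported (partialDeriv i f) := HasCompactSupport.fderiv_apply ℝ h _

theorem integ_mul_partialDeriv (i : ι) {f φ : SmoothFn ι 𝕜} (h : IsCompactlySupported φ) :
    integ (partialDeriv i f * φ) = - integ (f * partialDeriv i φ) := by
  rw [eq_neg_iff_add_eq_zero, add_comm, ← eq_neg_iff_add_eq_zero]
  exact integral_mul_fderiv_eq_neg_fderiv_mul_of_integrable
    (h.mul_left (BCH.partialDeriv i f)).integrable ((h.partialDeriv i).mul_left f).integrable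
    (h.mul_left f).integrable (fun x _ => f.differentiable x) (fun x _ => φ.differentiable x)

/-- Real polynomials as smooth functions. -/
def polyIncl : MvPolynomial ι ℝ →ₐ[ℝ] SmoothFn ι 𝕜 :=
  MvPolynomial.aeval SmoothFn.coord

theorem polyIncl_apply (p : MvPolynomial ι ℝ) (ξ : ι → ℝ) :
    (polyIncl p : SmoothFn ι 𝕜).1 ξ = ((MvPolynomial.eval ξ p : ℝ) : 𝕜) := by
  induction p using MvPolynomial.induction_on with
  | C a => rw [← MvPolynomial.algebraMap_eq, AlgHom.commutes, MvPolynomial.algebraMap_eq,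
      MvPolynomial.eval_C, ← RCLike.algebraMap_eq_ofReal]; rfl
  | add p q hp hq => rw [map_add, map_add, RCLike.ofReal_add, ← hp, ← hq]; rfl
  | mul_X p i hp =>
    rw [map_mul, map_mul, RCLike.ofReal_mul, ← hp, MvPolynomial.eval_X]
    change _ * (polyIncl (MvPolynomial.X i) : SmoothFn ι 𝕜).1 ξ = _
    rw [polyIncl, MvPolynomial.aeval_X]
    rfl

theorem partialDeriv_polyIncl (i : ι) (p : MvPolynomial ι ℝ) :
    partialDeriv i (polyIncl p : SmoothFn ι 𝕜) = polyIncl (MvPolynomial.pderiv i p) := by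
  classical
  induction p using MvPolynomial.induction_on with
  | C a =>
    rw [← MvPolynomial.algebraMap_eq, AlgHom.commutes, Derivation.map_algebraMap, map_zero]
    ext ξ
    change fderiv ℝ (fun _ => algebraMap ℝ 𝕜 a) ξ _ = 0
    simp
  | add p q hp hq => rw [map_add, map_add, hp, hq, map_add, map_add]
  | mul_X p j hp =>
    rw [map_mul, partialDeriv_mul, hp, Derivation.leibniz, MvPolynomial.pderiv_X]
    have h : partialDeriv i (polyIncl (MvPolynomial.X j) : SmoothFn ι 𝕜) =
        polyIncl ((Pi.single i 1 : ι → MvPolynomial ι ℝ) j) := by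
      ext ξ
      have h1 : (polyIncl (MvPolynomial.X j) : SmoothFn ι 𝕜).1 =
          ((RCLike.ofRealCLM (K := 𝕜)).comp (ContinuousLinearMap.proj j) : (ι → ℝ) →L[ℝ] 𝕜) := by
        ext ξ
        rw [polyIncl_apply]; simp
      rw [partialDeriv_apply, h1, ContinuousLinearMap.fderiv, polyIncl_apply]
      by_cases hij : i = j
      · subst hij; simp
      · simp [Ne.symm hij]
    rw [h, smul_eq_mul, smul_eq_mul, map_add, map_mul, map_mul]
    ring

/-- Multiplication by a coordinate. -/
def coordMul (i : ι) : Module.End ℝ (SmoothFn ι 𝕜) :=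
  LinearMap.mulLeft ℝ (polyIncl (MvPolynomial.X i))

/-- Stone–Weierstrass: the coordinate functions separate points. -/
theorem exists_polynomial_near {K : Set (ι → ℝ)} (hK : IsCompact K) (g : C(ι → ℝ, ℝ)) {ε : ℝ}
    (hε : 0 < ε) : ∃ p : MvPolynomial ι ℝ, ∀ ξ ∈ K, ‖MvPolynomial.eval ξ p - g ξ‖ < ε := by
  let F : MvPolynomial ι ℝ →ₐ[ℝ] C(ι → ℝ, ℝ) :=
    MvPolynomial.aeval fun i => ⟨fun ξ => ξ i, continuous_apply i⟩
  have hF : ∀ p ξ, F p ξ = MvPolynomial.eval ξ p := fun p ξ => by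
    induction p using MvPolynomial.induction_on with
    | C a => rw [← MvPolynomial.algebraMap_eq, AlgHom.commutes]; simp
    | add p q hp hq => rw [map_add, map_add, ← hp, ← hq]; rfl
    | mul_X p i hp =>
      rw [map_mul, map_mul, ← hp, MvPolynomial.eval_X]
      change _ * F (MvPolynomial.X i) ξ = _
      rw [MvPolynomial.aeval_X]; rfl
  have hsep : F.range.SeparatesPoints := fun x y hxy => by
    obtain ⟨i, hi⟩ := Function.ne_iff.1 hxy
    exact ⟨_, ⟨F (MvPolynomial.X i), ⟨_, rfl⟩, rfl⟩, by simpa [hF] using hi⟩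
  obtain ⟨_, ⟨p, rfl⟩, hp⟩ :=
    ContinuousMap.exists_mem_subalgebra_near_continuous_of_isCompact_of_separatesPoints
      hsep g hK hε
  exact ⟨p, fun ξ hξ => by rw [← hF]; exact hp ξ hξ⟩

/-- A compactly supported smooth function orthogonal to all polynomials vanishes. -/
theorem eq_zero_of_integ_polyIncl_mul {φ : SmoothFn ι 𝕜} (hφ : IsCompactlySupported φ)
    (h : ∀ p : MvPolynomial ι ℝ, integ (polyIncl p * φ) = 0) : φ = 0 := by
  have hae : ∀ᵐ ξ, φ.1 ξ = 0 := by
    refine ae_eq_zero_of_integral_contDiff_smul_eq_zero φ.continuous.locallyIntegrable ?_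
    intro g hg _
    have hφn := hφ.integrable.norm
    have hint : ∀ g : (ι → ℝ) → ℝ, Continuous g → Integrable fun ξ => g ξ • φ.1 ξ :=
      fun g hg => (hg.smul φ.continuous).integrable_of_hasCompactSupport (hφ.smul_left)
    refine norm_le_zero_iff.1 (le_of_forall_pos_le_add fun δ hδ => ?_)
    set M := ∫ ξ, ‖φ.1 ξ‖ with hM
    have hM0 : 0 ≤ M := integral_nonneg fun _ => norm_nonneg _
    -- Approximate `g` on the support of `φ`. As `p` is orthogonal to `φ`, the integral of `g • φ`
    -- has norm at most `δ * M / (M + 1) ≤ δ`; the `+ 1` covers the case `M = 0`.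
    obtain ⟨p, hp⟩ := exists_polynomial_near hφ ⟨g, hg.continuous⟩
      (show 0 < δ / (M + 1) by positivity)
    have hpc : Continuous fun ξ => MvPolynomial.eval ξ p := MvPolynomial.continuous_eval p
    have h0 : ∫ ξ, MvPolynomial.eval ξ p • φ.1 ξ = 0 := by
      rw [← h p]
      refine integral_congr_ae (Filter.Eventually.of_forall fun ξ => ?_)
      change _ = (polyIncl p : SmoothFn ι 𝕜).1 ξ * φ.1 ξ
      rw [polyIncl_apply]
      exact RCLike.real_smul_eq_coe_mul _ _
    rw [← sub_zero (∫ ξ, g ξ • φ.1 ξ), ← h0, ← integral_sub (hint g hg.continuous) (hint _ hpc)]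
    refine (norm_integral_le_integral_norm _).trans ?_
    have hle : ∀ ξ, ‖g ξ • φ.1 ξ - MvPolynomial.eval ξ p • φ.1 ξ‖ ≤ δ / (M + 1) * ‖φ.1 ξ‖ :=
      fun ξ => by
        rw [← sub_smul, norm_smul]
        by_cases hξ : φ.1 ξ = 0
        · simp [hξ]
        · have := hp ξ (subset_tsupport _ hξ)
          rw [norm_sub_rev] at this
          exact mul_le_mul_of_nonneg_right this.le (norm_nonneg _)
    refine (integral_mono ((hint g hg.continuous).sub (hint _ hpc)).norm
      (hφn.const_mul _) hle).trans ?_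
    rw [integral_const_mul, ← hM, zero_add, div_mul_eq_mul_div, div_le_iff₀ (by positivity)]
    nlinarith
  have := Continuous.ae_eq_iff_eq volume φ.continuous (continuous_const (y := (0 : 𝕜)))
  exact Subtype.ext (this.1 hae)

theorem eq_zero_of_integ_mul {f : SmoothFn ι 𝕜}
    (h : ∀ φ, IsCompactlySupported φ → integ (f * φ) = 0) : f = 0 := by
  have hae : ∀ᵐ ξ, f.1 ξ = 0 := by
    refine ae_eq_zero_of_integral_contDiff_smul_eq_zero f.continuous.locallyIntegrable ?_
    intro g hg hg'
    let φ : SmoothFn ι 𝕜 :=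
      .of (fun ξ => ((g ξ : ℝ) : 𝕜)) ((RCLike.ofRealCLM (K := 𝕜)).contDiff.comp hg)
    rw [← h φ (hg'.comp_left (g := fun x : ℝ => (x : 𝕜)) (by simp))]
    refine integral_congr_ae (Filter.Eventually.of_forall fun ξ => ?_)
    change _ = f.1 ξ * ((g ξ : ℝ) : 𝕜)
    rw [mul_comm]
    exact RCLike.real_smul_eq_coe_mul _ _
  have := Continuous.ae_eq_iff_eq volume f.continuous (continuous_const (y := (0 : 𝕜)))
  exact Subtype.ext (this.1 hae)

/-! ### Transfer of operator identities from polynomials to smooth functions -/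

section WeylAlgebra

variable (ι 𝕜) in
/-- Pairs of an operator on polynomials and an operator on smooth functions. -/
abbrev OpPair := Module.End ℝ (MvPolynomial ι ℝ) × Module.End ℝ (SmoothFn ι 𝕜)

/-- Multiplication by a coordinate on polynomials and smooth functions. -/
def pairX (i : ι) : OpPair ι 𝕜 := (mulX i, coordMul i)

/-- A partial derivative on polynomials and smooth functions. -/
def pairD (i : ι) : OpPair ι 𝕜 := (pderivEnd i, partialDeriv i)

variable (ι 𝕜) in
/-- Differential operators with polynomial coefficients, acting on polynomials and on smooth
functions. -/
def weylAlgebra : Subalgebra ℝ (OpPair ι 𝕜) :=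
  Algebra.adjoin ℝ (Set.range pairX ∪ Set.range pairD)

theorem pairX_mem (i : ι) : pairX i ∈ weylAlgebra ι 𝕜 := Algebra.subset_adjoin (Or.inl ⟨i, rfl⟩)

theorem pairD_mem (i : ι) : pairD i ∈ weylAlgebra ι 𝕜 := Algebra.subset_adjoin (Or.inr ⟨i, rfl⟩)

/-- Each property holds for the generators and passes to sums and products. The formal adjoint of
`∂_i` is `-∂_i`, and adjoints reverse products. -/
theorem weylAlgebra_properties {w : OpPair ι 𝕜} (hw : w ∈ weylAlgebra ι 𝕜) :
    (∀ p, w.2 (polyIncl p) = polyIncl (w.1 p)) ∧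
    (∀ φ, IsCompactlySupported φ → IsCompactlySupported (w.2 φ)) ∧
    ∃ w' : Module.End ℝ (SmoothFn ι 𝕜),
      (∀ φ, IsCompactlySupported φ → IsCompactlySupported (w' φ)) ∧
      ∀ f φ, IsCompactlySupported φ → integ (w.2 f * φ) = integ (f * w' φ) := by
  induction hw using Algebra.adjoin_induction with
  | mem w hw =>
    rcases hw with ⟨i, rfl⟩ | ⟨i, rfl⟩
    · refine ⟨fun p => ?_, fun φ h => h.mul_left _, coordMul i, fun φ h => h.mul_left _,
        fun f φ h => ?_⟩
      · change polyIncl _ * polyIncl p = polyIncl (_ * p)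
        rw [map_mul]
      · change integ (polyIncl _ * f * φ) = integ (f * (polyIncl _ * φ))
        rw [mul_assoc, mul_left_comm]
    · refine ⟨partialDeriv_polyIncl i, fun φ h => h.partialDeriv i, - partialDeriv i,
        fun φ h => ?_, fun f φ h => ?_⟩
      · rw [LinearMap.neg_apply, ← neg_one_smul ℝ]
        exact (h.partialDeriv i).smul _
      · change integ (partialDeriv i f * φ) = _
        rw [integ_mul_partialDeriv i h, LinearMap.neg_apply, mul_neg, ← neg_one_smul ℝ,
          ← neg_one_smul ℝ (f * _), integ_smul]
  | algebraMap c =>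
    refine ⟨fun p => ?_, fun φ h => ?_, algebraMap ℝ _ c, fun φ h => ?_, fun f φ h => ?_⟩
    · change c • polyIncl p = polyIncl (c • p)
      rw [map_smul]
    · exact h.smul c
    · exact h.smul c
    · change integ (c • f * φ) = integ (f * c • φ)
      rw [smul_mul_assoc, mul_smul_comm]
  | add w v _ _ hw hv =>
    obtain ⟨a, b, w', c, d⟩ := hw
    obtain ⟨a', b', v', c', d'⟩ := hv
    refine ⟨fun p => ?_, fun φ h => (b φ h).add (b' φ h), w' + v', fun φ h => (c φ h).add (c' φ h),
      fun f φ h => ?_⟩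
    · change w.2 _ + v.2 _ = polyIncl (w.1 p + v.1 p)
      rw [map_add, a, a']
    · change integ ((w.2 f + v.2 f) * φ) = integ (f * (w' φ + v' φ))
      rw [add_mul, mul_add, integ_add (h.mul_left _) (h.mul_left _),
        integ_add ((c φ h).mul_left _) ((c' φ h).mul_left _), d f φ h, d' f φ h]
  | mul w v _ _ hw hv =>
    obtain ⟨a, b, w', c, d⟩ := hw
    obtain ⟨a', b', v', c', d'⟩ := hv
    refine ⟨fun p => ?_, fun φ h => b _ (b' φ h), v' * w', fun φ h => c' _ (c φ h),
      fun f φ h => ?_⟩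
    · change w.2 (v.2 _) = polyIncl (w.1 (v.1 p))
      rw [a', a]
    · change integ (w.2 (v.2 f) * φ) = integ (f * v' (w' φ))
      rw [d _ _ h, d' _ _ (c φ h)]

/-- Moving `w` to its adjoint, `w' φ` pairs with every polynomial `p` as `φ` pairs with `w p = 0`,
so `w' φ = 0`. Hence `w f` pairs to zero with every test function. -/
theorem weylAlgebra_snd_eq_zero {w : OpPair ι 𝕜} (hw : w ∈ weylAlgebra ι 𝕜) (h : w.1 = 0) :
    w.2 = 0 := by
  obtain ⟨a, -, w', c, d⟩ := weylAlgebra_properties hw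
  refine LinearMap.ext fun f => eq_zero_of_integ_mul fun φ hφ => ?_
  rw [d f φ hφ, eq_zero_of_integ_polyIncl_mul (c φ hφ), mul_zero, integ_zero]
  intro p
  rw [← d _ _ hφ, a, h, LinearMap.zero_apply, map_zero, zero_mul, integ_zero]

theorem weylAlgebra_snd_eq {w v : OpPair ι 𝕜} (hw : w ∈ weylAlgebra ι 𝕜)
    (hv : v ∈ weylAlgebra ι 𝕜) (h : w.1 = v.1) : w.2 = v.2 :=
  sub_eq_zero.1 (weylAlgebra_snd_eq_zero (Subalgebra.sub_mem _ hw hv) (sub_eq_zero.2 h))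

end WeylAlgebra

end SmoothFunctions

end

end BCH

namespace BCH

noncomputable section

open Finset.HasAntidiagonal (antidiagonal)

/-! ### Star multiplication by polynomials on smooth functions -/

section SeriesInSubalgebra

variable {A : Type*} [Ring A] [Algebra ℝ A]

theorem coeff_mul_mem (W : Subalgebra ℝ A) {P Q : PowerSeries A}
    (hP : ∀ r, PowerSeries.coeff r P ∈ W) (hQ : ∀ r, PowerSeries.coeff r Q ∈ W) (r : ℕ) :
    PowerSeries.coeff r (P * Q) ∈ W := by
  rw [PowerSeries.coeff_mul]
  exact Subalgebra.sum_mem _ fun _ _ => Subalgebra.mul_mem _ (hP _) (hQ _)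

theorem coeff_pow_mem (W : Subalgebra ℝ A) {P : PowerSeries A}
    (hP : ∀ r, PowerSeries.coeff r P ∈ W) (d r : ℕ) : PowerSeries.coeff r (P ^ d) ∈ W := by
  induction d generalizing r with
  | zero =>
    rw [pow_zero, PowerSeries.coeff_one]
    split_ifs
    · exact Subalgebra.one_mem _
    · exact Subalgebra.zero_mem _
  | succ d ih =>
    rw [pow_succ]
    exact coeff_mul_mem W ih hP r

variable {L : Type*} [LieRing L] [LieAlgebra ℝ L] {ι : Type*} [Fintype ι]
  (e : Module.Basis ι ℝ L)

theorem coeff_leftSeries_mem (W : Subalgebra ℝ A) {X D : ι → A} (hX : ∀ i, X i ∈ W)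
    (hD : ∀ i, D i ∈ W) (x : L) (r : ℕ) : PowerSeries.coeff r (leftSeries e X D x) ∈ W := by
  rw [leftSeries, PowerSeries.coeff_mk]
  exact Subalgebra.smul_mem _ (orderOp_mem e W hX hD r x) _

theorem coeff_rightSeries_mem (W : Subalgebra ℝ A) {X D : ι → A} (hX : ∀ i, X i ∈ W)
    (hD : ∀ i, D i ∈ W) (x : L) (r : ℕ) : PowerSeries.coeff r (rightSeries e X D x) ∈ W := by
  rw [rightSeries, map_add]
  refine Subalgebra.add_mem _ (coeff_leftSeries_mem e W hX hD x r) (coeff_mul_mem W ?_ ?_ r)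
  · intro r
    rw [PowerSeries.coeff_X]
    split_ifs
    · exact Subalgebra.one_mem _
    · exact Subalgebra.zero_mem _
  · intro r
    rw [PowerSeries.coeff_C]
    split_ifs
    · exact orderOp_mem e W hX hD 1 x
    · exact Subalgebra.zero_mem _

theorem map_leftSeries {B : Type*} [Ring B] [Algebra ℝ B] (F : A →ₐ[ℝ] B) (X D : ι → A) (x : L) :
    PowerSeries.map (F : A →+* B) (leftSeries e X D x) =
      leftSeries e (fun i => F (X i)) (fun i => F (D i)) x := by
  ext r
  rw [PowerSeries.coeff_map, leftSeries, leftSeries, PowerSeries.coeff_mk, PowerSeries.coeff_mk,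
    RingHom.coe_coe, map_smul, map_orderOp]

theorem map_rightSeries {B : Type*} [Ring B] [Algebra ℝ B] (F : A →ₐ[ℝ] B) (X D : ι → A) (x : L) :
    PowerSeries.map (F : A →+* B) (rightSeries e X D x) =
      rightSeries e (fun i => F (X i)) (fun i => F (D i)) x := by
  rw [rightSeries, rightSeries, map_add, map_mul, map_leftSeries, PowerSeries.map_X,
    PowerSeries.map_C, RingHom.coe_coe, map_orderOp]

end SeriesInSubalgebra

section SmoothCochain

variable {ι : Type*} [Fintype ι] {𝕜 : Type*} [RCLike 𝕜]

theorem prodOp_mem {A : Type*} [Ring A] [Algebra ℝ A] (W : Subalgebra ℝ A) {D : ι → A}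
    (hD : ∀ i, D i ∈ W) {k : ℕ} (i : Fin k → ι) : prodOp D i ∈ W := by
  induction k with
  | zero => rw [prodOp_zero]; exact Subalgebra.one_mem _
  | succ k ih => rw [prodOp_succ]; exact Subalgebra.mul_mem _ (hD _) (ih _)

theorem prodOp_pairD {k : ℕ} (i : Fin k → ι) :
    (prodOp pairD i : OpPair ι 𝕜) = (prodOp pderivEnd i, prodOp partialDeriv i) := by
  induction k with
  | zero => rw [prodOp_zero, prodOp_zero, prodOp_zero]; rfl
  | succ k ih => rw [prodOp_succ, prodOp_succ, prodOp_succ, ih]; rfl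

theorem prodOp_pair_mem {k : ℕ} (i : Fin k → ι) :
    ((prodOp pderivEnd i, prodOp partialDeriv i) : OpPair ι 𝕜) ∈ weylAlgebra ι 𝕜 := by
  rw [← prodOp_pairD]
  exact prodOp_mem _ pairD_mem i

theorem prodOp_partialDeriv_polyIncl {k : ℕ} (i : Fin k → ι) (p : MvPolynomial ι ℝ) :
    prodOp partialDeriv i (polyIncl p : SmoothFn ι 𝕜) = polyIncl (prodOp pderivEnd i p) :=
  (weylAlgebra_properties (prodOp_pair_mem i)).1 p

theorem IsCompactlySupported.prodOp {f : SmoothFn ι 𝕜} (h : IsCompactlySupported f) {k : ℕ}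
    (i : Fin k → ι) : IsCompactlySupported (prodOp BCH.partialDeriv i f) :=
  (weylAlgebra_properties (prodOp_pair_mem i)).2.1 f h

theorem mulLeft_mem (p : MvPolynomial ι ℝ) :
    ((LinearMap.mulLeft ℝ p, LinearMap.mulLeft ℝ (polyIncl p)) : OpPair ι 𝕜) ∈
      weylAlgebra ι 𝕜 := by
  induction p using MvPolynomial.induction_on with
  | C a =>
    convert Subalgebra.algebraMap_mem (weylAlgebra ι 𝕜) a using 1
    refine Prod.ext (LinearMap.ext fun p => ?_) (LinearMap.ext fun f => ?_)
    · exact (MvPolynomial.smul_eq_C_mul p a).symm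
    · change polyIncl (algebraMap ℝ _ a) * f = a • f
      rw [AlgHom.commutes, Algebra.smul_def]
  | add p q hp hq =>
    convert Subalgebra.add_mem _ hp hq using 1
    refine Prod.ext (LinearMap.ext fun f => ?_) (LinearMap.ext fun f => ?_)
    · exact add_mul p q f
    · change polyIncl (p + q) * f = polyIncl p * f + polyIncl q * f
      rw [map_add, add_mul]
  | mul_X p i hp =>
    convert Subalgebra.mul_mem _ hp (pairX_mem i) using 1
    refine Prod.ext (LinearMap.ext fun f => ?_) (LinearMap.ext fun f => ?_)
    · exact mul_assoc p _ f
    · change polyIncl (p * _) * f = polyIncl p * (polyIncl _ * f)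
      rw [map_mul, mul_assoc]

variable {L : Type*} [LieRing L] [LieAlgebra ℝ L] (e : Module.Basis ι ℝ L)

/-- The coefficient of `∂_i f · ∂_j g` in the `r`-th bidifferential operator of the star product,
as a polynomial. -/
def cochainCoeff (r : ℕ) {k l : ℕ} (i : Fin k → ι) (j : Fin l → ι) : MvPolynomial ι ℝ :=
  ((k.factorial : ℝ)⁻¹ * (l.factorial : ℝ)⁻¹) • (exists_symbol_eq_eval e r i j).choose

theorem eval_cochainCoeff (r : ℕ) {k l : ℕ} (i : Fin k → ι) (j : Fin l → ι) (ξ : ι → ℝ) :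
    MvPolynomial.eval ξ (cochainCoeff e r i j) =
      (k.factorial : ℝ)⁻¹ * (l.factorial : ℝ)⁻¹ * symbol e r i j ξ := by
  rw [cochainCoeff, MvPolynomial.smul_eval, ← (exists_symbol_eq_eval e r i j).choose_spec ξ]

/-- The `r`-th bidifferential operator of the star product on smooth functions in coordinates. -/
def smoothCochain (r : ℕ) : SmoothFn ι 𝕜 →ₗ[ℝ] SmoothFn ι 𝕜 →ₗ[ℝ] SmoothFn ι 𝕜 :=
  ∑ k ∈ Finset.range (r + 1), ∑ l ∈ Finset.range (r + 1), ∑ i : Fin k → ι, ∑ j : Fin l → ι,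
    (LinearMap.mul ℝ (SmoothFn ι 𝕜)).compl₁₂
      (LinearMap.mulLeft ℝ (polyIncl (cochainCoeff e r i j)) * prodOp partialDeriv i)
      (prodOp partialDeriv j)

theorem smoothCochain_apply (r : ℕ) (f g : SmoothFn ι 𝕜) :
    smoothCochain e r f g =
      ∑ k ∈ Finset.range (r + 1), ∑ l ∈ Finset.range (r + 1), ∑ i : Fin k → ι, ∑ j : Fin l → ι,
        polyIncl (cochainCoeff e r i j) * prodOp partialDeriv i f * prodOp partialDeriv j g := by
  simp [smoothCochain, LinearMap.sum_apply]

theorem polyCochain_eq_sum (r : ℕ) (p q : MvPolynomial ι ℝ) :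
    polyCochain e r p q =
      ∑ k ∈ Finset.range (r + 1), ∑ l ∈ Finset.range (r + 1), ∑ i : Fin k → ι, ∑ j : Fin l → ι,
        cochainCoeff e r i j * prodOp pderivEnd i p * prodOp pderivEnd j q := by
  refine MvPolynomial.funext fun ξ => ?_
  rw [eval_polyCochain]
  simp only [map_sum, map_mul, eval_cochainCoeff, mul_assoc]

theorem IsCompactlySupported.smoothCochain_left {f : SmoothFn ι 𝕜} (h : IsCompactlySupported f)
    (r : ℕ) (g : SmoothFn ι 𝕜) : IsCompactlySupported (smoothCochain e r f g) := by
  rw [smoothCochain_apply]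
  exact .sum fun _ _ => .sum fun _ _ => .sum fun i _ => .sum fun _ _ =>
    ((h.prodOp i).mul_left _).mul_right _

theorem IsCompactlySupported.smoothCochain_right {g : SmoothFn ι 𝕜} (h : IsCompactlySupported g)
    (r : ℕ) (f : SmoothFn ι 𝕜) : IsCompactlySupported (smoothCochain e r f g) := by
  rw [smoothCochain_apply]
  exact .sum fun _ _ => .sum fun _ _ => .sum fun _ _ => .sum fun j _ => (h.prodOp j).mul_left _

theorem mk_sum_mem {α : Type*} {s : Finset α} {F : α → Module.End ℝ (MvPolynomial ι ℝ)}
    {F' : α → Module.End ℝ (SmoothFn ι 𝕜)}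
    (h : ∀ a ∈ s, ((F a, F' a) : OpPair ι 𝕜) ∈ weylAlgebra ι 𝕜) :
    ((∑ a ∈ s, F a, ∑ a ∈ s, F' a) : OpPair ι 𝕜) ∈ weylAlgebra ι 𝕜 := by
  have h1 : ((∑ a ∈ s, F a, ∑ a ∈ s, F' a) : OpPair ι 𝕜) = ∑ a ∈ s, (F a, F' a) :=
    Prod.ext (Prod.fst_sum (s := s) (f := fun a => ((F a, F' a) : OpPair ι 𝕜))).symm
      (Prod.snd_sum (s := s) (f := fun a => ((F a, F' a) : OpPair ι 𝕜))).symm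
  rw [h1]
  exact Subalgebra.sum_mem _ h

theorem mk_mul_mem {a b : Module.End ℝ (MvPolynomial ι ℝ)} {a' b' : Module.End ℝ (SmoothFn ι 𝕜)}
    (h : ((a, a') : OpPair ι 𝕜) ∈ weylAlgebra ι 𝕜) (h' : ((b, b') : OpPair ι 𝕜) ∈ weylAlgebra ι 𝕜) :
    ((a * b, a' * b') : OpPair ι 𝕜) ∈ weylAlgebra ι 𝕜 :=
  Subalgebra.mul_mem _ h h'

/-- With one argument a fixed polynomial, `C_r` is a differential operator with polynomial
coefficients, given by the same formula on polynomials and on smooth functions. -/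
theorem polyCochain_left_mem (r : ℕ) (p : MvPolynomial ι ℝ) :
    ((polyCochain e r p, smoothCochain e r (polyIncl p)) : OpPair ι 𝕜) ∈ weylAlgebra ι 𝕜 := by
  have h1 : polyCochain e r p =
      ∑ k ∈ Finset.range (r + 1), ∑ l ∈ Finset.range (r + 1), ∑ i : Fin k → ι, ∑ j : Fin l → ι,
        LinearMap.mulLeft ℝ (cochainCoeff e r i j * prodOp pderivEnd i p) * prodOp pderivEnd j :=
    LinearMap.ext fun q => by
      simp only [polyCochain_eq_sum, LinearMap.sum_apply]
      rfl
  have h2 : smoothCochain e r (polyIncl p : SmoothFn ι 𝕜) =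
      ∑ k ∈ Finset.range (r + 1), ∑ l ∈ Finset.range (r + 1), ∑ i : Fin k → ι, ∑ j : Fin l → ι,
        LinearMap.mulLeft ℝ (polyIncl (cochainCoeff e r i j * prodOp pderivEnd i p)) *
          prodOp partialDeriv j :=
    LinearMap.ext fun q => by
      simp only [smoothCochain_apply, LinearMap.sum_apply, prodOp_partialDeriv_polyIncl]
      exact Finset.sum_congr rfl fun k _ => Finset.sum_congr rfl fun l _ =>
        Finset.sum_congr rfl fun i _ => Finset.sum_congr rfl fun j _ => by
          rw [map_mul]; rfl
  rw [h1, h2]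
  refine mk_sum_mem fun k _ => mk_sum_mem fun l _ => mk_sum_mem fun i _ =>
    mk_sum_mem fun j _ => ?_
  exact mk_mul_mem (mulLeft_mem _) (prodOp_pair_mem j)

theorem polyCochain_right_mem (r : ℕ) (q : MvPolynomial ι ℝ) :
    (((polyCochain e r).flip q, (smoothCochain e r).flip (polyIncl q)) : OpPair ι 𝕜) ∈
      weylAlgebra ι 𝕜 := by
  have h1 : (polyCochain e r).flip q =
      ∑ k ∈ Finset.range (r + 1), ∑ l ∈ Finset.range (r + 1), ∑ i : Fin k → ι, ∑ j : Fin l → ι,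
        LinearMap.mulLeft ℝ (cochainCoeff e r i j * prodOp pderivEnd j q) * prodOp pderivEnd i :=
    LinearMap.ext fun p => by
      simp only [LinearMap.flip_apply, polyCochain_eq_sum, LinearMap.sum_apply]
      exact Finset.sum_congr rfl fun k _ => Finset.sum_congr rfl fun l _ =>
        Finset.sum_congr rfl fun i _ => Finset.sum_congr rfl fun j _ =>
          mul_right_comm _ _ _
  have h2 : (smoothCochain e r).flip (polyIncl q : SmoothFn ι 𝕜) =
      ∑ k ∈ Finset.range (r + 1), ∑ l ∈ Finset.range (r + 1), ∑ i : Fin k → ι, ∑ j : Fin l → ι,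
        LinearMap.mulLeft ℝ (polyIncl (cochainCoeff e r i j * prodOp pderivEnd j q)) *
          prodOp partialDeriv i :=
    LinearMap.ext fun p => by
      simp only [LinearMap.flip_apply, smoothCochain_apply, LinearMap.sum_apply,
        prodOp_partialDeriv_polyIncl]
      exact Finset.sum_congr rfl fun k _ => Finset.sum_congr rfl fun l _ =>
        Finset.sum_congr rfl fun i _ => Finset.sum_congr rfl fun j _ => by
          rw [map_mul, mul_right_comm]; rfl
  rw [h1, h2]
  refine mk_sum_mem fun k _ => mk_sum_mem fun l _ => mk_sum_mem fun i _ =>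
    mk_sum_mem fun j _ => ?_
  exact mk_mul_mem (mulLeft_mem _) (prodOp_pair_mem i)

variable (ι 𝕜) in
/-- The component on polynomials. -/
def polyPart : OpPair ι 𝕜 →ₐ[ℝ] Module.End ℝ (MvPolynomial ι ℝ) := AlgHom.fst ℝ _ _

/-- The series of left star multiplication on polynomials and smooth functions. -/
abbrev pairLeft (z : L) : PowerSeries (OpPair ι 𝕜) := leftSeries e pairX pairD z

/-- The series of right star multiplication on polynomials and smooth functions. -/
abbrev pairRight (z : L) : PowerSeries (OpPair ι 𝕜) := rightSeries e pairX pairD z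

theorem map_fst_pairLeft (z : L) :
    PowerSeries.map (polyPart ι 𝕜 : OpPair ι 𝕜 →+* Module.End ℝ (MvPolynomial ι ℝ)) (pairLeft e z) =
      leftSeries e mulX pderivEnd z :=
  map_leftSeries e (polyPart ι 𝕜) pairX pairD z

theorem map_fst_pairRight (z : L) :
    PowerSeries.map (polyPart ι 𝕜 : OpPair ι 𝕜 →+* Module.End ℝ (MvPolynomial ι ℝ))
      (pairRight e z) =
      rightSeries e mulX pderivEnd z :=
  map_rightSeries e (polyPart ι 𝕜) pairX pairD z

theorem coeff_pairLeft_mem (z : L) (r : ℕ) :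
    PowerSeries.coeff r (pairLeft e z) ∈ weylAlgebra ι 𝕜 :=
  coeff_leftSeries_mem e _ pairX_mem pairD_mem z r

theorem coeff_pairRight_mem (z : L) (r : ℕ) :
    PowerSeries.coeff r (pairRight e z) ∈ weylAlgebra ι 𝕜 :=
  coeff_rightSeries_mem e _ pairX_mem pairD_mem z r

/-- Both sides lie in the Weyl algebra and agree on polynomials, so they agree on smooth functions.
-/
theorem smoothCochain_pow_left (z : L) (d r : ℕ) (f : SmoothFn ι 𝕜) :
    smoothCochain e r (polyIncl (linForm e z ^ d)) f =
      (PowerSeries.coeff r (pairLeft e z ^ d)).2 f := by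
  refine LinearMap.congr_fun (weylAlgebra_snd_eq (polyCochain_left_mem e r (linForm e z ^ d))
    (coeff_pow_mem _ (coeff_pairLeft_mem e z) d r) ?_) f
  refine LinearMap.ext fun q => ?_
  change polyCochain e r (linForm e z ^ d) q = (polyPart ι 𝕜 : OpPair ι 𝕜 →+* Module.End ℝ
      (MvPolynomial ι ℝ)) _ q
  rw [← PowerSeries.coeff_map, RingHom.map_pow, map_fst_pairLeft]
  exact coeff_polyStar_pow_left e z d q r

theorem smoothCochain_pow_right (z : L) (d r : ℕ) (f : SmoothFn ι 𝕜) :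
    smoothCochain e r f (polyIncl (linForm e z ^ d)) =
      (PowerSeries.coeff r (pairRight e z ^ d)).2 f := by
  refine LinearMap.congr_fun (weylAlgebra_snd_eq (polyCochain_right_mem e r (linForm e z ^ d))
    (coeff_pow_mem _ (coeff_pairRight_mem e z) d r) ?_) f
  refine LinearMap.ext fun q => ?_
  change polyCochain e r q (linForm e z ^ d) = (polyPart ι 𝕜 : OpPair ι 𝕜 →+* Module.End ℝ
      (MvPolynomial ι ℝ)) _ q
  rw [← PowerSeries.coeff_map, RingHom.map_pow, map_fst_pairRight]
  exact coeff_polyStar_pow_right e z d q r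

theorem commute_pairLeft_pairRight (z : L) :
    Commute (pairRight e z : PowerSeries (OpPair ι 𝕜)) (pairLeft e z) := by
  have h1 : PowerSeries.map (polyPart ι 𝕜 : OpPair ι 𝕜 →+* _)
      (pairRight e z * pairLeft e z) =
      PowerSeries.map (polyPart ι 𝕜 : OpPair ι 𝕜 →+* Module.End ℝ (MvPolynomial ι ℝ))
        (pairLeft e z * pairRight e z) := by
    rw [map_mul, map_mul, map_fst_pairLeft, map_fst_pairRight, leftSeries_mul_rightSeries]
  refine PowerSeries.ext fun r => ?_
  have h2 : (PowerSeries.coeff r (pairRight e z * pairLeft e z : PowerSeries (OpPair ι 𝕜))).1 =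
      (PowerSeries.coeff r (pairLeft e z * pairRight e z : PowerSeries (OpPair ι 𝕜))).1 := by
    have := congrArg (PowerSeries.coeff r) h1
    rwa [PowerSeries.coeff_map, PowerSeries.coeff_map] at this
  exact Prod.ext h2 (weylAlgebra_snd_eq
    (coeff_mul_mem _ (coeff_pairRight_mem e z) (coeff_pairLeft_mem e z) r)
    (coeff_mul_mem _ (coeff_pairLeft_mem e z) (coeff_pairRight_mem e z) r) h2)

end SmoothCochain

/-! ### Vanishing of the integrated star commutator -/

section StronglyClosed

variable {ι : Type*} [Fintype ι] {𝕜 : Type*} [RCLike 𝕜]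
  {L : Type*} [LieRing L] [LieAlgebra ℝ L] (e : Module.Basis ι ℝ L)

theorem integ_coordMul_partialDeriv [DecidableEq ι] (i j : ι) {φ : SmoothFn ι 𝕜}
    (h : IsCompactlySupported φ) :
    integ (coordMul j (partialDeriv i φ)) = if i = j then - integ φ else 0 := by
  have h1 := integ_mul_partialDeriv i (f := polyIncl (MvPolynomial.X j)) h
  rw [partialDeriv_polyIncl, MvPolynomial.pderiv_X] at h1
  have h2 : integ (coordMul j (partialDeriv i φ)) =
      - integ (polyIncl ((Pi.single i 1 : ι → MvPolynomial ι ℝ) j) * φ) := by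
    rw [h1, neg_neg]; rfl
  rw [h2]
  split_ifs with hij
  · subst hij; simp
  · rw [Pi.single_eq_of_ne (Ne.symm hij), map_zero, zero_mul, integ_zero, neg_zero]

/-- In a unimodular Lie algebra the coadjoint vector fields are divergence free. -/
theorem integ_orderOp_one {x : L} (hx : ∑ i, e.repr ⁅e i, x⁆ i = 0) {φ : SmoothFn ι 𝕜}
    (h : IsCompactlySupported φ) : integ (orderOp e coordMul partialDeriv 1 x φ) = 0 := by
  classical
  have h1 : orderOp e coordMul partialDeriv 1 x φ =
      ∑ i, ∑ j, e.repr ⁅e i, x⁆ j • coordMul j (partialDeriv i φ) := by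
    simp [orderOp_succ, orderOp_zero, LinearMap.sum_apply]
  have hc : ∀ i j, IsCompactlySupported (e.repr ⁅e i, x⁆ j • coordMul j (partialDeriv i φ)) :=
    fun i j => ((h.partialDeriv i).mul_left _).smul _
  rw [h1, integ_sum fun i _ => IsCompactlySupported.sum fun j _ => hc i j]
  simp_rw [integ_sum fun j _ => hc _ j, integ_smul, integ_coordMul_partialDeriv _ _ h]
  simp [← Finset.sum_smul, hx]

/-- The factorization `R ^ d - L ^ d = (R - L) ∑ R ^ i L ^ (d - 1 - i)` for commuting `R` and `L`
puts the divergence-free field `R - L` leftmost. It then acts on a compactly supported function, and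
its integral vanishes. -/
theorem integ_smoothCochain_pow {z : L} (hz : ∑ i, e.repr ⁅e i, z⁆ i = 0) (r d : ℕ)
    {φ : SmoothFn ι 𝕜} (h : IsCompactlySupported φ) :
    integ (smoothCochain e r φ (polyIncl (linForm e z ^ d)) -
      smoothCochain e r (polyIncl (linForm e z ^ d)) φ) = 0 := by
  rw [smoothCochain_pow_left, smoothCochain_pow_right, ← LinearMap.sub_apply, ← Prod.snd_sub,
    ← map_sub, ← (commute_pairLeft_pairRight e z).mul_geom_sum₂ d]
  set S : PowerSeries (OpPair ι 𝕜) :=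
    ∑ i ∈ Finset.range d, pairRight e z ^ i * pairLeft e z ^ (d - 1 - i) with hS
  have hSm : ∀ r, PowerSeries.coeff r S ∈ weylAlgebra ι 𝕜 := fun r => by
    rw [hS, map_sum]
    exact Subalgebra.sum_mem _ fun i _ => coeff_mul_mem _
      (coeff_pow_mem _ (coeff_pairRight_mem e z) i)
      (coeff_pow_mem _ (coeff_pairLeft_mem e z) _) r
  have hd : pairRight e z - pairLeft e z =
      PowerSeries.X * PowerSeries.C (orderOp e pairX pairD 1 z : OpPair ι 𝕜) := by
    rw [pairRight, rightSeries, add_sub_cancel_left]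
  rw [hd, mul_assoc]
  -- `R - L` is divisible by `ν`: order zero is trivial, and order `r + 1` sees the coefficient `r`
  -- of the geometric sum.
  cases r with
  | zero => rw [PowerSeries.coeff_zero_X_mul]; exact integ_zero
  | succ r =>
    rw [PowerSeries.coeff_succ_X_mul, PowerSeries.coeff_C_mul]
    change integ ((orderOp e pairX pairD 1 z : OpPair ι 𝕜).2 _) = 0
    have : (orderOp e pairX pairD 1 z : OpPair ι 𝕜).2 = orderOp e coordMul partialDeriv 1 z :=
      map_orderOp e (AlgHom.snd ℝ _ _) pairX pairD 1 z
    rw [this]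
    exact integ_orderOp_one e hz ((weylAlgebra_properties (hSm r)).2.1 φ h)

theorem integ_smoothCochain_polyIncl (hu : ∀ x, ∑ i, e.repr ⁅e i, x⁆ i = 0) (r : ℕ)
    {φ : SmoothFn ι 𝕜} (h : IsCompactlySupported φ) (p : MvPolynomial ι ℝ) :
    integ (smoothCochain e r φ (polyIncl p) - smoothCochain e r (polyIncl p) φ) = 0 := by
  have hp : p ∈ Submodule.span ℝ {a | ∃ z k, linForm e z ^ k = a} := by
    rw [span_linForm_pow]; trivial
  have hc : ∀ p, IsCompactlySupported
      (smoothCochain e r φ (polyIncl p) - smoothCochain e r (polyIncl p) φ) := fun p => by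
    rw [sub_eq_add_neg, ← neg_one_smul ℝ]
    exact (h.smoothCochain_left e r _).add ((h.smoothCochain_right e r _).smul _)
  induction hp using Submodule.span_induction with
  | mem p hp =>
    obtain ⟨z, d, rfl⟩ := hp
    exact integ_smoothCochain_pow e (hu z) r d h
  | zero => simp [integ_zero]
  | add p q _ _ hp hq =>
    rw [map_add, map_add, map_add, LinearMap.add_apply, add_sub_add_comm, integ_add (hc p) (hc q),
      hp, hq, add_zero]
  | smul c p _ hp =>
    rw [map_smul, map_smul, map_smul, LinearMap.smul_apply, ← smul_sub, integ_smul, hp, smul_zero]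

/-- A functional on smooth functions given by integration against a test function. -/
def IsRepresentable (F : SmoothFn ι 𝕜 → 𝕜) : Prop :=
  ∃ ψ, IsCompactlySupported ψ ∧ ∀ h, F h = integ (h * ψ)

theorem IsRepresentable.sum {α : Type*} {s : Finset α} {F : α → SmoothFn ι 𝕜 → 𝕜}
    (hF : ∀ a ∈ s, IsRepresentable (F a)) : IsRepresentable fun h => ∑ a ∈ s, F a h := by
  classical
  induction s using Finset.induction_on with
  | empty => exact ⟨0, .zero, fun h => by simp [integ_zero]⟩
  | insert a s ha ih =>
    obtain ⟨ψ, hψ, h1⟩ := ih fun b hb => hF b (Finset.mem_insert_of_mem hb)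
    obtain ⟨ψ', hψ', h2⟩ := hF a (Finset.mem_insert_self a s)
    refine ⟨ψ' + ψ, hψ'.add hψ, fun h => ?_⟩
    change ∑ a ∈ insert a s, F a h = _
    rw [Finset.sum_insert ha, show ∑ a ∈ s, F a h = _ from h1 h, h2, mul_add,
        integ_add (hψ'.mul_left _) (hψ.mul_left _)]

theorem isRepresentable_prodOp {φ : SmoothFn ι 𝕜} (h : IsCompactlySupported φ) {k : ℕ}
    (i : Fin k → ι) : IsRepresentable fun g => integ (prodOp partialDeriv i g * φ) := by
  obtain ⟨-, -, w', h1, h2⟩ := weylAlgebra_properties (prodOp_pair_mem (𝕜 := 𝕜) i)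
  exact ⟨w' φ, h1 φ h, fun g => h2 g φ h⟩

/-- Integration by parts moves all derivatives off `g`; what remains has compact support because
every term contains a derivative of `φ`. -/
theorem isRepresentable_smoothCochain_left {φ : SmoothFn ι 𝕜} (h : IsCompactlySupported φ)
    (r : ℕ) : IsRepresentable fun g => integ (smoothCochain e r φ g) := by
  have hc : ∀ (g : SmoothFn ι 𝕜) {k l : ℕ} (i : Fin k → ι) (j : Fin l → ι), IsCompactlySupported
      (polyIncl (cochainCoeff e r i j) * prodOp partialDeriv i φ * prodOp partialDeriv j g) :=
    fun g _ _ i j => ((h.prodOp i).mul_left _).mul_right _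
  have := IsRepresentable.sum (𝕜 := 𝕜) (s := Finset.range (r + 1)) fun k _ =>
    IsRepresentable.sum (s := Finset.range (r + 1)) fun l _ =>
      IsRepresentable.sum (s := Finset.univ) fun (i : Fin k → ι) _ =>
        IsRepresentable.sum (s := Finset.univ) fun (j : Fin l → ι) _ =>
          isRepresentable_prodOp ((h.prodOp i).mul_left (polyIncl (cochainCoeff e r i j))) j
  convert this using 2 with g
  rw [smoothCochain_apply, integ_sum fun k _ => .sum fun l _ => .sum fun i _ => .sum fun j _ =>
    hc g i j]
  refine Finset.sum_congr rfl fun k _ => ?_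
  rw [integ_sum fun l _ => .sum fun i _ => .sum fun j _ => hc g i j]
  refine Finset.sum_congr rfl fun l _ => ?_
  rw [integ_sum fun i _ => .sum fun j _ => hc g i j]
  refine Finset.sum_congr rfl fun i _ => ?_
  rw [integ_sum fun j _ => hc g i j]
  refine Finset.sum_congr rfl fun j _ => ?_
  rw [mul_comm]

theorem isRepresentable_smoothCochain_right {φ : SmoothFn ι 𝕜} (h : IsCompactlySupported φ)
    (r : ℕ) : IsRepresentable fun g => integ (smoothCochain e r g φ) := by
  have hc : ∀ (g : SmoothFn ι 𝕜) {k l : ℕ} (i : Fin k → ι) (j : Fin l → ι), IsCompactlySupported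
      (polyIncl (cochainCoeff e r i j) * prodOp partialDeriv i g * prodOp partialDeriv j φ) :=
    fun g _ _ i j => (h.prodOp j).mul_left _
  have := IsRepresentable.sum (𝕜 := 𝕜) (s := Finset.range (r + 1)) fun k _ =>
    IsRepresentable.sum (s := Finset.range (r + 1)) fun l _ =>
      IsRepresentable.sum (s := Finset.univ) fun (i : Fin k → ι) _ =>
        IsRepresentable.sum (s := Finset.univ) fun (j : Fin l → ι) _ =>
          isRepresentable_prodOp ((h.prodOp j).mul_left (polyIncl (cochainCoeff e r i j))) i
  convert this using 2 with g
  rw [smoothCochain_apply, integ_sum fun k _ => .sum fun l _ => .sum fun i _ => .sum fun j _ =>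
    hc g i j]
  refine Finset.sum_congr rfl fun k _ => ?_
  rw [integ_sum fun l _ => .sum fun i _ => .sum fun j _ => hc g i j]
  refine Finset.sum_congr rfl fun l _ => ?_
  rw [integ_sum fun i _ => .sum fun j _ => hc g i j]
  refine Finset.sum_congr rfl fun i _ => ?_
  rw [integ_sum fun j _ => hc g i j]
  refine Finset.sum_congr rfl fun j _ => ?_
  rw [mul_comm (polyIncl _), mul_assoc]

/-- For a unimodular Lie algebra, the star commutator of a test function with a smooth function
integrates to zero. -/
theorem integ_smoothCochain_comm (hu : ∀ x, ∑ i, e.repr ⁅e i, x⁆ i = 0) (r : ℕ)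
    {φ : SmoothFn ι 𝕜} (h : IsCompactlySupported φ) (g : SmoothFn ι 𝕜) :
    integ (smoothCochain e r φ g) = integ (smoothCochain e r g φ) := by
  obtain ⟨ψ, hψ, h1⟩ := isRepresentable_smoothCochain_left e h r
  obtain ⟨ψ', hψ', h2⟩ := isRepresentable_smoothCochain_right e h r
  have key : ∀ f : SmoothFn ι 𝕜, integ (f * (ψ + (-1 : ℝ) • ψ')) =
      integ (smoothCochain e r φ f - smoothCochain e r f φ) := fun f => by
    rw [sub_eq_add_neg, ← neg_one_smul ℝ (smoothCochain e r f φ),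
      integ_add (h.smoothCochain_left e r f) ((h.smoothCochain_right e r f).smul _), integ_smul,
      show integ (smoothCochain e r φ f) = _ from h1 f,
      show integ (smoothCochain e r f φ) = _ from h2 f, mul_add, mul_smul_comm,
        integ_add (hψ.mul_left f) ((hψ'.mul_left f).smul _),
      integ_smul]
  -- The representing function of the commutator functional is orthogonal to all polynomials, so the
  -- functional vanishes on every smooth `g`, with no condition on the support of `g`.
  have h0 : ψ + (-1 : ℝ) • ψ' = 0 :=
    eq_zero_of_integ_polyIncl_mul (hψ.add (hψ'.smul _)) fun p => by
      rw [key, integ_smoothCochain_polyIncl e hu r h]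
  have h3 := key g
  rw [h0, mul_zero, integ_zero, sub_eq_add_neg, ← neg_one_smul ℝ (smoothCochain e r g φ),
      integ_add (h.smoothCochain_left e r g) ((h.smoothCochain_right e r g).smul _), integ_smul,
      neg_one_smul, ← sub_eq_add_neg] at h3
  exact sub_eq_zero.1 h3.symm

end StronglyClosed

/-! ### From the operators to the formal star product -/

section StarProduct

variable {ι : Type*} [Fintype ι] {𝕜 : Type*} [RCLike 𝕜]
  {L : Type*} [LieRing L] [LieAlgebra ℝ L] (e : Module.Basis ι ℝ L)

theorem prodOp_partialDeriv_apply {k : ℕ} (i : Fin k → ι) (f : SmoothFn ι 𝕜) (ξ : ι → ℝ) :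
    (prodOp partialDeriv i f).1 ξ =
      iteratedFDeriv ℝ k f.1 ξ fun a => Pi.basisFun ℝ ι (i a) := by
  induction k generalizing ξ with
  | zero => rw [prodOp_zero, iteratedFDeriv_zero_apply]; rfl
  | succ k ih =>
    rw [prodOp_succ, iteratedFDeriv_succ_apply_left]
    change fderiv ℝ (prodOp partialDeriv (Fin.tail i) f).1 ξ _ = _
    have h1 : (prodOp partialDeriv (Fin.tail i) f).1 = fun ξ =>
        iteratedFDeriv ℝ k f.1 ξ fun a => Pi.basisFun ℝ ι (Fin.tail i a) :=
      funext fun ξ => ih _ ξ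
    have h2 : DifferentiableAt ℝ (iteratedFDeriv ℝ k f.1) ξ :=
      f.contDiff.differentiable_iteratedFDeriv (by exact_mod_cast WithTop.coe_lt_top _) ξ
    rw [h1]
    exact congrArg (· (Pi.basisFun ℝ ι (i 0))) (fderiv_continuousMultilinear_apply_const h2 _)

theorem cochain_apply_dualCoords (r : ℕ) {F F' : Module.Dual ℝ L → 𝕜} {f f' : SmoothFn ι 𝕜}
    (hf : f.1 = F ∘ dualCoords e) (hf' : f'.1 = F' ∘ dualCoords e) (ξ : ι → ℝ) :
    cochain e r F F' (dualCoords e ξ) = (smoothCochain e r f f').1 ξ := by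
  let ev : SmoothFn ι 𝕜 →+* 𝕜 :=
    (Pi.evalRingHom (fun _ : ι → ℝ => 𝕜) ξ).comp (smoothSubalgebra ι 𝕜).val.toRingHom
  change _ = ev _
  rw [smoothCochain_apply, cochain]
  simp only [LinearEquiv.symm_apply_apply, map_sum]
  refine Finset.sum_congr rfl fun k _ => Finset.sum_congr rfl fun l _ =>
    Finset.sum_congr rfl fun i _ => Finset.sum_congr rfl fun j _ => ?_
  change _ = (polyIncl (cochainCoeff e r i j) : SmoothFn ι 𝕜).1 ξ * (prodOp partialDeriv i f).1 ξ *
    (prodOp partialDeriv j f').1 ξ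
  rw [polyIncl_apply, eval_cochainCoeff, prodOp_partialDeriv_apply, prodOp_partialDeriv_apply,
    hf, hf', partialD, partialD, ← mul_assoc]

theorem integrable_cochain (r : ℕ) {F F' : Module.Dual ℝ L → 𝕜} (hF : IsTestFunction e F)
    (hF' : IsTestFunction e F') :
    Integrable fun ξ => cochain e r F F' (dualCoords e ξ) := by
  have h : (fun ξ => cochain e r F F' (dualCoords e ξ)) =
      (smoothCochain e r (.of _ hF.1) (.of _ hF'.1) : SmoothFn ι 𝕜).1 :=
    funext (cochain_apply_dualCoords e r rfl rfl)
  rw [h]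
  exact (IsCompactlySupported.smoothCochain_left e (f := .of _ hF.1) hF.2 r _).integrable

theorem integral_cochain_comm (hu : ∀ x, ∑ i, e.repr ⁅e i, x⁆ i = 0) (r : ℕ)
    {F F' : Module.Dual ℝ L → 𝕜} (hF : IsTestFunction e F) (hF' : IsTestFunction e F') :
    ∫ ξ, cochain e r F F' (dualCoords e ξ) = ∫ ξ, cochain e r F' F (dualCoords e ξ) := by
  have h := integ_smoothCochain_comm e hu r (φ := .of _ hF.1) hF.2 (.of _ hF'.1)
  rw [integ, integ] at h
  rw [integral_congr_ae (Filter.Eventually.of_forall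
      (cochain_apply_dualCoords e r (f := .of _ hF.1) (f' := .of _ hF'.1) rfl rfl)), h]
  exact integral_congr_ae (Filter.Eventually.of_forall fun ξ =>
    (cochain_apply_dualCoords e r (f := .of _ hF'.1) (f' := .of _ hF.1) rfl rfl ξ).symm)

theorem coeff_bchStar_apply (r : ℕ) (f g : PowerSeries (Module.Dual ℝ L → 𝕜)) (ξ : ι → ℝ) :
    PowerSeries.coeff r (bchStar e f g) (dualCoords e ξ) =
      ∑ s ∈ antidiagonal r, ∑ t ∈ antidiagonal s.2,
        cochain e s.1 (PowerSeries.coeff t.1 f) (PowerSeries.coeff t.2 g) (dualCoords e ξ) := by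
  rw [bchStar, PowerSeries.coeff_mk]
  simp only [Finset.sum_apply]

theorem integrable_coeff_bchStar {f g : PowerSeries (Module.Dual ℝ L → 𝕜)}
    (hf : ∀ r, IsTestFunction e (PowerSeries.coeff r f))
    (hg : ∀ r, IsTestFunction e (PowerSeries.coeff r g)) (r : ℕ) :
    Integrable fun ξ => PowerSeries.coeff r (bchStar e f g) (dualCoords e ξ) := by
  simp only [coeff_bchStar_apply]
  exact integrable_finsetSum _ fun s _ => integrable_finsetSum _ fun t _ =>
    integrable_cochain e s.1 (hf t.1) (hg t.2)

theorem integral_coeff_bchStar_comm (hu : ∀ x, ∑ i, e.repr ⁅e i, x⁆ i = 0)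
    {f g : PowerSeries (Module.Dual ℝ L → 𝕜)}
    (hf : ∀ r, IsTestFunction e (PowerSeries.coeff r f))
    (hg : ∀ r, IsTestFunction e (PowerSeries.coeff r g)) (r : ℕ) :
    ∫ ξ, PowerSeries.coeff r (bchStar e f g) (dualCoords e ξ) =
      ∫ ξ, PowerSeries.coeff r (bchStar e g f) (dualCoords e ξ) := by
  simp only [coeff_bchStar_apply]
  rw [integral_finsetSum _ fun s _ => integrable_finsetSum _ fun t _ =>
      integrable_cochain e s.1 (hf t.1) (hg t.2),
    integral_finsetSum _ fun s _ => integrable_finsetSum _ fun t _ =>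
      integrable_cochain e s.1 (hg t.1) (hf t.2)]
  refine Finset.sum_congr rfl fun s _ => ?_
  rw [integral_finsetSum _ fun t _ => integrable_cochain e s.1 (hf t.1) (hg t.2),
    integral_finsetSum _ fun t _ => integrable_cochain e s.1 (hg t.1) (hf t.2)]
  -- Exchanging `f` and `g` exchanges the orders of their coefficients, while the order of the
  -- operator stays fixed.
  exact Finset.sum_nbij' Prod.swap Prod.swap
    (fun t ht => Finset.HasAntidiagonal.swap_mem_antidiagonal.2 ht)
    (fun t ht => Finset.HasAntidiagonal.swap_mem_antidiagonal.2 ht)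
    (fun _ _ => rfl) (fun _ _ => rfl)
    fun t _ => integral_cochain_comm e hu s.1 (hf _) (hg _)

/-- The star product of a unimodular Lie algebra is strongly closed. -/
theorem stronglyClosed_of_unimodular (hu : ∀ x, ∑ i, e.repr ⁅e i, x⁆ i = 0)
    {f g : PowerSeries (Module.Dual ℝ L → 𝕜)}
    (hf : ∀ r, IsTestFunction e (PowerSeries.coeff r f))
    (hg : ∀ r, IsTestFunction e (PowerSeries.coeff r g)) (r : ℕ) :
    (Integrable fun ξ : ι → ℝ =>
        PowerSeries.coeff r (bchStar e f g - bchStar e g f) (dualCoords e ξ)) ∧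
      ∫ ξ : ι → ℝ,
        PowerSeries.coeff r (bchStar e f g - bchStar e g f) (dualCoords e ξ) = 0 := by
  simp only [map_sub, Pi.sub_apply]
  refine ⟨(integrable_coeff_bchStar e hf hg r).sub (integrable_coeff_bchStar e hg hf r), ?_⟩
  rw [integral_sub (integrable_coeff_bchStar e hf hg r) (integrable_coeff_bchStar e hg hf r),
    integral_coeff_bchStar_comm e hu hf hg, sub_self]

end StarProduct

end

end BCH

namespace BCH

noncomputable section

/-! ### Left and right translations of a Lie group in the chart at the identity -/

section Jacobi

/-- The derivative of the determinant at the identity is the trace. -/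
theorem hasDerivAt_matrix_det {ι : Type*} [Fintype ι] [DecidableEq ι] {A : ℝ → Matrix ι ι ℝ}
    {A' : Matrix ι ι ℝ} (h : ∀ i j, HasDerivAt (fun t => A t i j) (A' i j) 0) (h0 : A 0 = 1) :
    HasDerivAt (fun t => (A t).det) A'.trace 0 := by
  simp only [Matrix.det_apply, zsmul_eq_mul, Units.smul_def]
  have h1 := HasDerivAt.fun_sum (u := Finset.univ) fun (σ : Equiv.Perm ι) _ =>
    (HasDerivAt.fun_finsetProd (u := Finset.univ) fun i _ => h (σ i) i).const_mul
      ((Equiv.Perm.sign σ : ℤ) : ℝ)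
  refine h1.congr_deriv ?_
  have h0' : ∀ i j, A 0 i j = if i = j then 1 else 0 := fun i j => by rw [h0, Matrix.one_apply]
  simp only [h0']
  rw [Finset.sum_eq_single 1]
  · simp [Matrix.trace]
  · intro σ _ hσ
    rw [Finset.sum_eq_zero fun i _ => ?_, mul_zero]
    -- A permutation other than the identity moves at least two points, so an off-diagonal entry of
    -- the identity matrix survives when the factor `i` is differentiated.
    obtain ⟨j, hj, hj'⟩ : ∃ j, j ≠ i ∧ σ j ≠ j := by
      by_contra! hc
      refine hσ (Equiv.ext fun j => ?_)
      by_cases hj : j = i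
      · subst hj
        by_contra hne
        exact hne (σ.injective (hc _ hne))
      · exact hc j hj
    rw [Finset.prod_eq_zero (Finset.mem_erase.2 ⟨hj, Finset.mem_univ j⟩)
      (if_neg hj'), zero_smul]
  · simp

theorem hasDerivAt_det {ι : Type*} [Fintype ι] {E : Type*} [NormedAddCommGroup E]
    [NormedSpace ℝ E] (e : Module.Basis ι ℝ E) {A : ℝ → E →L[ℝ] E} {A' : E →L[ℝ] E}
    (h : HasDerivAt A A' 0) (h0 : A 0 = .id ℝ E) :
    HasDerivAt (fun t => (A t).det) (∑ i, e.repr (A' (e i)) i) 0 := by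
  classical
  have : FiniteDimensional ℝ E := e.finiteDimensional_of_finite
  have h1 : ∀ i j, HasDerivAt (fun t => LinearMap.toMatrix e e (A t : E →ₗ[ℝ] E) i j)
      (LinearMap.toMatrix e e (A' : E →ₗ[ℝ] E) i j) 0 := fun i j => by
    simp only [LinearMap.toMatrix_apply]
    have h2 := (LinearMap.toContinuousLinearMap (e.coord i)).hasFDerivAt.comp_hasDerivAt (0 : ℝ)
      (h.clm_apply (hasDerivAt_const 0 (e j)))
    refine h2.congr_deriv ?_
    simp
  have h3 := hasDerivAt_matrix_det h1 (by rw [h0]; exact LinearMap.toMatrix_id e)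
  simp only [LinearMap.det_toMatrix] at h3
  refine h3.congr_deriv ?_
  simp [Matrix.trace, LinearMap.toMatrix_apply]

end Jacobi

section ModelDerivative

variable {E : Type*} [NormedAddCommGroup E] [NormedSpace ℝ E]
  {M : Type*} [TopologicalSpace M] [ChartedSpace E M]
  {N : Type*} [TopologicalSpace N] [ChartedSpace E N]
  {P : Type*} [TopologicalSpace P] [ChartedSpace E P]

/-- The derivative of a map between manifolds modelled on `E`, as an endomorphism of `E`. -/
def modelDeriv (f : M → N) (x : M) : E →L[ℝ] E := mfderiv 𝓘(ℝ, E) 𝓘(ℝ, E) f x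

theorem modelDeriv_comp {g : N → P} {f : M → N} {x : M}
    (hg : MDifferentiableAt 𝓘(ℝ, E) 𝓘(ℝ, E) g (f x))
    (hf : MDifferentiableAt 𝓘(ℝ, E) 𝓘(ℝ, E) f x) :
    modelDeriv (E := E) (fun y => g (f y)) x = modelDeriv g (f x) ∘L modelDeriv f x :=
  mfderiv_comp x hg hf

theorem modelDeriv_congr {f g : M → N} {x : M} (h : ∀ᶠ y in nhds x, f y = g y) :
    modelDeriv (E := E) f x = modelDeriv g x :=
  Filter.EventuallyEq.mfderiv_eq h

theorem modelDeriv_eq_fderiv (f : E → E) (x : E) : modelDeriv f x = fderiv ℝ f x :=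
  mfderiv_eq_fderiv

theorem modelDeriv_id (x : M) : modelDeriv (E := E) (fun y : M => y) x = .id ℝ E :=
  mfderiv_id

end ModelDerivative

section LieGroup

variable {E : Type*} [NormedAddCommGroup E] [NormedSpace ℝ E]
  (G : Type*) [TopologicalSpace G] [ChartedSpace E G] [Group G] [LieGroup 𝓘(ℝ, E) ∞ G]

/-- The chart at the identity. -/
def unitChart (E G : Type*) [NormedAddCommGroup E] [NormedSpace ℝ E] [TopologicalSpace G]
    [ChartedSpace E G] [Group G] : PartialEquiv G E := extChartAt 𝓘(ℝ, E) (1 : G)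

/-- The multiplication in the chart at the identity. -/
def localMul (p : E × E) : E :=
  unitChart E G ((unitChart E G).symm p.1 * (unitChart E G).symm p.2)

theorem unitChart_symm_one : (unitChart E G).symm (unitChart E G (1 : G) : E) = 1 :=
  extChartAt_to_inv _

variable {G} in
theorem mdifferentiableAt_of_contMDiff {M N : Type*} [TopologicalSpace M] [ChartedSpace E M]
    [TopologicalSpace N] [ChartedSpace E N] {f : M → N}
    (hf : ContMDiff 𝓘(ℝ, E) 𝓘(ℝ, E) ∞ f) (x : M) : MDifferentiableAt 𝓘(ℝ, E) 𝓘(ℝ, E) f x :=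
  hf.mdifferentiableAt (by simp)

theorem isManifold_one : IsManifold 𝓘(ℝ, E) 1 G :=
  have : IsManifold 𝓘(ℝ, E) ∞ G := ContMDiffMul.toIsManifold
  IsManifold.of_le (n := ∞) (by simp)

theorem contDiffAt_localMul :
    ContDiffAt ℝ ∞ (localMul G) ((unitChart E G 1 : E), (unitChart E G 1 : E)) := by
  have : IsManifold 𝓘(ℝ, E) ∞ G := ContMDiffMul.toIsManifold
  have hs : ContMDiffAt 𝓘(ℝ, E) 𝓘(ℝ, E) ∞ (unitChart E G).symm (unitChart E G 1 : E) :=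
    (contMDiffOn_extChartAt_symm (1 : G)).contMDiffAt (extChartAt_target_mem_nhds _)
  have h1 : ContMDiffAt 𝓘(ℝ, E × E) 𝓘(ℝ, E) ∞ (fun p : E × E => (unitChart E G).symm p.1)
      ((unitChart E G 1 : E), (unitChart E G 1 : E)) :=
    ContMDiffAt.comp _ hs contDiff_fst.contMDiff.contMDiffAt
  have h2 : ContMDiffAt 𝓘(ℝ, E × E) 𝓘(ℝ, E) ∞ (fun p : E × E => (unitChart E G).symm p.2)
      ((unitChart E G 1 : E), (unitChart E G 1 : E)) :=
    ContMDiffAt.comp _ hs contDiff_snd.contMDiff.contMDiffAt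
  have h3 := h1.mul h2
  refine contMDiffAt_iff_contDiffAt.1 (ContMDiffAt.comp _ ?_ h3)
  dsimp only
  rw [unitChart_symm_one, mul_one]
  exact contMDiffAt_extChartAt

theorem eventually_differentiableAt_localMul :
    ∀ᶠ p in nhds ((unitChart E G 1 : E), (unitChart E G 1 : E)),
      DifferentiableAt ℝ (localMul G) p := by
  have := ((contDiffAt_localMul (E := E) G).of_le (m := 1) (by simp)).eventually (by simp)
  exact this.mono fun p hp => hp.differentiableAt (by simp)

variable {G}

theorem eventually_mem_source : ∀ᶠ a in nhds (1 : G), a ∈ (unitChart E G).source :=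
  extChartAt_source_mem_nhds _

theorem localMul_unitChart {a b : G} (ha : a ∈ (unitChart E G).source)
    (hb : b ∈ (unitChart E G).source) :
    localMul G ((unitChart E G a : E), (unitChart E G b : E)) = unitChart E G (a * b) := by
  rw [localMul, (unitChart E G).left_inv ha, (unitChart E G).left_inv hb]

theorem modelDeriv_unitChart_one : modelDeriv (unitChart E G) (1 : G) = .id ℝ E :=
  have := isManifold_one (E := E) G
  mfderiv_extChartAt_self

theorem mdifferentiableAt_unitChart {a : G} (ha : a ∈ (unitChart E G).source) :
    MDifferentiableAt 𝓘(ℝ, E) 𝓘(ℝ, E) (unitChart E G) a :=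
  have := isManifold_one (E := E) G
  mdifferentiableAt_extChartAt (by rwa [← extChartAt_source 𝓘(ℝ, E)])

theorem mdifferentiableAt_mul_left (a b : G) :
    MDifferentiableAt 𝓘(ℝ, E) 𝓘(ℝ, E) (fun h => a * h) b :=
  mdifferentiableAt_of_contMDiff (contMDiff_mul_left (n := ∞)) b

theorem mdifferentiableAt_mul_right (a b : G) :
    MDifferentiableAt 𝓘(ℝ, E) 𝓘(ℝ, E) (fun h => h * a) b :=
  mdifferentiableAt_of_contMDiff (contMDiff_mul_right (n := ∞)) b

theorem mdifferentiableAt_conj (a b : G) :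
    MDifferentiableAt 𝓘(ℝ, E) 𝓘(ℝ, E) (fun h => a * h * a⁻¹) b :=
  mdifferentiableAt_of_contMDiff
    ((contMDiff_mul_right (n := ∞) (a := a⁻¹)).comp (contMDiff_mul_left (n := ∞) (a := a))) b

/-- Chain rule for `h ↦ a * h` read in the chart, whose derivative at the identity is the identity
map. -/
theorem fderiv_localMul_inr {a : G} (ha : a ∈ (unitChart E G).source)
    (hd : DifferentiableAt ℝ (localMul G) ((unitChart E G a : E), (unitChart E G 1 : E))) :
    fderiv ℝ (localMul G) ((unitChart E G a : E), (unitChart E G 1 : E)) ∘L .inr ℝ E E =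
      modelDeriv (unitChart E G) a ∘L modelDeriv (E := E) (fun h : G => a * h) 1 := by
  have h1 : HasFDerivAt (𝕜 := ℝ) (fun v : E => localMul G ((unitChart E G a : E), v))
      (fderiv ℝ (localMul G) ((unitChart E G a : E), (unitChart E G 1 : E)) ∘L .inr ℝ E E)
      (unitChart E G 1) :=
    HasFDerivAt.comp (unitChart E G 1 : E) hd.hasFDerivAt (hasFDerivAt_prodMk_right _ _)
  have h2 := modelDeriv_comp (E := E) (g := fun v : E => localMul G ((unitChart E G a : E), v))
    (f := unitChart E G) (x := (1 : G)) h1.differentiableAt.mdifferentiableAt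
    (mdifferentiableAt_unitChart (E := E) (mem_extChartAt_source _))
  rw [modelDeriv_eq_fderiv, h1.fderiv, modelDeriv_unitChart_one, ContinuousLinearMap.comp_id,
    modelDeriv_congr (eventually_mem_source.mono fun h hh => localMul_unitChart ha hh),
    modelDeriv_comp (f := fun h : G => a * h) _ (mdifferentiableAt_mul_left a 1), mul_one] at h2
  · exact h2.symm
  · rw [mul_one]; exact mdifferentiableAt_unitChart ha

theorem fderiv_localMul_inl {a : G} (ha : a ∈ (unitChart E G).source)
    (hd : DifferentiableAt ℝ (localMul G) ((unitChart E G 1 : E), (unitChart E G a : E))) :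
    fderiv ℝ (localMul G) ((unitChart E G 1 : E), (unitChart E G a : E)) ∘L .inl ℝ E E =
      modelDeriv (unitChart E G) a ∘L modelDeriv (E := E) (fun h : G => h * a) 1 := by
  have h1 : HasFDerivAt (fun v : E => localMul G (v, (unitChart E G a : E)))
      (fderiv ℝ (localMul G) ((unitChart E G 1 : E), (unitChart E G a : E)) ∘L .inl ℝ E E)
      (unitChart E G 1) :=
    HasFDerivAt.comp (g := localMul G) (f := fun v : E => (v, unitChart E G a)) (unitChart E G 1)
      hd.hasFDerivAt (hasFDerivAt_prodMk_left _ _)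
  have h2 := modelDeriv_comp (E := E) (g := fun v : E => localMul G (v, (unitChart E G a : E)))
    (f := unitChart E G) (x := (1 : G)) h1.differentiableAt.mdifferentiableAt
    (mdifferentiableAt_unitChart (E := E) (mem_extChartAt_source _))
  rw [modelDeriv_eq_fderiv, h1.fderiv, modelDeriv_unitChart_one, ContinuousLinearMap.comp_id,
    modelDeriv_congr (eventually_mem_source.mono fun h hh => localMul_unitChart hh ha),
    modelDeriv_comp (f := fun h : G => h * a) _ (mdifferentiableAt_mul_right a 1), one_mul] at h2
  · exact h2.symm
  · rw [one_mul]; exact mdifferentiableAt_unitChart ha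

/-- The adjoint representation. -/
def adjointMap (a : G) : E →L[ℝ] E := modelDeriv (fun h : G => a * h * a⁻¹) 1

/-- Differentiate `(a * h * a⁻¹) * a = a * h` at `h = 1`. -/
theorem modelDeriv_mul_right_comp_adjointMap (a : G) :
    modelDeriv (fun h : G => h * a) 1 ∘L adjointMap a =
      (modelDeriv (fun h : G => a * h) 1 : E →L[ℝ] E) := by
  have h := modelDeriv_comp (E := E) (x := (1 : G)) (mdifferentiableAt_mul_right a _)
    (mdifferentiableAt_conj a 1)
  simp only [mul_one, mul_inv_cancel, inv_mul_cancel_right] at h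
  exact h.symm

theorem adjointMap_mul (a b : G) :
    (adjointMap (a * b) : E →L[ℝ] E) = adjointMap a ∘L adjointMap b := by
  have h := modelDeriv_comp (E := E) (x := (1 : G)) (mdifferentiableAt_conj a _)
    (mdifferentiableAt_conj b 1)
  simp only [mul_one, mul_inv_cancel] at h
  rw [adjointMap, adjointMap, adjointMap, ← h]
  simp only [mul_inv_rev, mul_assoc]

theorem adjointMap_one : (adjointMap (1 : G) : E →L[ℝ] E) = .id ℝ E := by
  have := modelDeriv_id (E := E) (1 : G)
  simpa only [adjointMap, one_mul, inv_one, mul_one] using this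

/-- The derivative of left multiplication at the identity in the chart. -/
def leftDeriv (G : Type*) [TopologicalSpace G] [ChartedSpace E G] [Group G] (u : E) : E →L[ℝ] E :=
  fderiv ℝ (localMul G) (u, (unitChart E G 1 : E)) ∘L .inr ℝ E E

/-- The derivative of right multiplication at the identity in the chart. -/
def rightDeriv (G : Type*) [TopologicalSpace G] [ChartedSpace E G] [Group G] (u : E) :
    E →L[ℝ] E :=
  fderiv ℝ (localMul G) ((unitChart E G 1 : E), u) ∘L .inl ℝ E E

variable (G) in
/-- The second derivative of the multiplication at the identity. -/
def mulHessian : E × E →L[ℝ] E × E →L[ℝ] E :=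
  fderiv ℝ (fderiv ℝ (localMul G)) ((unitChart E G 1 : E), (unitChart E G 1 : E))

variable (G) in
theorem hasFDerivAt_fderiv_localMul :
    HasFDerivAt (fderiv ℝ (localMul G)) (mulHessian (E := E) G)
      ((unitChart E G 1 : E), (unitChart E G 1 : E)) :=
  (((contDiffAt_localMul G).fderiv_right (m := 1) (by norm_cast)).differentiableAt
    (by simp)).hasFDerivAt

theorem mulHessian_symm (v w : E × E) : mulHessian G v w = mulHessian G w v :=
  (contDiffAt_localMul G).isSymmSndFDerivAt (by simp; norm_cast) v w

variable (G) in
theorem hasFDerivAt_leftDeriv :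
    HasFDerivAt (leftDeriv (E := E) G)
      ((ContinuousLinearMap.compL ℝ E (E × E) E).flip (.inr ℝ E E) ∘L
        mulHessian G ∘L .inl ℝ E E) (unitChart E G 1) :=
  ((ContinuousLinearMap.compL ℝ E (E × E) E).flip (.inr ℝ E E)).hasFDerivAt.comp _
    (HasFDerivAt.comp (unitChart E G 1 : E) (hasFDerivAt_fderiv_localMul G)
      (hasFDerivAt_prodMk_left _ _))

variable (G) in
theorem hasFDerivAt_rightDeriv :
    HasFDerivAt (rightDeriv (E := E) G)
      ((ContinuousLinearMap.compL ℝ E (E × E) E).flip (.inl ℝ E E) ∘L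
        mulHessian G ∘L .inr ℝ E E) (unitChart E G 1) :=
  ((ContinuousLinearMap.compL ℝ E (E × E) E).flip (.inl ℝ E E)).hasFDerivAt.comp _
    (HasFDerivAt.comp (unitChart E G 1 : E) (hasFDerivAt_fderiv_localMul G)
      (hasFDerivAt_prodMk_right _ _))

variable (G) in
theorem eventually_mem_target : ∀ᶠ u in nhds (unitChart E G 1 : E), u ∈ (unitChart E G).target :=
  extChartAt_target_mem_nhds _

variable (G) in
theorem eventually_leftDeriv_eq : ∀ᶠ u in nhds (unitChart E G 1 : E),
    leftDeriv G u = modelDeriv (unitChart E G) ((unitChart E G).symm u) ∘L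
      modelDeriv (E := E) (fun h : G => (unitChart E G).symm u * h) 1 := by
  have h1 : ContinuousAt (fun u : E => (u, (unitChart E G 1 : E))) (unitChart E G 1 : E) :=
      by fun_prop
  filter_upwards [eventually_mem_target G,
    h1.eventually (eventually_differentiableAt_localMul G)] with u hu hd
  rw [leftDeriv, ← fderiv_localMul_inr ((unitChart E G).map_target hu),
    (unitChart E G).right_inv hu]
  rwa [(unitChart E G).right_inv hu]

variable (G) in
theorem eventually_rightDeriv_eq : ∀ᶠ u in nhds (unitChart E G 1 : E),
    rightDeriv G u = modelDeriv (unitChart E G) ((unitChart E G).symm u) ∘L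
      modelDeriv (E := E) (fun h : G => h * (unitChart E G).symm u) 1 := by
  have h1 : ContinuousAt (fun u : E => ((unitChart E G 1 : E), u)) (unitChart E G 1 : E) :=
      by fun_prop
  filter_upwards [eventually_mem_target G,
    h1.eventually (eventually_differentiableAt_localMul G)] with u hu hd
  rw [rightDeriv, ← fderiv_localMul_inl ((unitChart E G).map_target hu),
    (unitChart E G).right_inv hu]
  rwa [(unitChart E G).right_inv hu]

variable (G) in
theorem eventually_rightDeriv_comp_adjointMap : ∀ᶠ u in nhds (unitChart E G 1 : E),
    rightDeriv G u ∘L adjointMap ((unitChart E G).symm u) = leftDeriv G u := by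
  filter_upwards [eventually_leftDeriv_eq G, eventually_rightDeriv_eq G] with u h1 h2
  rw [h1, h2, ContinuousLinearMap.comp_assoc, modelDeriv_mul_right_comp_adjointMap]

variable (G) in
theorem leftDeriv_one : leftDeriv G (unitChart E G 1 : E) = .id ℝ E := by
  rw [(eventually_leftDeriv_eq G).self_of_nhds, unitChart_symm_one, modelDeriv_unitChart_one]
  simp only [one_mul]
  rw [modelDeriv_id, ContinuousLinearMap.comp_id]

variable (G) in
theorem rightDeriv_one : rightDeriv G (unitChart E G 1 : E) = .id ℝ E := by
  rw [(eventually_rightDeriv_eq G).self_of_nhds, unitChart_symm_one, modelDeriv_unitChart_one]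
  simp only [mul_one]
  rw [modelDeriv_id, ContinuousLinearMap.comp_id]

theorem eventually_mpullbackWithin_eq (y : E) :
    ∀ᶠ u in nhds (unitChart E G 1 : E),
      VectorField.mpullbackWithin 𝓘(ℝ, E) 𝓘(ℝ, E) (extChartAt 𝓘(ℝ, E) (1 : G)).symm
        (mulInvariantVectorField (I := 𝓘(ℝ, E)) (G := G) y) (Set.range 𝓘(ℝ, E)) u =
          leftDeriv G u y := by
  have := isManifold_one (E := E) G
  filter_upwards [eventually_mem_target G, eventually_leftDeriv_eq G] with u hu h1
  rw [VectorField.mpullbackWithin_apply, h1, ContinuousLinearMap.inverse_eq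
    (mfderivWithin_extChartAt_symm_comp_mfderiv_extChartAt hu)
    (mfderiv_extChartAt_comp_mfderivWithin_extChartAt_symm hu)]
  rfl

/-- In the chart the left-invariant field of `z` is `u ↦ leftDeriv G u z`, equal to `z` at the
identity. The Lie bracket of two such fields there is the antisymmetrized mixed second derivative of
the multiplication. -/
theorem bracket_eq_mulHessian (x y : E) :
    Bracket.bracket (L := GroupLieAlgebra 𝓘(ℝ, E) G) (M := GroupLieAlgebra 𝓘(ℝ, E) G) x y =
      (mulHessian G (x, 0) (0, y) - mulHessian G (y, 0) (0, x) : E) := by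
  have := isManifold_one (E := E) G
  have hD : ∀ z w : E, fderiv ℝ (fun u => leftDeriv G u z) (unitChart E G 1 : E) w =
      mulHessian G (w, (0 : E)) ((0 : E), z) := fun z w => by
    rw [((hasFDerivAt_leftDeriv G).clm_apply (hasFDerivAt_const z _)).fderiv]
    simp
  let V : E → E → E := fun z => VectorField.mpullbackWithin 𝓘(ℝ, E) 𝓘(ℝ, E)
    (extChartAt 𝓘(ℝ, E) (1 : G)).symm (mulInvariantVectorField (I := 𝓘(ℝ, E)) (G := G) z)
    (Set.range 𝓘(ℝ, E))
  have hV : ∀ z, ∀ᶠ u in nhds (unitChart E G 1), V z u = leftDeriv G u z :=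
    eventually_mpullbackWithin_eq
  change (modelDeriv (unitChart E G) (1 : G)).inverse (VectorField.lieBracketWithin ℝ (V x) (V y)
    ((extChartAt 𝓘(ℝ, E) (1 : G)).symm ⁻¹' Set.univ ∩ Set.range 𝓘(ℝ, E)) (unitChart E G 1)) = _
  rw [modelDeriv_unitChart_one, ContinuousLinearMap.inverse_id, ContinuousLinearMap.id_apply,
    Filter.EventuallyEq.lieBracketWithin_vectorField_eq_nhds (hV x) (hV y), Set.preimage_univ,
    Set.univ_inter,
    modelWithCornersSelf_coe, Set.range_id, VectorField.lieBracketWithin_univ,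
    VectorField.lieBracket, hD, hD, leftDeriv_one]
  rfl

/-! ### Unimodularity of compact Lie groups -/

section Unimodular

/-- `Ad` is the quotient of the left by the right Jacobian, whose determinants tend to `1`. Near the
identity they are below `2` and above `1 / 2` in absolute value, whence the bound `4`. -/
theorem eventually_abs_det_adjointMap_le :
    ∀ᶠ a in nhds (1 : G), |(adjointMap a : E →L[ℝ] E).det| ≤ 4 := by
  have hc : ∀ {F : E → E →L[ℝ] E} {F' : E →L[ℝ] E →L[ℝ] E}, HasFDerivAt F F' (unitChart E G 1) →
      F (unitChart E G 1) = .id ℝ E →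
      Filter.Tendsto (fun u => |(F u).det|) (nhds (unitChart E G 1)) (nhds 1) :=
    fun {F F'} hF h1 => by
      have h2 := (ContinuousLinearMap.continuous_det.continuousAt.comp hF.continuousAt).abs
      have h3 : |(F (unitChart E G 1)).det| = 1 := by
        rw [h1]
        change |LinearMap.det (LinearMap.id : E →ₗ[ℝ] E)| = 1
        simp
      rw [← h3]
      exact h2
  have hφ : Filter.Tendsto (unitChart E G) (nhds 1) (nhds (unitChart E G 1)) :=
    continuousAt_extChartAt (1 : G)
  filter_upwards [eventually_mem_source (E := E) (G := G),
    hφ.eventually (eventually_rightDeriv_comp_adjointMap G),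
    hφ.eventually ((hc (hasFDerivAt_leftDeriv G) (leftDeriv_one G)).eventually
      (gt_mem_nhds (show (1 : ℝ) < 2 by norm_num))),
    hφ.eventually ((hc (hasFDerivAt_rightDeriv G) (rightDeriv_one G)).eventually
      (lt_mem_nhds (show (1 / 2 : ℝ) < 1 by norm_num)))] with a ha h1 h2 h3
  rw [(unitChart E G).left_inv ha] at h1
  have h4 : (rightDeriv G (unitChart E G a)).det * (adjointMap a : E →L[ℝ] E).det =
      (leftDeriv G (unitChart E G a)).det := by
    rw [← h1]
    exact (LinearMap.det_comp _ _).symm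
  have h5 := congrArg abs h4
  rw [abs_mul] at h5
  nlinarith [abs_nonneg (adjointMap a : E →L[ℝ] E).det]

theorem det_adjointMap_mul (a b : G) : (adjointMap (a * b) : E →L[ℝ] E).det =
    (adjointMap a : E →L[ℝ] E).det * (adjointMap b : E →L[ℝ] E).det := by
  rw [adjointMap_mul]
  exact LinearMap.det_comp _ _

theorem det_adjointMap_one : (adjointMap (1 : G) : E →L[ℝ] E).det = 1 := by
  rw [adjointMap_one]
  exact LinearMap.det_id

/-- Finitely many translates of the neighbourhood where the local bound holds cover the group, and
`det Ad` is multiplicative. Only boundedness near the identity is used, not continuity of `Ad`. -/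
theorem exists_abs_det_adjointMap_le [CompactSpace G] :
    ∃ C, ∀ a : G, |(adjointMap a : E →L[ℝ] E).det| ≤ C := by
  obtain ⟨t, ht⟩ := CompactSpace.elim_nhds_subcover
    (fun a : G => (fun b => a⁻¹ * b) ⁻¹' {b | |(adjointMap b : E →L[ℝ] E).det| ≤ 4}) fun a => by
      have h1 : Filter.Tendsto (fun b : G => a⁻¹ * b) (nhds a) (nhds 1) := by
        have : IsTopologicalGroup G := topologicalGroup_of_lieGroup 𝓘(ℝ, E) ∞
        have h2 : ContinuousAt (fun b : G => a⁻¹ * b) a := (continuous_const_mul _).continuousAt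
        simpa [ContinuousAt] using h2
      exact h1.eventually eventually_abs_det_adjointMap_le
  refine ⟨∑ a ∈ t, |(adjointMap a : E →L[ℝ] E).det| * 4, fun b => ?_⟩
  have hb : b ∈ ⋃ a ∈ t, (fun b => a⁻¹ * b) ⁻¹' {b | |(adjointMap b : E →L[ℝ] E).det| ≤ 4} := by
    rw [ht]; trivial
  simp only [Set.mem_iUnion] at hb
  obtain ⟨a, ha, hab⟩ := hb
  have h1 : (adjointMap b : E →L[ℝ] E).det =
      (adjointMap a : E →L[ℝ] E).det * (adjointMap (a⁻¹ * b) : E →L[ℝ] E).det := by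
    rw [← det_adjointMap_mul, mul_inv_cancel_left]
  rw [h1, abs_mul]
  exact (mul_le_mul_of_nonneg_left hab (abs_nonneg _)).trans
    (Finset.single_le_sum (f := fun a => |(adjointMap a : E →L[ℝ] E).det| * 4)
      (fun _ _ => by positivity) ha)

/-- The adjoint representation of a compact Lie group has determinant `±1`. -/
theorem abs_det_adjointMap [CompactSpace G] (a : G) :
    |(adjointMap a : E →L[ℝ] E).det| = 1 := by
  obtain ⟨C, hC⟩ := exists_abs_det_adjointMap_le (E := E) (G := G)
  have hpow : ∀ (a : G) (k : ℕ),
      |(adjointMap (a ^ k) : E →L[ℝ] E).det| = |(adjointMap a : E →L[ℝ] E).det| ^ k := fun a k => by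
    induction k with
    | zero => rw [pow_zero, pow_zero, det_adjointMap_one, abs_one]
    | succ k ih => rw [pow_succ, pow_succ, det_adjointMap_mul, abs_mul, ih]
  -- If the value at `a` exceeded `1`, its powers, which are the values at `a ^ k`, would be
  -- unbounded.
  have hle : ∀ a : G, |(adjointMap a : E →L[ℝ] E).det| ≤ 1 := fun a => by
    by_contra! h
    obtain ⟨k, hk⟩ := pow_unbounded_of_one_lt C h
    exact (hk.trans_le ((hpow a k).symm.le.trans (hC _))).false
  have h1 : |(adjointMap a : E →L[ℝ] E).det| * |(adjointMap a⁻¹ : E →L[ℝ] E).det| = 1 := by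
    rw [← abs_mul, ← det_adjointMap_mul, mul_inv_cancel, det_adjointMap_one, abs_one]
  nlinarith [hle a, hle a⁻¹, abs_nonneg (adjointMap a : E →L[ℝ] E).det]

variable {ι : Type*} [Fintype ι]

/-- The two traces are the derivatives at the identity, in direction `x`, of the determinants of
left and right translation. These determinants have equal squares because `|det Ad| = 1`. -/
theorem sum_repr_mulHessian_eq [CompactSpace G] (e : Module.Basis ι ℝ E) (x : E) :
    ∑ i, e.repr (mulHessian G (x, 0) (0, e i)) i = ∑ i, e.repr (mulHessian G (0, x) (e i,
      0)) i := by
  have hline : HasDerivAt (fun t : ℝ => unitChart E G 1 + t • x) x 0 := by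
    simpa using ((hasDerivAt_id (0 : ℝ)).smul_const x).const_add (unitChart E G 1)
  have h0 : unitChart E G 1 + (0 : ℝ) • x = unitChart E G 1 := by simp
  have hL := hasDerivAt_det e (HasFDerivAt.comp_hasDerivAt_of_eq (0 : ℝ)
    (hasFDerivAt_leftDeriv G) hline h0.symm)
    (by rw [Function.comp_apply, h0, leftDeriv_one])
  have hR := hasDerivAt_det e (HasFDerivAt.comp_hasDerivAt_of_eq (0 : ℝ)
    (hasFDerivAt_rightDeriv G) hline h0.symm)
    (by rw [Function.comp_apply, h0, rightDeriv_one])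
  have ht : Filter.Tendsto (fun t : ℝ => unitChart E G 1 + t • x) (nhds 0)
      (nhds (unitChart E G 1)) := by
    have := hline.continuousAt.tendsto
    rwa [h0] at this
  -- Squares remove the sign ambiguity of `det Ad`; since both determinants equal `1` at `t = 0`,
  -- differentiating the squares only doubles the traces.
  have heq : (fun t : ℝ => (leftDeriv G (unitChart E G 1 + t • x)).det ^ 2) =ᶠ[nhds 0]
      fun t : ℝ => (rightDeriv G (unitChart E G 1 + t • x)).det ^ 2 := by
    filter_upwards [ht.eventually (eventually_rightDeriv_comp_adjointMap G)] with t h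
    rw [← h]
    change LinearMap.det (_ ∘ₗ _) ^ 2 = _
    rw [LinearMap.det_comp, mul_pow]
    have h1 := abs_det_adjointMap (E := E) ((unitChart E G).symm (unitChart E G 1 + t • x))
    have h2 : (adjointMap ((unitChart E G).symm (unitChart E G 1 + t • x)) : E →L[ℝ] E).det ^ 2 =
        1 := by rw [← sq_abs, h1, one_pow]
    exact (congrArg _ h2).trans (mul_one _)
  have hone : (ContinuousLinearMap.id ℝ E).det = 1 := LinearMap.det_id
  have hu := ((hL.fun_pow 2).congr_of_eventuallyEq heq.symm).unique (hR.fun_pow 2)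
  simp only [Function.comp_apply, h0, leftDeriv_one, rightDeriv_one, hone] at hu
  simpa using hu

/-- The Lie algebra of a compact Lie group is unimodular. -/
theorem sum_repr_bracket_eq_zero [CompactSpace G]
    (e : Module.Basis ι ℝ (GroupLieAlgebra 𝓘(ℝ, E) G)) (x : GroupLieAlgebra 𝓘(ℝ, E) G) :
    ∑ i, e.repr ⁅e i, x⁆ i = 0 := by
  let e' : Module.Basis ι ℝ E := e
  let x' : E := x
  have h : ∀ i, e.repr ⁅e i, x⁆ i =
      e'.repr (mulHessian G (0, x') (e' i, 0)) i - e'.repr (mulHessian G (x', 0) (0, e' i)) i :=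
    fun i => by
      rw [mulHessian_symm (0, x'), ← Finsupp.sub_apply, ← map_sub]
      exact congrArg (fun y : E => e'.repr y i) (bracket_eq_mulHessian (G := G) (e' i) x')
  rw [Finset.sum_congr rfl fun i _ => h i, Finset.sum_sub_distrib, sum_repr_mulHessian_eq, sub_self]

end Unimodular

end LieGroup

end

end BCH

theorem mainTheorem10 {n : ℕ} {G : Type*} [TopologicalSpace G] [T2Space G] [CompactSpace G]
    [ChartedSpace (EuclideanSpace ℝ (Fin n)) G] [Group G] [LieGroup (𝓡 n) ∞ G]
    (e : Module.Basis (Fin n) ℝ (GroupLieAlgebra (𝓡 n) G))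
    {𝕜 : Type*} [RCLike 𝕜]
    (f g : PowerSeries (Module.Dual ℝ (GroupLieAlgebra (𝓡 n) G) → 𝕜))
    (hf : ∀ r, BCH.IsTestFunction e (PowerSeries.coeff r f))
    (hg : ∀ r, BCH.IsTestFunction e (PowerSeries.coeff r g))
    (r : ℕ) :
    Integrable (fun ξ : Fin n → ℝ =>
        PowerSeries.coeff r (BCH.bchStar e f g - BCH.bchStar e g f) (BCH.dualCoords e ξ)) volume ∧
      ∫ ξ : Fin n → ℝ,
        PowerSeries.coeff r (BCH.bchStar e f g - BCH.bchStar e g f) (BCH.dualCoords e ξ) = 0 := by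
  -- Compactness of the group enters only through the vanishing of the adjoint traces.
  exact BCH.stronglyClosed_of_unimodular e (BCH.sum_repr_bracket_eq_zero e) hf hg r
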